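/- **Conventions.** $\mathbb C\mathfrak t^{\mathbb R}$ is the set of symbols $c\mathfrak t^{x}$ ($c\in\mathbb C$, $x\in\mathbb R$) with $c_1\mathfrak t^{x}\cdot c_2\mathfrak t^{y}=c_1c_2\mathfrak t^{x+y}$, and with $c_1\mathfrak t^{x}+c_2\mathfrak t^{y}$ equal to the summand of smaller exponent if $x\neq y$ and to $(c_1+c_2)\mathfrak t^{x}$ if $x=y$; $\mathbb C^*\mathfrak t^{\mathbb R}$ is the subset with $c\ne0$. For $x\ge 0$ put $\lceil c\mathfrak t^x\rceil=c$ if $x=0$ and $0$ if $x>0$. An *abstract exploded space* is a topological space $\mathbf B$ with a sheaf $\mathcal E^\times$ of abelian groups of $\mathbb C^*\mathfrak t^{\mathbb R}$-valued functions (*exploded functions*) containing the constants; *smooth maps* are continuous maps that pull exploded functions back to exploded functions. An *integral affine polytope* $P\subset\mathbb R^m$ is a set with nonempty interior given by finitely many inequalities $a+x\cdot\alpha\ge0$ or $a+x\cdot\alpha>0$ with $a\in\mathbb R$, $\alpha\in\mathbb Z^m$. The space $\mathbb R^n\times\mathbf T^m_P$ consists of the $(x,\tilde z)\in\mathbb R^n\times(\mathbb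 C^*\mathfrak t^{\mathbb R})^m$ with exponent vector of $\tilde z$ in $P$. It has the coarsest topology for which $x$ and all $\zeta=\lceil \mathfrak t^{a}\tilde z^{\alpha}\rceil$ are continuous, where $\mathfrak t^a\tilde z^\alpha$ ranges over the monomials with nonnegative exponent on $P$; its exploded functions are those locally of the form $h(x,\zeta_1,\dots,\zeta_N)\,\mathfrak t^{a}\tilde z^{\alpha}$ with such $\zeta_i$, $h$ smooth and $\mathbb C^*$-valued, $a\in\mathbb R$, $\alpha\in\mathbb Z^m$. An *exploded manifold* is an abstract exploded space in which every point has an open neighbourhood isomorphic to some $\mathbb R^n\times\mathbf T^m_P$. Its *smooth part* is its quotient by topological indistinguishability. $C^\infty$ denotes the sheaf of smooth maps to $\mathbb R$ (whose exploded functions are locally $h\mathfrak t^a$, $h$ smooth and $\mathbb C^*$-valued, $a$ constant). An *exploded tropical function* $f\in\mathcal E(\mathbf B)$ is a $\mathbb C\mathfrak t^{\mathbb R}$-valued function that is locally a finite sum of exploded functions. A *tangent vector* $v\in T_p\mathbf B$ is a pair of maps, from germs at $p$ of $C^\infty$ to $\mathbb R$ and from germs at $p$ of $\mathcal E$ to $\mathbb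 C\mathfrak t^{\mathbb R}$, which are additive, satisfy $v(fg)=v(f)g(p)+f(p)v(g)$ and $v(c\mathfrak t^yf)=c\mathfrak t^yv(f)$, and are compatible with the inclusion $C^\infty\to\mathcal E$, $f\mapsto f\mathfrak t^0$. The function $f\in\mathcal E(\mathbf B)$ is *transverse to $0\mathfrak t^{\mathbb R}$* if for every $p$ with $f(p)=0\mathfrak t^{y}$ the derivative $v\mapsto v(f)$ maps $T_p\mathbf B$ onto $\mathbb C\mathfrak t^{y}$. A *refinement* of $\mathbf B$ is a smooth map $r:\mathbf B'\to\mathbf B$ from an exploded manifold that is bijective on points, induces a proper map of smooth parts, and has surjective derivative at every point. A subset $Z\subset\mathbf B$ is an *exploded submanifold of codimension $k$* if there are a refinement $r:\mathbf B'\to\mathbf B$, an exploded manifold $\mathbf A$, and a smooth topological embedding $j:\mathbf A\to\mathbf B'$ with $r(j(\mathbf A))=Z$ such that around every point of $\mathbf A$ there are charts $\mathbb R^n\times\mathbf T^m_P$ of $\mathbf A$ and $\mathbb R^{k+n}\times\mathbf T^m_P$ of $\mathbf B'$ in which $j$ is $(x,\tilde z)\mapsto((0,x),\tilde z)$ and the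 image of $\mathbf A$ is $\{x_1=\dots=x_k=0\}$; if the smooth part of $\mathbf B$ is Hausdorff, those of $\mathbf A$ and $\mathbf B'$ are required to be Hausdorff, too. **Theorem.** Let $\mathbf B$ be an exploded manifold and let $f\in\mathcal E(\mathbf B)$ be an exploded tropical function that is transverse to $0\mathfrak t^{\mathbb R}$. Then the subset $f^{-1}(0\mathfrak t^{\mathbb R})\subset\mathbf B$ is an exploded submanifold of $\mathbf B$ of codimension $2$. -/

import Mathlib

open TopologicalSpace
open scoped ContDiff Topology

universe u v

noncomputable section

/-! ### The exploded semiring -/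

/-- The exploded semiring `ℂ t^ℝ`: the element `c t^x` is `⟨c, x⟩`. -/
@[ext] structure Expl where
  coeff : ℂ
  exp : ℝ

namespace Expl

/-- `(c₁ t^x) (c₂ t^y) = c₁ c₂ t^(x+y)`. -/
instance : Mul Expl := ⟨fun a b => ⟨a.coeff * b.coeff, a.exp + b.exp⟩⟩

open Classical in
/-- The summand with the smaller exponent wins; equal exponents add the coefficients. -/
instance : Add Expl := ⟨fun a b =>
  if a.exp < b.exp then a
  else if b.exp < a.exp then b
  else ⟨a.coeff + b.coeff, a.exp⟩⟩

/-- The inclusion `ι : ℝ → ℂ t^ℝ`, `c ↦ c t^0`. -/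
def ofReal (c : ℝ) : Expl := ⟨(c : ℂ), 0⟩

end Expl

/-- The abelian group `ℂ^* t^ℝ`: the element `c t^x` is `(c, x)`. -/
abbrev ExplUnit : Type := ℂˣ × Multiplicative ℝ

namespace ExplUnit

/-- The exponent `x` of `c t^x`, i.e. its tropical part. -/
def trop (a : ExplUnit) : ℝ := Multiplicative.toAdd a.2

/-- The inclusion `ℂ^* t^ℝ ⊆ ℂ t^ℝ`. -/
def toExpl (a : ExplUnit) : Expl := ⟨(a.1 : ℂ), a.trop⟩

open Classical in
/-- The smooth part of `c t^x`, for `x ≥ 0`: it is `c` if `x = 0` and `0` if `x > 0`. -/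
def smoothPart (a : ExplUnit) : ℂ := if a.trop = 0 then (a.1 : ℂ) else 0

end ExplUnit

/-! ### Abstract exploded spaces -/

/-- The structure of an abstract exploded space on a topological space: a sheaf of abelian groups
of `ℂ^* t^ℝ`-valued functions that contains the constants. A function on an open set `U` is
represented by any of its extensions to the whole space (`congr`: only the values on `U` matter). -/
structure ExplodedSpace (X : Type u) [TopologicalSpace X] where
  sec : Opens X → Subgroup (X → ExplUnit)
  congr : ∀ (U : Opens X) (f g : X → ExplUnit), (∀ p ∈ U, f p = g p) → f ∈ sec U → g ∈ sec U
  const : ∀ (U : Opens X) (a : ExplUnit), (fun _ => a) ∈ sec U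
  restrict : ∀ (U V : Opens X), V ≤ U → ∀ f ∈ sec U, f ∈ sec V
  glue : ∀ (U : Opens X) (f : X → ExplUnit),
    (∀ p ∈ U, ∃ V : Opens X, p ∈ V ∧ V ≤ U ∧ f ∈ sec V) → f ∈ sec U

namespace ExplodedSpace

variable {X : Type u} {Y : Type v} [TopologicalSpace X] [TopologicalSpace Y]

/-- Morphisms (smooth maps): continuous maps that pull exploded functions back to exploded
functions. -/
structure IsMorphism (A : ExplodedSpace X) (B : ExplodedSpace Y) (φ : X → Y) : Prop where
  continuous : Continuous φ
  pullback : ∀ (V : Opens Y) (g : Y → ExplUnit), g ∈ B.sec V →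
    g ∘ φ ∈ A.sec ⟨φ ⁻¹' V, V.isOpen.preimage continuous⟩

/-- `φ` is an isomorphism of abstract exploded spaces from `A` onto an open subset of `B`. -/
structure IsOpenIso (A : ExplodedSpace X) (B : ExplodedSpace Y) (φ : X → Y) : Prop where
  isOpenEmbedding : Topology.IsOpenEmbedding φ
  sec_iff : ∀ (V : Opens Y), (V : Set Y) ⊆ Set.range φ → ∀ g : Y → ExplUnit,
    g ∈ B.sec V ↔ g ∘ φ ∈ A.sec ⟨φ ⁻¹' V, V.isOpen.preimage isOpenEmbedding.continuous⟩

/-- The sheaf of those functions that near every point have a given form; the forms have to contain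
the constants and to be stable under products, inverses and restriction. -/
def ofForm (F : Set X → (X → ExplUnit) → Prop)
    (mono : ∀ V W g, W ⊆ V → F V g → F W g)
    (congr : ∀ V f g, (∀ p ∈ V, f p = g p) → F V f → F V g)
    (const : ∀ V a, F V (fun _ => a))
    (mul : ∀ V f g, F V f → F V g → F V (f * g))
    (inv : ∀ V f, F V f → F V f⁻¹) : ExplodedSpace X where
  sec U :=
    { carrier := {g | ∀ p ∈ U, ∃ V : Opens X, p ∈ V ∧ V ≤ U ∧ F V g}
      one_mem' := fun _ hp => ⟨U, hp, le_rfl, const _ 1⟩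
      mul_mem' := by
        intro f g hf hg p hp
        obtain ⟨V, hpV, hVU, hV⟩ := hf p hp
        obtain ⟨W, hpW, _, hW⟩ := hg p hp
        exact ⟨V ⊓ W, ⟨hpV, hpW⟩, inf_le_left.trans hVU,
          mul _ _ _ (mono _ _ _ Set.inter_subset_left hV) (mono _ _ _ Set.inter_subset_right hW)⟩
      inv_mem' := by
        intro f hf p hp
        obtain ⟨V, hpV, hVU, hV⟩ := hf p hp
        exact ⟨V, hpV, hVU, inv _ _ hV⟩ }
  congr U f g hfg hf := by
    intro p hp
    obtain ⟨V, hpV, hVU, hV⟩ := hf p hp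
    exact ⟨V, hpV, hVU, congr _ _ _ (fun q hq => hfg q (hVU hq)) hV⟩
  const U a := fun p hp => ⟨U, hp, le_rfl, const _ a⟩
  restrict U V hVU f hf := by
    intro p hp
    obtain ⟨W, hpW, _, hW⟩ := hf p (hVU hp)
    exact ⟨W ⊓ V, ⟨hpW, hp⟩, inf_le_right, mono _ _ _ Set.inter_subset_left hW⟩
  glue U f hf := by
    intro p hp
    obtain ⟨V, hpV, hVU, hV⟩ := hf p hp
    obtain ⟨W, hpW, hWV, hW⟩ := hV p hpV
    exact ⟨W, hpW, hWV.trans hVU, hW⟩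

end ExplodedSpace

/-! ### The local models `ℝⁿ × T^m_P` -/

/-- The integral affine function `x ↦ a + x · α`. -/
def affEval {m : ℕ} (c : ℝ × (Fin m → ℤ)) (x : Fin m → ℝ) : ℝ := c.1 + ∑ i, x i * (c.2 i : ℝ)

/-- Integral affine polytopes: nonempty interior, finitely many weak and strict inequalities. -/
def IsIntegralAffinePolytope {m : ℕ} (P : Set (Fin m → ℝ)) : Prop :=
  (interior P).Nonempty ∧
  ∃ s t : Finset (ℝ × (Fin m → ℤ)),
    P = {x | (∀ c ∈ s, 0 ≤ affEval c x) ∧ (∀ c ∈ t, 0 < affEval c x)}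

/-- The points of `ℝⁿ × T^m_P`: coordinates `x ∈ ℝⁿ` and `z̃ ∈ (ℂ^* t^ℝ)^m` with tropical part
in `P`. -/
@[ext] structure Model (n m : ℕ) (P : Set (Fin m → ℝ)) where
  x : Fin n → ℝ
  z : Fin m → ExplUnit
  mem : (fun i => (z i).trop) ∈ P

/-- The exploded function `t^a z̃^α`. -/
def monomial {m : ℕ} (c : ℝ × (Fin m → ℤ)) (z : Fin m → ExplUnit) : ExplUnit :=
  (1, Multiplicative.ofAdd c.1) * ∏ i, z i ^ c.2 i

/-- The monomials `t^a z̃^α` whose exponent is nonnegative on `P`. -/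
def NonnegMonomial {m : ℕ} (P : Set (Fin m → ℝ)) : Type :=
  {c : ℝ × (Fin m → ℤ) // ∀ x ∈ P, 0 ≤ affEval c x}

namespace Model

variable {n m : ℕ} {P : Set (Fin m → ℝ)}

/-- The smooth monomial, the smooth part of `t^a z̃^α`. -/
def zeta (c : NonnegMonomial P) (q : Model n m P) : ℂ := (monomial c.1 q.z).smoothPart

/-- The coarsest topology in which the coordinates `x` and all smooth monomials are continuous.
(Every smooth monomial is `0` or a product of members of a finite generating set, so this is also
the topology pulled back from `ℝⁿ × ℂ^N` by `x` and such a generating set.) -/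
instance : TopologicalSpace (Model n m P) :=
  TopologicalSpace.induced
    (fun q => (q.x, fun c : NonnegMonomial P => zeta c q)) inferInstance

/-- On the set `V`, the function `g` has the form `h(x, ζ₁, …, ζ_N) t^a z̃^α`, where the `ζᵢ` are
smooth monomials and `h` is a smooth `ℂ^*`-valued function on `ℝⁿ × ℂ^N`. -/
def HasForm (V : Set (Model n m P)) (g : Model n m P → ExplUnit) : Prop :=
  ∃ (N : ℕ) (ζ : Fin N → NonnegMonomial P) (h : (Fin n → ℝ) × (Fin N → ℂ) → ℂ)
    (hne : ∀ y, h y ≠ 0) (c : ℝ × (Fin m → ℤ)), ContDiff ℝ ∞ h ∧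
    ∀ q ∈ V, g q = (Units.mk0 _ (hne (q.x, fun i => zeta (ζ i) q)), 1) * monomial c q.z

theorem monomial_mul {m : ℕ} (c d : ℝ × (Fin m → ℤ)) (z : Fin m → ExplUnit) :
    monomial (c + d) z = monomial c z * monomial d z := by
  have h : ∀ i, z i ^ (c.2 i + d.2 i) = z i ^ c.2 i * z i ^ d.2 i := fun i => zpow_add _ _ _
  simp only [monomial, Prod.fst_add, Prod.snd_add, Pi.add_apply, h, Finset.prod_mul_distrib]
  rw [mul_mul_mul_comm]
  congr 1
  ext <;> simp

theorem monomial_neg {m : ℕ} (c : ℝ × (Fin m → ℤ)) (z : Fin m → ExplUnit) :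
    monomial (-c) z = (monomial c z)⁻¹ := by
  have h : monomial (-c) z * monomial c z = 1 := by
    rw [← monomial_mul]
    simp only [neg_add_cancel, monomial]
    ext <;> simp
  exact eq_inv_of_mul_eq_one_left h

theorem hasForm_const (V : Set (Model n m P)) (a : ExplUnit) : HasForm V (fun _ => a) := by
  refine ⟨0, Fin.elim0, fun _ => a.1, fun _ => a.1.ne_zero, (a.trop, 0), contDiff_const, ?_⟩
  intro q _
  ext <;> simp [monomial, ExplUnit.trop]

theorem HasForm.mul {V : Set (Model n m P)} {f g : Model n m P → ExplUnit}
    (hf : HasForm V f) (hg : HasForm V g) : HasForm V (f * g) := by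
  obtain ⟨N, ζ, h, hne, c, hh, hq⟩ := hf
  obtain ⟨N', ζ', h', hne', c', hh', hq'⟩ := hg
  refine ⟨N + N', Fin.append ζ ζ',
    fun y => h (y.1, fun i => y.2 (Fin.castAdd N' i)) * h' (y.1, fun i => y.2 (Fin.natAdd N i)),
    fun y => mul_ne_zero (hne _) (hne' _), c + c', ?_, ?_⟩
  · refine (hh.comp ?_).mul (hh'.comp ?_) <;> fun_prop
  · intro q hqV
    rw [Pi.mul_apply, hq q hqV, hq' q hqV, monomial_mul, mul_mul_mul_comm]
    congr 1
    ext <;> simp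

theorem HasForm.inv {V : Set (Model n m P)} {f : Model n m P → ExplUnit}
    (hf : HasForm V f) : HasForm V f⁻¹ := by
  obtain ⟨N, ζ, h, hne, c, hh, hq⟩ := hf
  refine ⟨N, ζ, fun y => (h y)⁻¹, fun y => inv_ne_zero (hne y), -c, hh.inv hne, ?_⟩
  intro q hqV
  rw [Pi.inv_apply, hq q hqV, monomial_neg, mul_inv]
  congr 1
  ext <;> simp

/-- `ℝⁿ × T^m_P` as an abstract exploded space. -/
def space (n m : ℕ) (P : Set (Fin m → ℝ)) : ExplodedSpace (Model n m P) :=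
  ExplodedSpace.ofForm HasForm
    (fun _ _ _ hWV ⟨N, ζ, h, hne, c, hh, hq⟩ => ⟨N, ζ, h, hne, c, hh, fun q hqW => hq q (hWV hqW)⟩)
    (fun _ _ _ hfg ⟨N, ζ, h, hne, c, hh, hq⟩ =>
      ⟨N, ζ, h, hne, c, hh, fun q hqV => (hfg q hqV).symm.trans (hq q hqV)⟩)
    hasForm_const (fun _ _ _ => HasForm.mul) (fun _ _ => HasForm.inv)

/-- The slice inclusion `ℝⁿ × T^m_P → ℝ^(k+n) × T^m_P`, `(x, z̃) ↦ ((0, x), z̃)`. -/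
def slice (k : ℕ) (q : Model n m P) : Model (k + n) m P := ⟨Fin.append 0 q.x, q.z, q.mem⟩

end Model

/-- The real line as an abstract exploded space: the exploded functions are those that locally are
`h t^a` with `h` smooth and `ℂ^*`-valued and `a` constant. -/
def realLine : ExplodedSpace ℝ :=
  ExplodedSpace.ofForm
    (fun V g => ∃ (h : ℝ → ℂ) (hne : ∀ y, h y ≠ 0) (a : ℝ), ContDiff ℝ ∞ h ∧
      ∀ y ∈ V, g y = (Units.mk0 _ (hne y), Multiplicative.ofAdd a))
    (fun _ _ _ hWV ⟨h, hne, a, hh, hq⟩ => ⟨h, hne, a, hh, fun q hqW => hq q (hWV hqW)⟩)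
    (fun _ _ _ hfg ⟨h, hne, a, hh, hq⟩ =>
      ⟨h, hne, a, hh, fun q hqV => (hfg q hqV).symm.trans (hq q hqV)⟩)
    (fun _ a => ⟨fun _ => a.1, fun _ => a.1.ne_zero, a.trop, contDiff_const,
      fun _ _ => by ext <;> simp [ExplUnit.trop]⟩)
    (fun _ f g ⟨h, hne, a, hh, hq⟩ ⟨h', hne', a', hh', hq'⟩ =>
      ⟨fun y => h y * h' y, fun y => mul_ne_zero (hne y) (hne' y), a + a', hh.mul hh',
        fun y hy => by rw [Pi.mul_apply, hq y hy, hq' y hy]; ext <;> simp⟩)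
    (fun _ f ⟨h, hne, a, hh, hq⟩ =>
      ⟨fun y => (h y)⁻¹, fun y => inv_ne_zero (hne y), -a, hh.inv hne,
        fun y hy => by rw [Pi.inv_apply, hq y hy]; ext <;> simp⟩)

/-! ### Exploded manifolds, functions and tangent vectors -/

namespace ExplodedSpace

variable {X : Type u} {Y : Type v} [TopologicalSpace X] [TopologicalSpace Y]

/-- A smooth exploded manifold: every point has an open neighbourhood isomorphic to some
`ℝⁿ × T^m_P`. -/
def IsExplodedManifold (B : ExplodedSpace X) : Prop :=
  ∀ p : X, ∃ (n m : ℕ) (P : Set (Fin m → ℝ)) (φ : Model n m P → X),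
    IsIntegralAffinePolytope P ∧ (Model.space n m P).IsOpenIso B φ ∧ p ∈ Set.range φ

/-- `f ∈ C^∞(U)`: on `U`, `f` is a morphism to the real line. -/
structure IsSmoothOn (B : ExplodedSpace X) (U : Opens X) (f : X → ℝ) : Prop where
  continuousOn : ContinuousOn f U
  pullback : ∀ (V : Opens ℝ) (g : ℝ → ExplUnit), g ∈ realLine.sec V →
    g ∘ f ∈ B.sec ⟨U ∩ f ⁻¹' V, continuousOn.isOpen_inter_preimage U.isOpen V.isOpen⟩

/-- `f ∈ 𝓔(U)`: `f` is an exploded tropical function on `U`, i.e. locally a finite (nonempty) sum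
`g₀ + g₁ + ⋯ + g_k` of exploded functions, added pointwise in `ℂ t^ℝ`. -/
def IsTropicalOn (B : ExplodedSpace X) (U : Opens X) (f : X → Expl) : Prop :=
  ∀ p ∈ U, ∃ V : Opens X, p ∈ V ∧ V ≤ U ∧
    ∃ (g₀ : X → ExplUnit) (l : List (X → ExplUnit)), g₀ ∈ B.sec V ∧ (∀ g ∈ l, g ∈ B.sec V) ∧
      ∀ q ∈ V, f q = l.foldl (fun s g => s + (g q).toExpl) (g₀ q).toExpl

/-- `f` defines a germ at `p` of a smooth real function. -/
def SmoothAt (B : ExplodedSpace X) (p : X) (f : X → ℝ) : Prop :=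
  ∃ U : Opens X, p ∈ U ∧ B.IsSmoothOn U f

/-- `f` defines a germ at `p` of an exploded tropical function. -/
def TropicalAt (B : ExplodedSpace X) (p : X) (f : X → Expl) : Prop :=
  ∃ U : Opens X, p ∈ U ∧ B.IsTropicalOn U f

/-- A tangent vector at `p`: a pair of maps on the germs at `p` of smooth functions and of exploded
tropical functions which are derivations, homogeneous over `ℂ t^ℝ` and compatible with the
inclusion `C^∞ → 𝓔`. (The values on functions that do not define such germs are irrelevant.) -/
structure TangentVector (B : ExplodedSpace X) (p : X) where
  onSmooth : (X → ℝ) → ℝ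
  onTropical : (X → Expl) → Expl
  smooth_germ : ∀ f g, B.SmoothAt p f → f =ᶠ[𝓝 p] g → onSmooth f = onSmooth g
  tropical_germ : ∀ f g, B.TropicalAt p f → f =ᶠ[𝓝 p] g → onTropical f = onTropical g
  smooth_add : ∀ f g, B.SmoothAt p f → B.SmoothAt p g →
    onSmooth (fun q => f q + g q) = onSmooth f + onSmooth g
  tropical_add : ∀ f g, B.TropicalAt p f → B.TropicalAt p g →
    onTropical (fun q => f q + g q) = onTropical f + onTropical g
  smooth_mul : ∀ f g, B.SmoothAt p f → B.SmoothAt p g →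
    onSmooth (fun q => f q * g q) = onSmooth f * g p + f p * onSmooth g
  tropical_mul : ∀ f g, B.TropicalAt p f → B.TropicalAt p g →
    onTropical (fun q => f q * g q) = onTropical f * g p + f p * onTropical g
  tropical_smul : ∀ (a : Expl) f, B.TropicalAt p f →
    onTropical (fun q => a * f q) = a * onTropical f
  compat : ∀ f, B.SmoothAt p f → onTropical (fun q => Expl.ofReal (f q)) = Expl.ofReal (onSmooth f)

/-- `dφ : T_p A → T_{φ p} B`, `dφ(v) g = v (g ∘ φ)`, is surjective. -/
def DerivSurjectiveAt (A : ExplodedSpace X) (B : ExplodedSpace Y) (φ : X → Y) (p : X) : Prop :=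
  ∀ w : B.TangentVector (φ p), ∃ v : A.TangentVector p,
    (∀ g, B.SmoothAt (φ p) g → v.onSmooth (g ∘ φ) = w.onSmooth g) ∧
    (∀ g, B.TropicalAt (φ p) g → v.onTropical (g ∘ φ) = w.onTropical g)

/-- The exploded tropical function `f` is transverse to `0 t^ℝ`: at every point `p` with
`f p = 0 t^y`, the derivative `v ↦ v f` maps `T_p B` onto `ℂ t^y`. -/
def TransverseToZero (B : ExplodedSpace X) (f : X → Expl) : Prop :=
  ∀ p, (f p).coeff = 0 → ∀ c : ℂ, ∃ v : B.TangentVector p, v.onTropical f = ⟨c, (f p).exp⟩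

end ExplodedSpace

/-! ### Refinements and submanifolds -/

/-- The map of smooth parts induced by a continuous map. The smooth part of `X` is its quotient by
topological indistinguishability. -/
def smoothPartMap {X : Type u} {Y : Type v} [TopologicalSpace X] [TopologicalSpace Y] (φ : X → Y)
    (hφ : Continuous φ) : SeparationQuotient X → SeparationQuotient Y :=
  SeparationQuotient.lift (fun p => SeparationQuotient.mk (φ p))
    (fun _ _ h => SeparationQuotient.mk_eq_mk.2 (h.map hφ))

namespace ExplodedSpace

variable {X : Type u} {Y : Type v} [TopologicalSpace X] [TopologicalSpace Y]

/-- `r` makes the exploded manifold `B'` a refinement of `B`: it is a smooth proper map, bijective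
on points, and with surjective derivative. -/
structure IsRefinement (B' : ExplodedSpace Y) (B : ExplodedSpace X) (r : Y → X) : Prop where
  isExplodedManifold : B'.IsExplodedManifold
  isMorphism : B'.IsMorphism B r
  isProper : IsProperMap (smoothPartMap r isMorphism.continuous)
  bijective : Function.Bijective r
  derivSurjective : ∀ p, DerivSurjectiveAt B' B r p

/-- `j` embeds the exploded manifold `A` in `B` with real codimension `k`: it is a smooth
topological embedding, and around every point there are coordinate charts `ℝⁿ × T^m_P` of `A` and
`ℝ^(k+n) × T^m_P` of `B` in which `j` is `(x, z̃) ↦ ((0, x), z̃)` and the image of `A` is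
`{x₁ = ⋯ = x_k = 0}`. -/
structure IsEmbeddingOfCodim (A : ExplodedSpace Y) (B : ExplodedSpace X) (k : ℕ) (j : Y → X) :
    Prop where
  isExplodedManifold : A.IsExplodedManifold
  isMorphism : A.IsMorphism B j
  isEmbedding : Topology.IsEmbedding j
  slice : ∀ a : Y, ∃ (n m : ℕ) (P : Set (Fin m → ℝ))
    (ψ : Model n m P → Y) (φ : Model (k + n) m P → X),
    IsIntegralAffinePolytope P ∧
    (Model.space n m P).IsOpenIso A ψ ∧ (Model.space (k + n) m P).IsOpenIso B φ ∧
    a ∈ Set.range ψ ∧ (∀ q, j (ψ q) = φ (q.slice k)) ∧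
    ∀ q, φ q ∈ Set.range j ↔ ∀ i : Fin k, q.x (Fin.castAdd n i) = 0

/-- `Z` is an exploded submanifold of `B` of real codimension `k`: there are an exploded manifold
`A`, a refinement `r : B' → B` and an embedding `j : A → B'` of codimension `k` such that the
(injective, smooth) map `r ∘ j : A → B` has image `Z`. If the smooth part of `B` is Hausdorff, those
of `A` and `B'` have to be so, too. -/
def IsExplodedSubmanifold {X : Type u} [TopologicalSpace X] (B : ExplodedSpace X) (k : ℕ)
    (Z : Set X) : Prop :=
  ∃ (X' : Type u) (_ : TopologicalSpace X') (B' : ExplodedSpace X') (r : X' → X)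
    (Y : Type u) (_ : TopologicalSpace Y) (A : ExplodedSpace Y) (j : Y → X'),
    B'.IsRefinement B r ∧ A.IsEmbeddingOfCodim B' k j ∧ Set.range (r ∘ j) = Z ∧
    (T2Space (SeparationQuotient X) →
      T2Space (SeparationQuotient X') ∧ T2Space (SeparationQuotient Y))

end ExplodedSpace

end

/-! Near any point, f is a finite sum of exploded functions g_j. Its exponent is the minimum of
theirs, and wherever a fixed g_i attains this minimum the coefficient of f is that of g_i times H,
the sum of the smooth parts of the quotients g_j/g_i (`Decomposes`). On B this H need not be smooth,
because g_i may be minimal on only part of every neighbourhood. The refinement `refine B f` removes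
the obstruction. It has the same points, but the loci where f has the exponent of one exploded
function become open, and smooth functions of smooth parts whose exponents are nonnegative on these
loci are admitted. Tropically, polytopes are subdivided along the domains of linearity of the
exponent of f. On the refinement f is locally a unit times a smooth complex function H,
transversality says that dH maps onto ℂ at the zeros of H, and the implicit function theorem turns
{H = 0} into a slice of real codimension 2.

Charts of the refinement (`exists_chart_refine`): near a point, the monomials whose linear part lies
in the saturated lattice of active constraints have constant exponent, so their coefficients serve
as ordinary complex coordinates. The remaining exponents fill a polytope with the given point over
its interior. At such a centre each smooth monomial is either 0 or the constant 1, so only the real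
coordinates contribute to the derivative of H. A chart has to be a whole model;
`exists_isOpenIso_subset` finds, inside any neighbourhood of the centre, an open copy of the entire
model, and `exists_isOpenIso_straighten` does this while making H a coordinate.

Tangent vectors: Hadamard's lemma and the Leibniz rule show that each of them is the velocity of a
curve (x + sξ, exp(sλ) z̃) in a chart (`exists_eq_curve`). Such curves keep all exponents fixed,
hence stay continuous in the finer topology. So the refinement map has surjective derivative, and
transversality can be tested upstairs (`TransverseToZero.exists_fderiv_eq`).

Properness (`exists_le_nhds_refined`) is tested on ultrafilters. One summand dominates along the
ultrafilter, all quotients by it have bounded smooth parts, and `exists_tendsto_smoothPart_monomial`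
produces a limit point in the corresponding cell. Separation (`r1Space_refined`) holds because
smooth parts are continuous and a quotient and its inverse multiply to 1. -/

noncomputable section

open Filter

/-! ### Smoothness near a point -/

section SmoothNear

variable {E F G : Type*} [NormedAddCommGroup E] [NormedSpace ℝ E] [NormedAddCommGroup F]
  [NormedSpace ℝ F] [NormedAddCommGroup G] [NormedSpace ℝ G]

/-- `h` is smooth in a neighbourhood of `y`. -/
def SmoothNear (h : E → F) (y : E) : Prop := ∀ᶠ x in 𝓝 y, ContDiffAt ℝ ∞ h x

theorem SmoothNear.contDiffAt {h : E → F} {y : E} (hh : SmoothNear h y) : ContDiffAt ℝ ∞ h y :=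
  hh.self_of_nhds

theorem SmoothNear.continuousAt {h : E → F} {y : E} (hh : SmoothNear h y) : ContinuousAt h y :=
  hh.contDiffAt.continuousAt

theorem SmoothNear.differentiableAt {h : E → F} {y : E} (hh : SmoothNear h y) :
    DifferentiableAt ℝ h y :=
  hh.contDiffAt.differentiableAt (by simp)

theorem SmoothNear.eventually {h : E → F} {y : E} (hh : SmoothNear h y) :
    ∀ᶠ x in 𝓝 y, SmoothNear h x :=
  eventually_eventually_nhds.2 hh

theorem ContDiff.smoothNear {h : E → F} (hh : ContDiff ℝ ∞ h) (y : E) : SmoothNear h y :=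
  Eventually.of_forall fun _ => hh.contDiffAt

theorem SmoothNear.comp {h : F → G} {k : E → F} {y : E} (hh : SmoothNear h (k y))
    (hk : SmoothNear k y) : SmoothNear (fun x => h (k x)) y := by
  filter_upwards [hk, hk.continuousAt.eventually hh] with x hx hx'
  exact ContDiffAt.comp x hx' hx

theorem SmoothNear.prodMk {h : E → F} {k : E → G} {y : E} (hh : SmoothNear h y)
    (hk : SmoothNear k y) : SmoothNear (fun x => (h x, k x)) y := by
  filter_upwards [hh, hk] with x hx hx' using hx.prodMk hx'

theorem smoothNear_const (c : F) (y : E) : SmoothNear (fun _ : E => c) y :=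
  contDiff_const.smoothNear y

theorem smoothNear_pi {ι : Type*} [Fintype ι] {h : E → ι → F} {y : E}
    (hh : ∀ i, SmoothNear (fun x => h x i) y) : SmoothNear h y := by
  filter_upwards [eventually_all.2 hh] with x hx using contDiffAt_pi.2 hx

theorem SmoothNear.sub {h k : E → F} {y : E} (hh : SmoothNear h y) (hk : SmoothNear k y) :
    SmoothNear (fun x => h x - k x) y := by
  filter_upwards [hh, hk] with x hx hx' using hx.sub hx'

theorem SmoothNear.mul {h k : E → ℂ} {y : E} (hh : SmoothNear h y) (hk : SmoothNear k y) :
    SmoothNear (fun x => h x * k x) y := by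
  filter_upwards [hh, hk] with x hx hx' using hx.mul hx'

theorem SmoothNear.inv {h : E → ℂ} {y : E} (hh : SmoothNear h y) (h0 : h y ≠ 0) :
    SmoothNear (fun x => (h x)⁻¹) y := by
  filter_upwards [hh, hh.continuousAt.eventually_ne h0] with x hx hx' using hx.inv hx'

theorem smoothNear_log {a : ℂ} (ha : a ∈ Complex.slitPlane) : SmoothNear Complex.log a := by
  filter_upwards [Complex.isOpen_slitPlane.mem_nhds ha] with x hx
  exact (Complex.contDiffAt_log hx).restrict_scalars ℝ

/-- A bump function supported where `h` is smooth and inside `s`; the product with it is smooth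
everywhere, being zero near every point where `h` might fail to be smooth. -/
theorem SmoothNear.mono_smul_cutoff [FiniteDimensional ℝ E] {h : E → F} {y : E}
    (hh : SmoothNear h y) {s : Set E} (hs : s ∈ 𝓝 y) :
    ∃ χ : E → ℝ, ContDiff ℝ ∞ χ ∧ (∀ᶠ x in 𝓝 y, χ x = 1) ∧ (∀ x, 0 ≤ χ x ∧ χ x ≤ 1) ∧
      (∀ x, χ x ≠ 0 → x ∈ s) ∧ ContDiff ℝ ∞ fun x => χ x • h x := by
  obtain ⟨r, hr, hrs⟩ := Metric.mem_nhds_iff.1 (inter_mem hh hs)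
  let b : ContDiffBump y := ⟨r / 4, r / 2, by positivity, by linarith⟩
  refine ⟨b, b.contDiff, b.eventuallyEq_one, fun x => ⟨b.nonneg, b.le_one⟩, ?_, ?_⟩
  · intro x hx
    have : x ∈ Metric.ball y (r / 2) := by
      have := b.support_eq ▸ (Function.mem_support.2 hx)
      exact this
    exact (hrs (Metric.ball_subset_ball (by linarith) this)).2
  · rw [contDiff_iff_contDiffAt]
    intro x
    by_cases hx : x ∈ Metric.ball y r
    · exact b.contDiff.contDiffAt.smul (hrs hx).1
    · have : (fun x => b x • h x) =ᶠ[𝓝 x] fun _ => 0 := by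
        have h1 : x ∈ (Metric.closedBall y (r / 2))ᶜ := by
          simp only [Metric.mem_ball, not_lt, Set.mem_compl_iff, Metric.mem_closedBall, not_le] at *
          linarith
        filter_upwards [Metric.isClosed_closedBall.isOpen_compl.mem_nhds h1] with z hz
        have : b z = 0 := b.zero_of_le_dist (by
          simp only [Set.mem_compl_iff, Metric.mem_closedBall, not_le] at hz
          exact hz.le)
        simp [this]
      exact contDiffAt_const.congr_of_eventuallyEq this

/-- A smooth germ agrees near the point with a globally defined smooth function. -/
theorem SmoothNear.exists_contDiff [FiniteDimensional ℝ E] {h : E → F} {y : E}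
    (hh : SmoothNear h y) : ∃ k : E → F, ContDiff ℝ ∞ k ∧ k =ᶠ[𝓝 y] h := by
  obtain ⟨χ, -, h1, -, -, h2⟩ := hh.mono_smul_cutoff univ_mem
  refine ⟨_, h2, ?_⟩
  filter_upwards [h1] with x hx
  simp [hx]

/-- A nonvanishing smooth germ extends to a nonvanishing smooth function. -/
theorem SmoothNear.exists_contDiff_ne_zero [FiniteDimensional ℝ E] {h : E → ℂ} {y : E}
    (hh : SmoothNear h y) (h0 : h y ≠ 0) :
    ∃ k : E → ℂ, ContDiff ℝ ∞ k ∧ (∀ x, k x ≠ 0) ∧ k =ᶠ[𝓝 y] h := by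
  have h1 : SmoothNear (fun x => h x - h y) y := hh.sub (smoothNear_const _ _)
  -- The deviation from `h y` is cut off inside the region where it is smaller than `h y`, so the
  -- interpolated function can never reach 0.
  have hs : {x | ‖h x - h y‖ < ‖h y‖} ∈ 𝓝 y := by
    have : ContinuousAt (fun x => ‖h x - h y‖) y := h1.continuousAt.norm
    refine this.eventually_lt continuousAt_const ?_
    simpa using h0
  obtain ⟨χ, -, h2, h3, h4, h5⟩ := h1.mono_smul_cutoff hs
  refine ⟨fun x => h y + χ x • (h x - h y), contDiff_const.add h5, fun x hx => ?_, ?_⟩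
  · by_cases hχ : χ x = 0
    · simp [hχ, h0] at hx
    · have h6 : ‖h x - h y‖ < ‖h y‖ := h4 x hχ
      have h7 : ‖χ x • (h x - h y)‖ ≤ ‖h x - h y‖ := by
        rw [norm_smul, Real.norm_of_nonneg (h3 x).1]
        exact mul_le_of_le_one_left (norm_nonneg _) (h3 x).2
      have h8 : h y = -(χ x • (h x - h y)) := eq_neg_of_add_eq_zero_left hx
      have h9 : ‖h y‖ = ‖χ x • (h x - h y)‖ := by
        conv_lhs => rw [h8, norm_neg]
      linarith
  · filter_upwards [h2] with x hx
    simp [hx]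

end SmoothNear

/-! ### Hadamard's lemma -/

section Hadamard

variable {E : Type} [NormedAddCommGroup E] [NormedSpace ℝ E]

/-- Differentiation under the integral sign; the derivative is continuous, hence bounded by a
constant on the compact set (closed unit ball around `x`) × [0,1]. -/
theorem hasFDerivAt_intervalIntegral_of_contDiff {G : Type} [NormedAddCommGroup G]
    [NormedSpace ℝ G] [CompleteSpace G] [FiniteDimensional ℝ E] {F : E → ℝ → G}
    (hF : ContDiff ℝ 1 fun p : E × ℝ => F p.1 p.2) (x : E) :
    HasFDerivAt (fun y => ∫ s in (0 : ℝ)..1, F y s)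
      (∫ s in (0 : ℝ)..1, (fderiv ℝ (fun p : E × ℝ => F p.1 p.2) (x, s)).comp
        (ContinuousLinearMap.inl ℝ E ℝ)) x := by
  set F' : E → ℝ → E →L[ℝ] G := fun y s =>
    (fderiv ℝ (fun p : E × ℝ => F p.1 p.2) (y, s)).comp (ContinuousLinearMap.inl ℝ E ℝ)
  have hF'c : Continuous fun p : E × ℝ => F' p.1 p.2 := by
    have := hF.continuous_fderiv (by simp)
    exact this.clm_comp continuous_const
  obtain ⟨C, hC⟩ := ((isCompact_closedBall x 1).prod (isCompact_Icc (a := (0 : ℝ)) (b := 1))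
    ).exists_bound_of_continuousOn (f := fun p : E × ℝ => F' p.1 p.2) hF'c.continuousOn
  refine intervalIntegral.hasFDerivAt_integral_of_dominated_of_fderiv_le (F' := F')
    (bound := fun _ => C) (Metric.closedBall_mem_nhds x one_pos) ?_ ?_ ?_ ?_ ?_ ?_
  · refine Eventually.of_forall fun y => Continuous.aestronglyMeasurable ?_
    exact hF.continuous.comp (by fun_prop : Continuous fun s : ℝ => (y, s))
  · refine Continuous.intervalIntegrable ?_ _ _
    exact hF.continuous.comp (by fun_prop : Continuous fun s : ℝ => (x, s))
  · have : SecondCountableTopologyEither ℝ (E →L[ℝ] G) := ⟨Or.inl inferInstance⟩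
    refine Continuous.aestronglyMeasurable ?_
    exact hF'c.comp (by fun_prop : Continuous fun s : ℝ => (x, s))
  · refine Eventually.of_forall fun s hs y hy => hC (y, s) ⟨hy, ?_⟩
    rw [Set.uIoc_of_le zero_le_one] at hs
    exact ⟨hs.1.le, hs.2⟩
  · exact intervalIntegrable_const
  · refine Eventually.of_forall fun s _ y _ => ?_
    have h1 : HasFDerivAt (fun p : E × ℝ => F p.1 p.2) _ (y, s) :=
      (hF.differentiable (by simp) (y, s)).hasFDerivAt
    have h2 : HasFDerivAt (fun y : E => (y, s)) (ContinuousLinearMap.inl ℝ E ℝ) y :=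
      hasFDerivAt_prodMk_left y s
    exact HasFDerivAt.comp y h1 h2

/-- Induction on the order: the derivative of the integral is again such an integral. The target `G`
varies inside the statement because the derivative takes values in E →L[ℝ] G. -/
theorem contDiff_intervalIntegral [FiniteDimensional ℝ E] (n : ℕ) :
    ∀ {G : Type} [NormedAddCommGroup G] [NormedSpace ℝ G] [CompleteSpace G] {F : E → ℝ → G},
    ContDiff ℝ ∞ (fun p : E × ℝ => F p.1 p.2) →
    ContDiff ℝ n fun y => ∫ s in (0 : ℝ)..1, F y s := by
  induction n with
  | zero =>
    intro G _ _ _ F hF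
    have : Differentiable ℝ fun y => ∫ s in (0 : ℝ)..1, F y s := fun y =>
      (hasFDerivAt_intervalIntegral_of_contDiff (hF.of_le (by exact_mod_cast le_top)) y).differentiableAt
    exact_mod_cast contDiff_zero.2 this.continuous
  | succ n ih =>
    intro G _ _ _ F hF
    have h1 := fun y =>
      hasFDerivAt_intervalIntegral_of_contDiff (hF.of_le (by exact_mod_cast le_top)) y
    push_cast
    rw [contDiff_succ_iff_hasFDerivAt]
    refine ⟨_, ?_, h1⟩
    refine ih (F := fun y s => (fderiv ℝ (fun p : E × ℝ => F p.1 p.2) (y, s)).comp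
        (ContinuousLinearMap.inl ℝ E ℝ)) ?_
    exact (hF.fderiv_right (m := ∞) (by simp)).clm_comp contDiff_const

/-- **Hadamard's lemma**: a smooth germ is `h y + A x (x - y)` with a smooth family `A` of linear
maps. -/
theorem SmoothNear.exists_hadamard [FiniteDimensional ℝ E] {G : Type} [NormedAddCommGroup G]
    [NormedSpace ℝ G] [CompleteSpace G] {h : E → G} {y : E} (hh : SmoothNear h y) :
    ∃ A : E → E →L[ℝ] G, ContDiff ℝ ∞ A ∧ A y = fderiv ℝ h y ∧
      ∀ᶠ x in 𝓝 y, h x = h y + A x (x - y) := by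
  obtain ⟨k, hk, hkh⟩ := hh.exists_contDiff
  have hsm : ContDiff ℝ ∞ fun p : E × ℝ => fderiv ℝ k (y + p.2 • (p.1 - y)) := by
    refine (hk.fderiv_right (m := ∞) (by simp)).comp ?_
    fun_prop
  -- `A x` is the average of the derivative along the segment from `y` to `x`; the fundamental
  -- theorem of calculus gives the formula.
  refine ⟨fun x => ∫ s in (0 : ℝ)..1, fderiv ℝ k (y + s • (x - y)), ?_, ?_, ?_⟩
  · exact contDiff_infty.2 fun n => contDiff_intervalIntegral n hsm
  · simp [hkh.fderiv_eq]
  · filter_upwards [hkh] with x hx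
    rw [← hx, ← hkh.self_of_nhds]
    have h1 : ∀ s ∈ Set.uIcc (0 : ℝ) 1, HasDerivAt (fun s : ℝ => k (y + s • (x - y)))
        (fderiv ℝ k (y + s • (x - y)) (x - y)) s := by
      intro s _
      have h2 : HasDerivAt (fun s : ℝ => y + s • (x - y)) (x - y) s := by
        simpa using ((hasDerivAt_id s).smul_const (x - y)).const_add y
      exact (hk.differentiable (by simp) _).hasFDerivAt.comp_hasDerivAt s h2
    have hc : Continuous fun s : ℝ => fderiv ℝ k (y + s • (x - y)) :=
      hsm.continuous.comp (by fun_prop : Continuous fun s : ℝ => (x, s))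
    have h3 := intervalIntegral.integral_eq_sub_of_hasDerivAt h1
      ((hc.clm_apply continuous_const).intervalIntegrable _ _)
    rw [ContinuousLinearMap.intervalIntegral_apply (hc.intervalIntegrable _ _), h3]
    simp

end Hadamard

/-! ### Farkas' lemma -/

/-- **Farkas' lemma** for finitely many linear functionals. -/
theorem exists_nonneg_combination_of_forall_nonneg {E : Type*} [AddCommGroup E] [Module ℝ E]
    {ι : Type*} (s : Finset ι) :
    ∀ (a : ι → E →ₗ[ℝ] ℝ) (b : E →ₗ[ℝ] ℝ), (∀ x, (∀ i ∈ s, 0 ≤ a i x) → 0 ≤ b x) →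
      ∃ r : ι → ℝ, (∀ i, 0 ≤ r i) ∧ b = ∑ i ∈ s, r i • a i := by
  classical
  induction s using Finset.induction_on with
  | empty =>
    intro a b h
    refine ⟨0, fun _ => le_rfl, ?_⟩
    ext x
    have h1 := h x (by simp)
    have h2 := h (-x) (by simp)
    simp at h2 ⊢
    linarith
  | insert j s hj ih =>
    intro a b h
    by_cases hb : ∀ x, (∀ i ∈ s, 0 ≤ a i x) → 0 ≤ b x
    · obtain ⟨r, hr, hbr⟩ := ih a b hb
      refine ⟨fun i => if i = j then 0 else r i, fun i => ?_, ?_⟩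
      · dsimp only
        split_ifs
        · exact le_rfl
        · exact hr i
      · rw [Finset.sum_insert hj, hbr]
        simp only [if_true, zero_smul, zero_add]
        refine Finset.sum_congr rfl fun i hi => ?_
        rw [if_neg (fun h : i = j => hj (h ▸ hi))]
    · push Not at hb
      obtain ⟨x₁, hx₁, hbx₁⟩ := hb
      have hneg : a j x₁ < 0 := by
        by_contra hcon
        push Not at hcon
        refine absurd (h x₁ fun i hi => ?_) (not_le.2 hbx₁)
        rcases Finset.mem_insert.1 hi with rfl | hi
        · exact hcon
        · exact hx₁ i hi
      -- A point violating the reduced implication must violate the constraint `j`. Normalised so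
      -- that `a j x₀ = -1`, it yields the projection x ↦ x + a j x • x₀ onto the kernel of `a j`,
      -- along which the problem descends to the constraints in `s`.
      set x₀ : E := (-(a j x₁))⁻¹ • x₁ with hx₀
      have hpos : 0 < (-(a j x₁))⁻¹ := inv_pos.2 (neg_pos.2 hneg)
      have hax₀ : a j x₀ = -1 := by
        rw [hx₀, map_smul, smul_eq_mul, inv_neg, neg_mul, inv_mul_cancel₀ hneg.ne]
      have hbx₀ : b x₀ < 0 := by
        rw [hx₀, map_smul, smul_eq_mul]
        exact mul_neg_of_pos_of_neg hpos hbx₁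
      have hix₀ : ∀ i ∈ s, 0 ≤ a i x₀ := fun i hi => by
        rw [hx₀, map_smul, smul_eq_mul]
        exact mul_nonneg hpos.le (hx₁ i hi)
      obtain ⟨r, hr, hbr⟩ := ih (fun i => a i + a i x₀ • a j) (b + b x₀ • a j) (by
        intro x hx
        have h1 := h (x + a j x • x₀) (by
          intro i hi
          rcases Finset.mem_insert.1 hi with rfl | hi
          · simp [hax₀]
          · have := hx i hi
            simp at this ⊢
            linarith)
        simp at h1 ⊢
        linarith)
      -- Solving `hbr` for `b` gives this coefficient of `a j`; it is nonnegative because `a i x₀ ≥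
      -- 0` and `b x₀ < 0`.
      refine ⟨fun i => if i = j then ∑ i ∈ s, r i * a i x₀ - b x₀ else r i, fun i => ?_, ?_⟩
      · dsimp only
        split_ifs
        · have : 0 ≤ ∑ i ∈ s, r i * a i x₀ :=
            Finset.sum_nonneg fun i hi => mul_nonneg (hr i) (hix₀ i hi)
          linarith
        · exact hr i
      · rw [Finset.sum_insert hj]
        simp only [if_true]
        have h2 : ∑ i ∈ s, (if i = j then ∑ i ∈ s, r i * a i x₀ - b x₀ else r i) • a i
            = ∑ i ∈ s, r i • a i :=
          Finset.sum_congr rfl fun i hi => by rw [if_neg (fun h : i = j => hj (h ▸ hi))]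
        rw [h2]
        ext x
        have h3 := LinearMap.congr_fun hbr x
        simp only [LinearMap.add_apply, LinearMap.smul_apply, LinearMap.sum_apply, smul_eq_mul,
          mul_add, Finset.sum_add_distrib] at h3 ⊢
        have h4 : ∑ i ∈ s, r i * (a i x₀ * a j x) = (∑ i ∈ s, r i * a i x₀) * a j x := by
          rw [Finset.sum_mul]
          exact Finset.sum_congr rfl fun i _ => by ring
        rw [h4] at h3
        linarith

/-! ### Exploded units -/

namespace ExplUnit

@[simp] theorem trop_mul (a b : ExplUnit) : (a * b).trop = a.trop + b.trop := rfl

@[simp] theorem trop_one : (1 : ExplUnit).trop = 0 := rfl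

@[simp] theorem trop_inv (a : ExplUnit) : (a⁻¹).trop = -a.trop := rfl

@[simp] theorem trop_div (a b : ExplUnit) : (a / b).trop = a.trop - b.trop := rfl

@[simp] theorem trop_zpow (a : ExplUnit) (n : ℤ) : (a ^ n).trop = n * a.trop := by
  simp [trop]

@[simp] theorem trop_prod {ι : Type*} (s : Finset ι) (a : ι → ExplUnit) :
    (∏ i ∈ s, a i).trop = ∑ i ∈ s, (a i).trop := by
  classical
  induction s using Finset.induction_on with
  | empty => simp
  | insert i s hi ih => rw [Finset.prod_insert hi, Finset.sum_insert hi, trop_mul, ih]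

theorem smoothPart_of_trop_eq_zero {a : ExplUnit} (h : a.trop = 0) : a.smoothPart = a.1 := by
  simp [smoothPart, h]

theorem smoothPart_of_trop_ne_zero {a : ExplUnit} (h : a.trop ≠ 0) : a.smoothPart = 0 := by
  simp [smoothPart, h]

theorem smoothPart_ne_zero_iff {a : ExplUnit} : a.smoothPart ≠ 0 ↔ a.trop = 0 := by
  by_cases h : a.trop = 0
  · simp [smoothPart_of_trop_eq_zero h, h]
  · simp [smoothPart_of_trop_ne_zero h, h]

theorem smoothPart_mul {a b : ExplUnit} (ha : 0 ≤ a.trop) (hb : 0 ≤ b.trop) :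
    (a * b).smoothPart = a.smoothPart * b.smoothPart := by
  by_cases h : a.trop = 0
  · by_cases h' : b.trop = 0
    · rw [smoothPart_of_trop_eq_zero h, smoothPart_of_trop_eq_zero h',
        smoothPart_of_trop_eq_zero (by simp [h, h'])]
      simp
    · rw [smoothPart_of_trop_ne_zero h', smoothPart_of_trop_ne_zero (by simp [h, h'])]
      simp
  · have : a.trop + b.trop ≠ 0 := by
      have := lt_of_le_of_ne ha (Ne.symm h)
      linarith
    rw [smoothPart_of_trop_ne_zero h, smoothPart_of_trop_ne_zero (by simpa using this)]
    simp

theorem smoothPart_mul_of_trop_eq_zero {a b : ExplUnit} (ha : a.trop = 0) :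
    (a * b).smoothPart = a.1 * b.smoothPart := by
  by_cases h' : b.trop = 0
  · rw [smoothPart_of_trop_eq_zero h', smoothPart_of_trop_eq_zero (by simp [ha, h'])]
    simp
  · rw [smoothPart_of_trop_ne_zero h', smoothPart_of_trop_ne_zero (by simp [ha, h'])]
    simp

@[simp] theorem smoothPart_one : (1 : ExplUnit).smoothPart = 1 := by
  rw [smoothPart_of_trop_eq_zero trop_one]
  simp

/-- The exploded unit `c t^0`. -/
def ofUnit (c : ℂˣ) : ExplUnit := (c, 1)

@[simp] theorem trop_ofUnit (c : ℂˣ) : (ofUnit c).trop = 0 := rfl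

@[simp] theorem smoothPart_ofUnit (c : ℂˣ) : (ofUnit c).smoothPart = c :=
  smoothPart_of_trop_eq_zero rfl

theorem ext_coeff_trop {a b : ExplUnit} (h : (a.1 : ℂ) = b.1) (h' : a.trop = b.trop) : a = b :=
  Prod.ext (Units.ext h) h'

open Classical in
/-- The exploded unit `c t^0`, for `c ≠ 0`. -/
def ofComplex (c : ℂ) : ExplUnit := if h : c = 0 then 1 else ofUnit (Units.mk0 c h)

@[simp] theorem trop_ofComplex (c : ℂ) : (ofComplex c).trop = 0 := by
  unfold ofComplex
  split_ifs <;> rfl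

theorem ofComplex_of_ne_zero {c : ℂ} (h : c ≠ 0) : ofComplex c = (Units.mk0 c h, 1) := by
  simp [ofComplex, h, ofUnit]

theorem coeff_ofComplex {c : ℂ} (h : c ≠ 0) : ((ofComplex c).1 : ℂ) = c := by
  simp [ofComplex_of_ne_zero h]

theorem smoothPart_ofComplex {c : ℂ} (h : c ≠ 0) : (ofComplex c).smoothPart = c := by
  rw [smoothPart_of_trop_eq_zero (trop_ofComplex c), coeff_ofComplex h]

theorem toExpl_ofComplex {c : ℂ} (h : c ≠ 0) : (ofComplex c).toExpl = ⟨c, 0⟩ := by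
  ext1
  · exact coeff_ofComplex h
  · exact trop_ofComplex c

end ExplUnit

/-! ### Germs of exploded functions and morphisms -/

namespace ExplodedSpace

variable {X : Type*} {Y : Type*} {Z : Type*} [TopologicalSpace X] [TopologicalSpace Y]
  [TopologicalSpace Z]

/-- `g` defines a germ at `p` of an exploded function. -/
def SecAt (B : ExplodedSpace X) (p : X) (g : X → ExplUnit) : Prop :=
  ∃ U : Opens X, p ∈ U ∧ g ∈ B.sec U

variable {A : ExplodedSpace X} {B : ExplodedSpace Y} {C : ExplodedSpace Z}

theorem secAt_of_mem {U : Opens X} {g : X → ExplUnit} (hg : g ∈ A.sec U) {p : X} (hp : p ∈ U) :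
    A.SecAt p g := ⟨U, hp, hg⟩

/-- The gluing axiom makes being a section a condition on germs, so all constructions below can be
checked point by point. -/
theorem mem_sec_iff {U : Opens X} {g : X → ExplUnit} : g ∈ A.sec U ↔ ∀ p ∈ U, A.SecAt p g := by
  refine ⟨fun h p hp => secAt_of_mem h hp, fun h => A.glue U g fun p hp => ?_⟩
  obtain ⟨V, hpV, hV⟩ := h p hp
  exact ⟨V ⊓ U, ⟨hpV, hp⟩, inf_le_right, A.restrict _ _ inf_le_left _ hV⟩

theorem SecAt.eventually {p : X} {g : X → ExplUnit} (h : A.SecAt p g) :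
    ∀ᶠ q in 𝓝 p, A.SecAt q g := by
  obtain ⟨U, hp, hU⟩ := h
  filter_upwards [U.isOpen.mem_nhds hp] with q hq using ⟨U, hq, hU⟩

theorem SecAt.congr {p : X} {g g' : X → ExplUnit} (h : A.SecAt p g) (hg : g' =ᶠ[𝓝 p] g) :
    A.SecAt p g' := by
  obtain ⟨U, hp, hU⟩ := h
  obtain ⟨s, hs, hso, hps⟩ := eventually_nhds_iff.1 hg
  let S : Opens X := ⟨s, hso⟩
  exact ⟨U ⊓ S, ⟨hp, hps⟩, A.congr _ g g' (fun q hq => (hs q hq.2).symm)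
    (A.restrict _ _ inf_le_left _ hU)⟩

theorem SecAt.exists_opens {p : X} {g : X → ExplUnit} (h : A.SecAt p g) {s : Set X}
    (hs : s ∈ 𝓝 p) : ∃ U : Opens X, p ∈ U ∧ (U : Set X) ⊆ s ∧ g ∈ A.sec U := by
  obtain ⟨U, hp, hU⟩ := h
  obtain ⟨t, ht, hto, hpt⟩ := mem_nhds_iff.1 hs
  exact ⟨U ⊓ ⟨t, hto⟩, ⟨hp, hpt⟩, fun q hq => ht hq.2, A.restrict _ _ inf_le_left _ hU⟩

theorem secAt_const (p : X) (a : ExplUnit) : A.SecAt p fun _ => a :=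
  ⟨⊤, trivial, A.const _ _⟩

theorem SecAt.mul {p : X} {g g' : X → ExplUnit} (h : A.SecAt p g) (h' : A.SecAt p g') :
    A.SecAt p fun q => g q * g' q := by
  obtain ⟨U, hp, hU⟩ := h
  obtain ⟨U', hp', hU'⟩ := h'
  exact ⟨U ⊓ U', ⟨hp, hp'⟩, (A.sec _).mul_mem (A.restrict _ _ inf_le_left _ hU)
    (A.restrict _ _ inf_le_right _ hU')⟩

theorem SecAt.inv {p : X} {g : X → ExplUnit} (h : A.SecAt p g) :
    A.SecAt p fun q => (g q)⁻¹ := by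
  obtain ⟨U, hp, hU⟩ := h
  exact ⟨U, hp, (A.sec _).inv_mem hU⟩

theorem SecAt.div {p : X} {g g' : X → ExplUnit} (h : A.SecAt p g) (h' : A.SecAt p g') :
    A.SecAt p fun q => g q / g' q := by
  simpa only [div_eq_mul_inv] using h.mul h'.inv

theorem SecAt.zpow {p : X} {g : X → ExplUnit} (h : A.SecAt p g) (n : ℤ) :
    A.SecAt p fun q => g q ^ n := by
  obtain ⟨U, hp, hU⟩ := h
  exact ⟨U, hp, (A.sec _).zpow_mem hU n⟩

theorem SecAt.prod {p : X} {ι : Type*} (s : Finset ι) {g : ι → X → ExplUnit}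
    (h : ∀ i ∈ s, A.SecAt p (g i)) : A.SecAt p fun q => ∏ i ∈ s, g i q := by
  classical
  induction s using Finset.induction_on with
  | empty => simpa using secAt_const p (1 : ExplUnit)
  | insert i s hi ih =>
    simp only [Finset.prod_insert hi]
    exact (h i (Finset.mem_insert_self _ _)).mul
      (ih fun j hj => h j (Finset.mem_insert_of_mem hj))

/-- `θ` defines a germ at `p` of a morphism. -/
def MorphAt (A : ExplodedSpace X) (B : ExplodedSpace Y) (θ : X → Y) (p : X) : Prop :=
  ContinuousAt θ p ∧ ∀ g, B.SecAt (θ p) g → A.SecAt p fun q => g (θ q)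

theorem MorphAt.comp {θ : X → Y} {η : Y → Z} {p : X} (hη : MorphAt B C η (θ p))
    (hθ : MorphAt A B θ p) : MorphAt A C (fun q => η (θ q)) p :=
  ⟨ContinuousAt.comp hη.1 hθ.1, fun g hg => hθ.2 _ (hη.2 g hg)⟩

theorem isMorphism_of_morphAt {θ : X → Y} (h : ∀ p, MorphAt A B θ p) : A.IsMorphism B θ where
  continuous := continuous_iff_continuousAt.2 fun p => (h p).1
  pullback _ g hg := mem_sec_iff.2 fun p hp => (h p).2 g (secAt_of_mem hg hp)

/-- `θ` defines a germ at `p` of an isomorphism. -/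
def LocalIsoAt (A : ExplodedSpace X) (B : ExplodedSpace Y) (θ : X → Y) (p : X) : Prop :=
  MorphAt A B θ p ∧ ∃ η : Y → X, MorphAt B A η (θ p) ∧ η (θ p) = p ∧
    (∀ᶠ q in 𝓝 (θ p), θ (η q) = q) ∧ ∀ᶠ q in 𝓝 p, η (θ q) = q

theorem LocalIsoAt.comp {θ : X → Y} {η : Y → Z} {p : X} (hη : LocalIsoAt B C η (θ p))
    (hθ : LocalIsoAt A B θ p) : LocalIsoAt A C (fun q => η (θ q)) p := by
  obtain ⟨h1, η', h2, h3, h4, h5⟩ := hη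
  obtain ⟨h1', θ', h2', h3', h4', h5'⟩ := hθ
  refine ⟨h1.comp h1', fun q => θ' (η' q), MorphAt.comp (by rwa [h3]) h2, ?_, ?_, ?_⟩
  · simp only [h3, h3']
  · have : ∀ᶠ q in 𝓝 (η (θ p)), θ (θ' (η' q)) = η' q := by
      have h6 : ∀ᶠ y in 𝓝 (η' (η (θ p))), θ (θ' y) = y := by rwa [h3]
      exact h2.1.eventually h6
    filter_upwards [this, h4] with q hq hq'
    rw [hq, hq']
  · filter_upwards [h5', h1'.1.eventually h5] with q hq hq'
    rw [hq', hq]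

theorem LocalIsoAt.nhds_le_map {θ : X → Y} {p : X} (h : LocalIsoAt A B θ p) :
    𝓝 (θ p) ≤ map θ (𝓝 p) := by
  obtain ⟨-, η, h2, h3, h4, -⟩ := h
  intro s hs
  have : η ⁻¹' (θ ⁻¹' s) ∈ 𝓝 (θ p) := h2.1 (by rwa [h3])
  filter_upwards [this, h4] with q hq hq'
  simp only [Set.mem_preimage] at hq
  rwa [hq'] at hq

theorem LocalIsoAt.secAt_iff {θ : X → Y} {p : X} (h : LocalIsoAt A B θ p) {g : Y → ExplUnit} :
    A.SecAt p (fun q => g (θ q)) ↔ B.SecAt (θ p) g := by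
  refine ⟨fun hg => ?_, h.1.2 g⟩
  obtain ⟨-, η, h2, h3, h4, -⟩ := h
  refine (h2.2 _ (by rwa [h3])).congr ?_
  filter_upwards [h4] with q hq
  rw [hq]

/-- This is how charts are produced: no global inverse is needed, only injectivity and inverse
germs. -/
theorem isOpenIso_of_localIsoAt {θ : X → Y} (hinj : Function.Injective θ)
    (h : ∀ p, LocalIsoAt A B θ p) : A.IsOpenIso B θ where
  isOpenEmbedding := .of_continuous_injective_isOpenMap
    (continuous_iff_continuousAt.2 fun p => (h p).1.1) hinj
    (isOpenMap_iff_nhds_le.2 fun p => (h p).nhds_le_map)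
  sec_iff V hV g := by
    refine ⟨fun hg => mem_sec_iff.2 fun p hp => (h p).1.2 g (secAt_of_mem hg hp), fun hg => ?_⟩
    refine mem_sec_iff.2 fun q hq => ?_
    obtain ⟨p, rfl⟩ := hV hq
    exact (h p).secAt_iff.1 (secAt_of_mem hg hq)

theorem IsOpenIso.localIsoAt {θ : X → Y} (h : A.IsOpenIso B θ) (p : X) : LocalIsoAt A B θ p := by
  have hinj := h.isOpenEmbedding.injective
  have : Nonempty X := ⟨p⟩
  have hopen := h.isOpenEmbedding.isOpenMap
  have hcont := h.isOpenEmbedding.continuous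
  have hinv : ∀ q, Function.invFun θ (θ q) = q := Function.leftInverse_invFun hinj
  have hnhds : ∀ q, map θ (𝓝 q) = 𝓝 (θ q) := h.isOpenEmbedding.map_nhds_eq
  have hM : MorphAt A B θ p := by
    refine ⟨hcont.continuousAt, fun g hg => ?_⟩
    obtain ⟨U, hU, hsub, hgU⟩ := hg.exists_opens
      (h.isOpenEmbedding.isOpen_range.mem_nhds (Set.mem_range_self p))
    exact secAt_of_mem ((h.sec_iff U hsub g).1 hgU) hU
  refine ⟨hM, Function.invFun θ, ⟨?_, ?_⟩, hinv p, ?_, Eventually.of_forall hinv⟩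
  · unfold ContinuousAt
    rw [← hnhds, tendsto_map'_iff, hinv]
    have : Function.invFun θ ∘ θ = id := funext hinv
    rw [this]
    exact tendsto_id
  · intro g hg
    rw [hinv] at hg
    obtain ⟨U, hU, hgU⟩ := hg
    let V : Opens Y := ⟨θ '' U, hopen U U.isOpen⟩
    refine secAt_of_mem (U := V) ?_ ⟨p, hU, rfl⟩
    refine (h.sec_iff V (Set.image_subset_range _ _) _).2 ?_
    refine mem_sec_iff.2 fun q hq => ?_
    obtain ⟨q', hq', hqq⟩ := hq
    have : q' = q := hinj hqq
    subst this
    have : (fun q => g (Function.invFun θ q)) ∘ θ = g := by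
      funext q
      simp [hinv]
    rw [this]
    exact secAt_of_mem hgU hq'
  · rw [← hnhds]
    exact eventually_map.2 (Eventually.of_forall fun q => by rw [hinv])

/-! ### Germs of smooth functions -/

variable {E : Type*} [NormedAddCommGroup E] [NormedSpace ℝ E]
  {F : Type*} [NormedAddCommGroup F] [NormedSpace ℝ F]

/-- Near `p`, `s` is a smooth function of the smooth parts of finitely many exploded functions with
nonnegative exponents. -/
def SmoothFnAt (A : ExplodedSpace X) (p : X) (s : X → E) : Prop :=
  ∃ (ι : Type) (_ : Fintype ι) (g : ι → X → ExplUnit) (h : (ι → ℂ) → E),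
    (∀ i, A.SecAt p (g i) ∧ ∀ᶠ q in 𝓝 p, 0 ≤ (g i q).trop) ∧
    SmoothNear h (fun i => (g i p).smoothPart) ∧
    s =ᶠ[𝓝 p] fun q => h fun i => (g i q).smoothPart

theorem SmoothFnAt.congr {p : X} {s t : X → E} (h : A.SmoothFnAt p s) (ht : t =ᶠ[𝓝 p] s) :
    A.SmoothFnAt p t := by
  obtain ⟨ι, _, g, k, h1, h2, h3⟩ := h
  exact ⟨ι, _, g, k, h1, h2, ht.trans h3⟩

theorem SmoothFnAt.comp {p : X} {s : X → E} (h : A.SmoothFnAt p s) {k : E → F}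
    (hk : SmoothNear k (s p)) : A.SmoothFnAt p fun q => k (s q) := by
  obtain ⟨ι, _, g, l, h1, h2, h3⟩ := h
  refine ⟨ι, _, g, fun y => k (l y), h1, SmoothNear.comp ?_ h2, ?_⟩
  · have h4 : s p = l fun i => (g i p).smoothPart := h3.self_of_nhds
    rwa [← h4]
  · filter_upwards [h3] with q hq
    rw [hq]

theorem smoothFnAt_const (p : X) (c : E) : A.SmoothFnAt p fun _ => c :=
  ⟨Empty, inferInstance, Empty.elim, fun _ => c, fun i => i.elim, smoothNear_const _ _,
    Eventually.of_forall fun _ => rfl⟩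

theorem smoothFnAt_pi {ι : Type} [Fintype ι] {p : X} {s : X → ι → E}
    (h : ∀ i, A.SmoothFnAt p fun q => s q i) : A.SmoothFnAt p s := by
  choose κ hκ g k h1 h2 h3 using h
  refine ⟨Σ i, κ i, inferInstance, fun x => g x.1 x.2, fun y i => k i fun j => y ⟨i, j⟩,
    fun x => h1 x.1 x.2, smoothNear_pi fun i => ?_, ?_⟩
  · refine SmoothNear.comp (k := fun (y : (Σ i, κ i) → ℂ) j => y ⟨i, j⟩) (h2 i) ?_
    exact ContDiff.smoothNear (by fun_prop) _
  · filter_upwards [eventually_all.2 h3] with q hq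
    funext i
    exact hq i

theorem SmoothFnAt.prodMk {p : X} {s : X → E} {t : X → F} (hs : A.SmoothFnAt p s)
    (ht : A.SmoothFnAt p t) : A.SmoothFnAt p fun q => (s q, t q) := by
  obtain ⟨ι, _, g, k, h1, h2, h3⟩ := hs
  obtain ⟨ι', _, g', k', h1', h2', h3'⟩ := ht
  refine ⟨ι ⊕ ι', inferInstance, Sum.elim g g',
    fun y => (k fun i => y (.inl i), k' fun i => y (.inr i)), ?_, ?_, ?_⟩
  · rintro (i | i)
    · exact h1 i
    · exact h1' i
  · refine SmoothNear.prodMk ?_ ?_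
    · refine SmoothNear.comp (k := fun (y : ι ⊕ ι' → ℂ) i => y (.inl i)) h2 ?_
      exact ContDiff.smoothNear (by fun_prop) _
    · refine SmoothNear.comp (k := fun (y : ι ⊕ ι' → ℂ) i => y (.inr i)) h2' ?_
      exact ContDiff.smoothNear (by fun_prop) _
  · filter_upwards [h3, h3'] with q hq hq'
    rw [hq, hq']
    rfl

theorem SecAt.smoothFnAt {p : X} {g : X → ExplUnit} (h : A.SecAt p g)
    (h0 : ∀ᶠ q in 𝓝 p, 0 ≤ (g q).trop) : A.SmoothFnAt p fun q => (g q).smoothPart :=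
  ⟨Unit, inferInstance, fun _ => g, fun y => y (), fun _ => ⟨h, h0⟩,
    ContDiff.smoothNear (by fun_prop) _, Eventually.of_forall fun _ => rfl⟩

theorem MorphAt.smoothFnAt {θ : X → Y} {p : X} (h : MorphAt A B θ p) {s : Y → E}
    (hs : B.SmoothFnAt (θ p) s) : A.SmoothFnAt p fun q => s (θ q) := by
  obtain ⟨ι, _, g, k, h1, h2, h3⟩ := hs
  exact ⟨ι, _, fun i q => g i (θ q), k, fun i => ⟨h.2 _ (h1 i).1, h.1.eventually (h1 i).2⟩, h2,
    h.1.eventually h3⟩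

/-- Near `p`, smooth parts are continuous, and nonvanishing smooth functions are exploded
functions. -/
structure GoodAt (A : ExplodedSpace X) (p : X) : Prop where
  continuousAt : ∀ g, A.SecAt p g → (∀ᶠ q in 𝓝 p, 0 ≤ (g q).trop) →
    ContinuousAt (fun q => (g q).smoothPart) p
  secAt : ∀ s : X → ℂ, A.SmoothFnAt p s → s p ≠ 0 →
    A.SecAt p fun q => ExplUnit.ofComplex (s q)

theorem SmoothFnAt.continuousAt {p : X} (hA : A.GoodAt p) {s : X → E} (h : A.SmoothFnAt p s) :
    ContinuousAt s p := by
  obtain ⟨ι, _, g, k, h1, h2, h3⟩ := h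
  have : ContinuousAt (fun q => k fun i => (g i q).smoothPart) p :=
    ContinuousAt.comp (f := fun q i => (g i q).smoothPart) h2.continuousAt
      (continuousAt_pi.2 fun i => hA.continuousAt _ (h1 i).1 (h1 i).2)
  exact this.congr h3.symm

theorem SmoothFnAt.eventually {p : X} (hA : A.GoodAt p) {s : X → E} (h : A.SmoothFnAt p s) :
    ∀ᶠ q in 𝓝 p, A.SmoothFnAt q s := by
  obtain ⟨ι, _, g, k, h1, h2, h3⟩ := h
  have hc : ContinuousAt (fun q i => (g i q).smoothPart) p :=
    continuousAt_pi.2 fun i => hA.continuousAt _ (h1 i).1 (h1 i).2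
  filter_upwards [hc.eventually h2.eventually, eventually_eventually_nhds.2 h3,
    eventually_all.2 fun i => (h1 i).1.eventually,
    eventually_all.2 fun i => eventually_eventually_nhds.2 (h1 i).2] with q a b c d
  exact ⟨ι, _, g, k, fun i => ⟨c i, d i⟩, a, b⟩

/-- Both properties are invariant under isomorphism of germs, so verifying them on local models
suffices for exploded manifolds. -/
theorem LocalIsoAt.goodAt {θ : X → Y} {p : X} (h : LocalIsoAt A B θ p) (hA : A.GoodAt p) :
    B.GoodAt (θ p) := by
  have h' := h
  obtain ⟨h1, η, h2, h3, h4, h5⟩ := h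
  constructor
  · intro g hg h0
    have a := hA.continuousAt _ (h1.2 g hg) (h1.1.eventually h0)
    have b : ContinuousAt (fun q => (g (θ (η q))).smoothPart) (θ p) :=
      ContinuousAt.comp (f := η) (g := fun q => (g (θ q)).smoothPart) (by rwa [h3]) h2.1
    refine b.congr ?_
    filter_upwards [h4] with q hq
    rw [hq]
  · intro s hs h0
    exact h'.secAt_iff.1 (hA.secAt _ (h1.smoothFnAt hs) h0)

end ExplodedSpace

/-! ### Integral affine functions -/

section Affine

variable {m : ℕ}

/-- The linear function `v ↦ v · α`. -/
def linEval (α : Fin m → ℤ) (v : Fin m → ℝ) : ℝ := ∑ i, v i * (α i : ℝ)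

theorem affEval_eq (c : ℝ × (Fin m → ℤ)) (x : Fin m → ℝ) : affEval c x = c.1 + linEval c.2 x := rfl

theorem linEval_add_right (α : Fin m → ℤ) (v w : Fin m → ℝ) :
    linEval α (v + w) = linEval α v + linEval α w := by
  simp [linEval, add_mul, Finset.sum_add_distrib]

theorem linEval_smul_right (α : Fin m → ℤ) (r : ℝ) (v : Fin m → ℝ) :
    linEval α (r • v) = r * linEval α v := by
  simp [linEval, Finset.mul_sum, mul_assoc]

theorem linEval_sub_right (α : Fin m → ℤ) (v w : Fin m → ℝ) :
    linEval α (v - w) = linEval α v - linEval α w := by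
  simp [linEval, sub_mul, Finset.sum_sub_distrib]

theorem linEval_add_left (α β : Fin m → ℤ) (v : Fin m → ℝ) :
    linEval (α + β) v = linEval α v + linEval β v := by
  simp [linEval, mul_add, Finset.sum_add_distrib]

theorem linEval_smul_left (n : ℤ) (α : Fin m → ℤ) (v : Fin m → ℝ) :
    linEval (n • α) v = n * linEval α v := by
  simp only [linEval, Finset.mul_sum, Pi.smul_apply, smul_eq_mul, Int.cast_mul]
  exact Finset.sum_congr rfl fun i _ => by ring

@[simp] theorem linEval_zero_left (v : Fin m → ℝ) : linEval 0 v = 0 := by simp [linEval]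

theorem affEval_add_smul (c : ℝ × (Fin m → ℤ)) (x v : Fin m → ℝ) (r : ℝ) :
    affEval c (x + r • v) = affEval c x + r * linEval c.2 v := by
  rw [affEval_eq, affEval_eq, linEval_add_right, linEval_smul_right]
  ring

theorem affEval_add (c d : ℝ × (Fin m → ℤ)) (x : Fin m → ℝ) :
    affEval (c + d) x = affEval c x + affEval d x := by
  rw [affEval_eq, affEval_eq, affEval_eq, Prod.fst_add, Prod.snd_add, linEval_add_left]
  ring

@[simp] theorem affEval_zero (x : Fin m → ℝ) : affEval (0 : ℝ × (Fin m → ℤ)) x = 0 := by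
  simp [affEval_eq]

theorem affEval_neg (c : ℝ × (Fin m → ℤ)) (x : Fin m → ℝ) : affEval (-c) x = -affEval c x := by
  have := affEval_add c (-c) x
  rw [add_neg_cancel, affEval_zero] at this
  linarith

theorem affEval_nsmul (n : ℕ) (c : ℝ × (Fin m → ℤ)) (x : Fin m → ℝ) :
    affEval (n • c) x = n * affEval c x := by
  induction n with
  | zero => simp
  | succ n ih => rw [succ_nsmul, affEval_add, ih]; push_cast; ring

theorem affEval_sum {ι : Type*} (s : Finset ι) (c : ι → ℝ × (Fin m → ℤ)) (x : Fin m → ℝ) :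
    affEval (∑ i ∈ s, c i) x = ∑ i ∈ s, affEval (c i) x := by
  classical
  induction s using Finset.induction_on with
  | empty => simp
  | insert i s hi ih => rw [Finset.sum_insert hi, Finset.sum_insert hi, affEval_add, ih]

/-- The set cut out by weak and strict inequalities. -/
def polytope (s t : Finset (ℝ × (Fin m → ℤ))) : Set (Fin m → ℝ) :=
  {x | (∀ c ∈ s, 0 ≤ affEval c x) ∧ (∀ c ∈ t, 0 < affEval c x)}

variable {s t : Finset (ℝ × (Fin m → ℤ))}

/-- Moving a little from a point of a polytope in a direction that does not violate the active
constraints. -/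
theorem eventually_mem_polytope {y v : Fin m → ℝ} (hy : y ∈ polytope s t)
    (hv : ∀ c ∈ s, affEval c y = 0 → 0 ≤ linEval c.2 v) :
    ∀ᶠ r : ℝ in 𝓝[>] 0, y + r • v ∈ polytope s t ∧
      ∀ c ∈ s, affEval c y ≠ 0 → 0 < affEval c (y + r • v) := by
  have key : ∀ c : ℝ × (Fin m → ℤ), 0 < affEval c y →
      ∀ᶠ r : ℝ in 𝓝[>] 0, 0 < affEval c (y + r • v) := by
    intro c hc
    have h1 : ContinuousAt (fun r : ℝ => affEval c y + r * linEval c.2 v) 0 := by fun_prop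
    have h2 := h1.eventually_const_lt (by simpa using hc)
    refine (h2.filter_mono nhdsWithin_le_nhds).mono fun r hr => ?_
    rwa [affEval_add_smul]
  have h1 : ∀ c ∈ t, ∀ᶠ r : ℝ in 𝓝[>] 0, 0 < affEval c (y + r • v) := fun c hc => key c (hy.2 c hc)
  have h2 : ∀ c ∈ s, ∀ᶠ r : ℝ in 𝓝[>] 0, 0 ≤ affEval c (y + r • v) ∧
      (affEval c y ≠ 0 → 0 < affEval c (y + r • v)) := by
    intro c hc
    by_cases h0 : affEval c y = 0
    · filter_upwards [self_mem_nhdsWithin] with r hr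
      refine ⟨?_, fun h => absurd h0 h⟩
      rw [affEval_add_smul, h0, zero_add]
      exact mul_nonneg (le_of_lt hr) (hv c hc h0)
    · filter_upwards [key c (lt_of_le_of_ne (hy.1 c hc) (Ne.symm h0))] with r hr
      exact ⟨hr.le, fun _ => hr⟩
  filter_upwards [(Finset.eventually_all t).2 h1, (Finset.eventually_all s).2 h2] with r a b
  exact ⟨⟨fun c hc => (b c hc).1, a⟩, fun c hc => (b c hc).2⟩

/-- The points of a polytope in the relative interior of the same face as `y`. -/
def SameFace (s t : Finset (ℝ × (Fin m → ℤ))) (y : Fin m → ℝ) : Set (Fin m → ℝ) :=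
  {x | x ∈ polytope s t ∧ ∀ c ∈ s, affEval c x = 0 ↔ affEval c y = 0}

theorem SameFace.self {y : Fin m → ℝ} (hy : y ∈ polytope s t) : y ∈ SameFace s t y :=
  ⟨hy, fun _ _ => Iff.rfl⟩

theorem SameFace.symm {x y : Fin m → ℝ} (hy : y ∈ polytope s t) (hx : x ∈ SameFace s t y) :
    y ∈ SameFace s t x :=
  ⟨hy, fun c hc => (hx.2 c hc).symm⟩

/-- Moving a little within the relative interior of a face. -/
theorem eventually_mem_sameFace {y v : Fin m → ℝ} (hy : y ∈ polytope s t)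
    (hv : ∀ c ∈ s, affEval c y = 0 → linEval c.2 v = 0) :
    ∀ᶠ r : ℝ in 𝓝[>] 0, y + r • v ∈ SameFace s t y := by
  filter_upwards [eventually_mem_polytope hy fun c hc h => (hv c hc h).ge] with r hr
  refine ⟨hr.1, fun c hc => ⟨fun h => ?_, fun h => ?_⟩⟩
  · by_contra h0
    exact absurd h (hr.2 c hc h0).ne'
  · rw [affEval_add_smul, h, hv c hc h]
    simp

theorem linEval_sub_eq_zero_of_sameFace {x y : Fin m → ℝ} (hx : x ∈ SameFace s t y)
    {c : ℝ × (Fin m → ℤ)} (hc : c ∈ s) (h : affEval c y = 0) : linEval c.2 (y - x) = 0 := by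
  have h1 := (hx.2 c hc).2 h
  rw [affEval_eq] at h h1
  rw [linEval_sub_right]
  linarith

/-- An affine function that is nonnegative on the relative interior of a face and vanishes at one
of its points vanishes identically there. -/
theorem affEval_eq_zero_of_sameFace {x y : Fin m → ℝ} (hy : y ∈ polytope s t)
    (hx : x ∈ SameFace s t y) {d : ℝ × (Fin m → ℤ)}
    (hd : ∀ w ∈ SameFace s t y, 0 ≤ affEval d w) (h0 : affEval d y = 0) : affEval d x = 0 := by
  -- The segment from `x` to `y` can be prolonged a little beyond `y` within the face; an affine
  -- function that is nonnegative at both ends and zero at `y` vanishes on it.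
  have h1 := eventually_mem_sameFace (v := y - x) hy
    fun c hc h => linEval_sub_eq_zero_of_sameFace hx hc h
  obtain ⟨r, hr, hr0⟩ := (h1.and self_mem_nhdsWithin).exists
  have h2 := hd _ hr
  rw [affEval_add_smul, h0, linEval_sub_right, zero_add] at h2
  have h3 : 0 ≤ linEval d.2 y - linEval d.2 x := nonneg_of_mul_nonneg_right h2 hr0
  have h4 := hd x hx
  rw [affEval_eq] at h0 h4 ⊢
  linarith

open Classical in
/-- An affine function that is nonnegative on the relative interior of a face becomes nonnegative
on the whole polytope after adding a multiple of the sum of the constraints active on the face. -/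
theorem exists_nonneg_add_nsmul {y : Fin m → ℝ} (hy : y ∈ polytope s t) {c : ℝ × (Fin m → ℤ)}
    (hc : ∀ x ∈ SameFace s t y, 0 ≤ affEval c x) :
    ∃ M : ℕ, ∀ x ∈ polytope s t,
      0 ≤ affEval (c + M • ∑ l ∈ s.filter (fun l => affEval l y = 0), l) x := by
  set A := s.filter (fun l => affEval l y = 0)
  -- Homogenisation: an affine function becomes a linear functional of (τ, v) whose restriction to τ
  -- = 1 is the original function, so that the linear Farkas lemma applies.
  let hom : ℝ × (Fin m → ℤ) → (ℝ × (Fin m → ℝ)) →ₗ[ℝ] ℝ := fun d =>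
    { toFun := fun w => d.1 * w.1 + linEval d.2 w.2
      map_add' := fun a b => by simp only [Prod.fst_add, Prod.snd_add, linEval_add_right]; ring
      map_smul' := fun r a => by
        simp only [Prod.smul_fst, Prod.smul_snd, linEval_smul_right, smul_eq_mul, RingHom.id_apply]
        ring }
  have hom_apply : ∀ d w, hom d w = d.1 * w.1 + linEval d.2 w.2 := fun _ _ => rfl
  have hom_one : ∀ d x, hom d (1, x) = affEval d x := fun d x => by
    rw [hom_apply, affEval_eq, mul_one]
  let T : Finset (ℝ × (Fin m → ℤ)) := insert (1, 0) (s ∪ t ∪ A.image Neg.neg)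
  obtain ⟨r, hr, hsum⟩ := exists_nonneg_combination_of_forall_nonneg T hom (hom c) (by
    rintro ⟨τ, v⟩ h
    have hτ : 0 ≤ τ := by simpa [hom_apply] using h (1, 0) (by simp [T])
    have hs : ∀ l ∈ s, 0 ≤ hom l (τ, v) := fun l hl => h l (by simp [T, hl])
    have ht : ∀ l ∈ t, 0 ≤ hom l (τ, v) := fun l hl => h l (by simp [T, hl])
    have hA : ∀ l ∈ A, hom l (τ, v) = 0 := by
      intro l hl
      have h1 := hs l (Finset.mem_filter.1 hl).1
      have h2 := h (-l) (by
        simp only [T, Finset.mem_insert, Finset.mem_union, Finset.mem_image]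
        exact Or.inr (Or.inr ⟨l, hl, rfl⟩))
      have h3 : hom (-l) (τ, v) = -hom l (τ, v) := by
        have : linEval (-l).2 v = -linEval l.2 v := by
          have := linEval_smul_left (-1) l.2 v
          simpa using this
        rw [hom_apply, hom_apply, this]
        simp
        ring
      rw [h3] at h2
      linarith
    -- Any (τ, v) satisfying the homogenised constraints is an asymptotic direction of the face: the
    -- rescaled point (y + R v)/(1 + R τ) has the same active constraints as `y`. Nonnegativity of
    -- `c` there for all R > 0 forces `hom c (τ, v) ≥ 0`.
    have key : ∀ R : ℝ, 0 < R → 0 ≤ affEval c y + R * hom c (τ, v) := by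
      intro R hR
      have hpos : 0 < 1 + R * τ := by positivity
      have hform : ∀ l : ℝ × (Fin m → ℤ), affEval l ((1 + R * τ)⁻¹ • (y + R • v)) =
          (1 + R * τ)⁻¹ * (affEval l y + R * hom l (τ, v)) := by
        intro l
        rw [affEval_eq, affEval_eq, linEval_smul_right, linEval_add_right, linEval_smul_right,
          hom_apply]
        field_simp
        ring
      have hmem : (1 + R * τ)⁻¹ • (y + R • v) ∈ SameFace s t y := by
        refine ⟨⟨fun l hl => ?_, fun l hl => ?_⟩, fun l hl => ?_⟩
        · rw [hform]
          have := hs l hl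
          have := hy.1 l hl
          positivity
        · rw [hform]
          have := ht l hl
          have := hy.2 l hl
          positivity
        · rw [hform, mul_eq_zero, or_iff_right (inv_pos.2 hpos).ne']
          constructor
          · intro h0
            have h1 := hs l hl
            have h2 := hy.1 l hl
            have h3 : 0 ≤ R * hom l (τ, v) := by positivity
            linarith
          · intro h0
            rw [h0, hA l (Finset.mem_filter.2 ⟨hl, h0⟩)]
            simp
      have := hc _ hmem
      rw [hform] at this
      exact nonneg_of_mul_nonneg_right this (inv_pos.2 hpos)
    by_contra hneg
    push Not at hneg
    have h0 : 0 ≤ affEval c y := hc y (SameFace.self hy)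
    have h1 := key ((affEval c y + 1) / (-hom c (τ, v))) (div_pos (by linarith) (by linarith))
    have h2 : (affEval c y + 1) / (-hom c (τ, v)) * hom c (τ, v) = -(affEval c y + 1) := by
      field_simp [hneg.ne]
    rw [h2] at h1
    linarith)
  obtain ⟨M, hM⟩ := exists_nat_ge (∑ d ∈ T, r d)
  refine ⟨M, fun x hx => ?_⟩
  have hle : ∀ l ∈ A, 0 ≤ affEval l x := fun l hl => hx.1 l (Finset.mem_filter.1 hl).1
  have hA0 : 0 ≤ ∑ l ∈ A, affEval l x := Finset.sum_nonneg hle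
  -- On the polytope only the negated active constraints can be negative, and each of those is at
  -- least minus the sum of all active ones. Hence any `M` above the total Farkas weight works.
  have h1 : ∀ d ∈ T, -∑ l ∈ A, affEval l x ≤ affEval d x := by
    intro d hd
    simp only [T, Finset.mem_insert, Finset.mem_union, Finset.mem_image] at hd
    rcases hd with rfl | (hd | hd) | ⟨l, hl, rfl⟩
    · have : affEval ((1, 0) : ℝ × (Fin m → ℤ)) x = 1 := by simp [affEval_eq]
      rw [this]
      linarith
    · have := hx.1 d hd
      linarith
    · have := hx.2 d hd
      linarith
    · rw [affEval_neg]
      have := Finset.single_le_sum hle hl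
      linarith
  have h2 : affEval c x = ∑ d ∈ T, r d * affEval d x := by
    have := LinearMap.congr_fun hsum (1, x)
    simpa [hom_one] using this
  have h3 : -(∑ d ∈ T, r d) * ∑ l ∈ A, affEval l x ≤ affEval c x := by
    rw [h2, ← Finset.sum_neg_distrib, Finset.sum_mul]
    refine Finset.sum_le_sum fun d hd => ?_
    have := mul_le_mul_of_nonneg_left (h1 d hd) (hr d)
    linarith
  rw [affEval_add, affEval_nsmul, affEval_sum]
  nlinarith

end Affine

/-! ### Monomials -/

section Monomial

variable {m : ℕ}

theorem trop_monomial (c : ℝ × (Fin m → ℤ)) (z : Fin m → ExplUnit) :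
    (monomial c z).trop = affEval c fun i => (z i).trop := by
  simp only [monomial, ExplUnit.trop_mul, ExplUnit.trop_prod, ExplUnit.trop_zpow, affEval]
  congr 1
  exact Finset.sum_congr rfl fun i _ => mul_comm _ _

theorem coeff_monomial (c : ℝ × (Fin m → ℤ)) (z : Fin m → ExplUnit) :
    (monomial c z).1 = ∏ i, (z i).1 ^ c.2 i := by
  simp [monomial, Prod.fst_prod]

theorem monomial_zero (z : Fin m → ExplUnit) : monomial 0 z = 1 := by
  simp [monomial]

theorem monomial_nsmul (n : ℕ) (c : ℝ × (Fin m → ℤ)) (z : Fin m → ExplUnit) :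
    monomial (n • c) z = monomial c z ^ n := by
  induction n with
  | zero => rw [zero_smul, monomial_zero, pow_zero]
  | succ n ih => rw [succ_nsmul, Model.monomial_mul, ih, pow_succ]

open ExplodedSpace in
theorem ExplodedSpace.secAt_monomial {X : Type*} [TopologicalSpace X] {A : ExplodedSpace X} {p : X}
    (c : ℝ × (Fin m → ℤ)) {z : X → Fin m → ExplUnit} (hz : ∀ i, A.SecAt p fun q => z q i) :
    A.SecAt p fun q => monomial c (z q) :=
  (secAt_const p _).mul (SecAt.prod _ fun i _ => (hz i).zpow _)

end Monomial

/-! ### The local models -/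

namespace Model

variable {n m : ℕ} {P : Set (Fin m → ℝ)}

/-- The tropical part of a point. -/
def trop (q : Model n m P) : Fin m → ℝ := fun i => (q.z i).trop

/-- The coordinate map that induces the topology. -/
theorem isInducing_coords : Topology.IsInducing
    fun q : Model n m P => (q.x, fun c : NonnegMonomial P => zeta c q) := ⟨rfl⟩

theorem continuous_x : Continuous (Model.x : Model n m P → _) :=
  continuous_fst.comp isInducing_coords.continuous

theorem continuous_zeta (c : NonnegMonomial P) : Continuous (zeta c : Model n m P → ℂ) :=
  (continuous_apply c).comp (continuous_snd.comp isInducing_coords.continuous)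

theorem tendsto_nhds_iff {α : Type*} {l : Filter α} {θ : α → Model n m P} {q : Model n m P} :
    Tendsto θ l (𝓝 q) ↔ Tendsto (fun a => (θ a).x) l (𝓝 q.x) ∧
      ∀ c, Tendsto (fun a => zeta c (θ a)) l (𝓝 (zeta c q)) := by
  rw [isInducing_coords.tendsto_nhds_iff, nhds_prod_eq, tendsto_prod_iff']
  refine and_congr Iff.rfl ?_
  rw [tendsto_pi_nhds]
  rfl

theorem inseparable_of_eq {p q : Model n m P} (hx : p.x = q.x) (hz : ∀ c, zeta c p = zeta c q) :
    Inseparable p q := by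
  rw [← isInducing_coords.inseparable_iff]
  rw [hx, funext hz]

theorem trop_monomial_nonneg (c : NonnegMonomial P) (q : Model n m P) :
    0 ≤ (monomial c.1 q.z).trop := by
  rw [trop_monomial]
  exact c.2 _ q.mem

theorem zeta_eq_of_trop {c : NonnegMonomial P} {q : Model n m P} (h : affEval c.1 q.trop = 0) :
    zeta c q = (monomial c.1 q.z).1 :=
  ExplUnit.smoothPart_of_trop_eq_zero (by rw [trop_monomial]; exact h)

theorem zeta_ne_zero_iff {c : NonnegMonomial P} {q : Model n m P} :
    zeta c q ≠ 0 ↔ affEval c.1 q.trop = 0 := by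
  unfold zeta
  rw [ExplUnit.smoothPart_ne_zero_iff, trop_monomial]
  rfl

/-! ### Germs of smooth functions on a local model. -/

section ModelSmooth

variable {E : Type*} [NormedAddCommGroup E] [NormedSpace ℝ E]
  {F : Type*} [NormedAddCommGroup F] [NormedSpace ℝ F]

/-- Near `q`, `s` is a smooth function of the coordinates `x` and of finitely many smooth
monomials. -/
def SmoothFormAt (q : Model n m P) (s : Model n m P → E) : Prop :=
  ∃ (ι : Type) (_ : Fintype ι) (ζ : ι → NonnegMonomial P) (h : (Fin n → ℝ) × (ι → ℂ) → E),
    SmoothNear h (q.x, fun i => zeta (ζ i) q) ∧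
    s =ᶠ[𝓝 q] fun r => h (r.x, fun i => zeta (ζ i) r)

theorem SmoothFormAt.congr {q : Model n m P} {s t : Model n m P → E} (h : SmoothFormAt q s)
    (ht : t =ᶠ[𝓝 q] s) : SmoothFormAt q t := by
  obtain ⟨ι, _, ζ, k, h1, h2⟩ := h
  exact ⟨ι, _, ζ, k, h1, ht.trans h2⟩

theorem SmoothFormAt.comp {q : Model n m P} {s : Model n m P → E} (h : SmoothFormAt q s)
    {k : E → F} (hk : SmoothNear k (s q)) : SmoothFormAt q fun r => k (s r) := by
  obtain ⟨ι, _, ζ, l, h1, h2⟩ := h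
  refine ⟨ι, _, ζ, fun y => k (l y), SmoothNear.comp ?_ h1, ?_⟩
  · have h3 : s q = l (q.x, fun i => zeta (ζ i) q) := h2.self_of_nhds
    rwa [← h3]
  · filter_upwards [h2] with r hr
    rw [hr]

theorem smoothFormAt_pi {ι : Type} [Fintype ι] {q : Model n m P} {s : Model n m P → ι → E}
    (h : ∀ i, SmoothFormAt q fun r => s r i) : SmoothFormAt q s := by
  choose κ hκ ζ k h1 h2 using h
  refine ⟨Σ i, κ i, inferInstance, fun x => ζ x.1 x.2, fun y i => k i (y.1, fun j => y.2 ⟨i, j⟩),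
    smoothNear_pi fun i => ?_, ?_⟩
  · refine SmoothNear.comp (k := fun (y : (Fin n → ℝ) × ((Σ i, κ i) → ℂ)) =>
      (y.1, fun j => y.2 ⟨i, j⟩)) (h1 i) ?_
    exact ContDiff.smoothNear (by fun_prop) _
  · filter_upwards [eventually_all.2 h2] with r hr
    funext i
    exact hr i

theorem SmoothFormAt.prodMk {q : Model n m P} {s : Model n m P → E} {t : Model n m P → F}
    (hs : SmoothFormAt q s) (ht : SmoothFormAt q t) : SmoothFormAt q fun r => (s r, t r) := by
  obtain ⟨ι, _, ζ, k, h1, h2⟩ := hs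
  obtain ⟨ι', _, ζ', k', h1', h2'⟩ := ht
  refine ⟨ι ⊕ ι', inferInstance, Sum.elim ζ ζ',
    fun y => (k (y.1, fun i => y.2 (.inl i)), k' (y.1, fun i => y.2 (.inr i))), ?_, ?_⟩
  · refine SmoothNear.prodMk ?_ ?_
    · refine SmoothNear.comp (k := fun (y : (Fin n → ℝ) × (ι ⊕ ι' → ℂ)) =>
        (y.1, fun i => y.2 (.inl i))) h1 ?_
      exact ContDiff.smoothNear (by fun_prop) _
    · refine SmoothNear.comp (k := fun (y : (Fin n → ℝ) × (ι ⊕ ι' → ℂ)) =>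
        (y.1, fun i => y.2 (.inr i))) h1' ?_
      exact ContDiff.smoothNear (by fun_prop) _
  · filter_upwards [h2, h2'] with r hr hr'
    rw [hr, hr']
    rfl

theorem SmoothFormAt.mul {q : Model n m P} {s t : Model n m P → ℂ}
    (hs : SmoothFormAt q s) (ht : SmoothFormAt q t) : SmoothFormAt q fun r => s r * t r :=
  (hs.prodMk ht).comp (k := fun y : ℂ × ℂ => y.1 * y.2) (ContDiff.smoothNear (by fun_prop) _)

theorem SmoothFormAt.inv {q : Model n m P} {s : Model n m P → ℂ}
    (hs : SmoothFormAt q s) (h0 : s q ≠ 0) : SmoothFormAt q fun r => (s r)⁻¹ :=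
  hs.comp ((ContDiff.smoothNear contDiff_id _).inv h0)

theorem SmoothFormAt.pow {q : Model n m P} {s : Model n m P → ℂ}
    (hs : SmoothFormAt q s) (k : ℕ) : SmoothFormAt q fun r => s r ^ k :=
  hs.comp (k := fun y : ℂ => y ^ k) (ContDiff.smoothNear (by fun_prop) _)

theorem smoothFormAt_zeta (q : Model n m P) (c : NonnegMonomial P) : SmoothFormAt q (zeta c) :=
  ⟨Unit, inferInstance, fun _ => c, fun y => y.2 (), ContDiff.smoothNear (by fun_prop) _,
    Eventually.of_forall fun _ => rfl⟩

theorem smoothFormAt_x (q : Model n m P) : SmoothFormAt q (Model.x : Model n m P → _) :=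
  ⟨Empty, inferInstance, Empty.elim, fun y => y.1, ContDiff.smoothNear (by fun_prop) _,
    Eventually.of_forall fun _ => rfl⟩

theorem SmoothFormAt.continuousAt {q : Model n m P} {s : Model n m P → E}
    (h : SmoothFormAt q s) : ContinuousAt s q := by
  obtain ⟨ι, _, ζ, k, h1, h2⟩ := h
  have : ContinuousAt (fun r : Model n m P => k (r.x, fun i => zeta (ζ i) r)) q := by
    refine ContinuousAt.comp (f := fun r : Model n m P => (r.x, fun i => zeta (ζ i) r))
      h1.continuousAt ?_
    exact (continuous_x.prodMk (continuous_pi fun i => continuous_zeta (ζ i))).continuousAt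
  exact this.congr h2.symm

end ModelSmooth

/-- The globally smooth, nowhere zero function demanded by `HasForm` can be replaced by a germ,
since a nonvanishing germ extends to such a function. -/
theorem secAt_iff {q : Model n m P} {g : Model n m P → ExplUnit} :
    (space n m P).SecAt q g ↔ ∃ (s : Model n m P → ℂ) (c : ℝ × (Fin m → ℤ)),
      SmoothFormAt q s ∧ s q ≠ 0 ∧
      g =ᶠ[𝓝 q] fun r => ExplUnit.ofComplex (s r) * monomial c r.z := by
  constructor
  · rintro ⟨U, hq, hU⟩
    obtain ⟨V, hqV, -, N, ζ, h, hne, c, hh, hV⟩ := hU q hq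
    refine ⟨fun r => h (r.x, fun i => zeta (ζ i) r), c,
      ⟨Fin N, inferInstance, ζ, h, hh.smoothNear _, EventuallyEq.rfl⟩, hne _, ?_⟩
    filter_upwards [V.isOpen.mem_nhds hqV] with r hr
    rw [hV r hr, ExplUnit.ofComplex_of_ne_zero (hne _)]
  · rintro ⟨s, c, ⟨ι, _, ζ, k, h1, h2⟩, h0, hg⟩
    have h3 : s q = k (q.x, fun i => zeta (ζ i) q) := h2.self_of_nhds
    obtain ⟨k', hk', hne, hkk⟩ := h1.exists_contDiff_ne_zero (by rwa [← h3])
    have hcont : ContinuousAt (fun r : Model n m P => (r.x, fun i => zeta (ζ i) r)) q :=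
      (continuous_x.prodMk (continuous_pi fun i => continuous_zeta (ζ i))).continuousAt
    obtain ⟨S, hS, hSo, hqS⟩ := eventually_nhds_iff.1 ((hg.and h2).and (hcont.eventually hkk))
    let V : Opens (Model n m P) := ⟨S, hSo⟩
    refine ⟨V, hqS, fun r hr => ⟨V, hr, le_rfl, Fintype.card ι,
      fun i => ζ ((Fintype.equivFin ι).symm i),
      fun y => k' (y.1, fun i => y.2 (Fintype.equivFin ι i)), fun y => hne _, c, ?_, ?_⟩⟩
    · exact hk'.comp (by fun_prop)
    · intro r hr
      obtain ⟨⟨a, b⟩, e⟩ := hS r hr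
      have : s r = k' (r.x, fun i => zeta (ζ i) r) := by rw [b, e]
      rw [a]
      dsimp only
      congr 1
      rw [this, ExplUnit.ofComplex_of_ne_zero (hne _)]
      simp

theorem secAt_z (q : Model n m P) (i : Fin m) : (space n m P).SecAt q fun r => r.z i := by
  refine secAt_iff.2 ⟨fun _ => 1, (0, Pi.single i 1), ?_, one_ne_zero, ?_⟩
  · exact (smoothFormAt_x q).comp (k := fun _ => (1 : ℂ)) (smoothNear_const _ _)
  · refine Eventually.of_forall fun r => ?_
    dsimp only
    rw [ExplUnit.ofComplex_of_ne_zero one_ne_zero]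
    have : ∏ j, r.z j ^ (Pi.single i (1 : ℤ) : Fin m → ℤ) j = r.z i := by
      rw [Finset.prod_eq_single i]
      · simp
      · intro j _ hj
        simp [hj]
      · simp
    simp only [monomial, this]
    ext <;> simp

theorem secAt_of_smoothFormAt {q : Model n m P} {s : Model n m P → ℂ} (hs : SmoothFormAt q s)
    (h0 : s q ≠ 0) : (space n m P).SecAt q fun r => ExplUnit.ofComplex (s r) :=
  secAt_iff.2 ⟨s, 0, hs, h0, Eventually.of_forall fun r => by simp only [monomial_zero, mul_one]⟩

theorem secAt_monomial (q : Model n m P) (c : ℝ × (Fin m → ℤ)) :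
    (space n m P).SecAt q fun r => monomial c r.z :=
  ExplodedSpace.secAt_monomial c fun i => secAt_z q i

/-- The point with the tropical part replaced. -/
def withTrop (q : Model n m P) (x : Fin m → ℝ) (hx : x ∈ P) : Model n m P :=
  ⟨q.x, fun i => ((q.z i).1, Multiplicative.ofAdd (x i)), hx⟩

@[simp] theorem trop_withTrop (q : Model n m P) (x : Fin m → ℝ) (hx : x ∈ P) :
    (q.withTrop x hx).trop = x := rfl

/-- A monomial with nonnegative exponent on `P` has zero exponent either everywhere or nowhere on
the relative interior of a face, and coefficients are kept. So no smooth monomial sees where in that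
relative interior the tropical part lies. -/
theorem inseparable_withTrop {s t : Finset (ℝ × (Fin m → ℤ))} (hP : P = polytope s t)
    (q : Model n m P) {x : Fin m → ℝ} (hx : x ∈ SameFace s t q.trop) :
    Inseparable q (q.withTrop x (hP ▸ hx.1)) := by
  subst hP
  refine inseparable_of_eq rfl fun c => ?_
  have hq : q.trop ∈ polytope s t := q.mem
  have h1 : affEval c.1 q.trop = 0 ↔ affEval c.1 x = 0 :=
    ⟨fun h => affEval_eq_zero_of_sameFace hq hx (fun w hw => c.2 w hw.1) h,
     fun h => affEval_eq_zero_of_sameFace hx.1 (SameFace.symm hq hx) (fun w hw => c.2 w hw.1) h⟩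
  by_cases h : affEval c.1 q.trop = 0
  · rw [zeta_eq_of_trop h, zeta_eq_of_trop (by rw [trop_withTrop]; exact h1.1 h), coeff_monomial,
      coeff_monomial]
    rfl
  · have h2 := mt zeta_ne_zero_iff.1 h
    have h3 : ¬ zeta c (q.withTrop x hx.1) ≠ 0 := by
      rw [zeta_ne_zero_iff, trop_withTrop]
      exact mt h1.2 h
    push Not at h2 h3
    rw [h2, h3]

/-- The smooth part of an exploded function with nonnegative exponents is smooth. -/
theorem smoothFormAt_smoothPart (hP : IsIntegralAffinePolytope P) {q : Model n m P}
    {g : Model n m P → ExplUnit} (hg : (space n m P).SecAt q g)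
    (h0 : ∀ᶠ r in 𝓝 q, 0 ≤ (g r).trop) : SmoothFormAt q fun r => (g r).smoothPart := by
  classical
  obtain ⟨σ, c, hσ, hσ0, hgf⟩ := secAt_iff.1 hg
  obtain ⟨-, s, t, hPst⟩ := hP
  change P = polytope s t at hPst
  have hq : q.trop ∈ polytope s t := hPst ▸ q.mem
  -- Moving within the open face gives an inseparable point, which lies in every neighbourhood of
  -- `q`; nonnegativity near `q` therefore spreads over the whole face.
  have hc : ∀ x ∈ SameFace s t q.trop, 0 ≤ affEval c x := by
    intro x hx
    have hi := inseparable_withTrop hPst q hx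
    have h1 : ∀ᶠ r : Model n m P in 𝓝 q, 0 ≤ affEval c r.trop := by
      filter_upwards [h0, hgf] with r hr hr'
      rw [hr', ExplUnit.trop_mul, ExplUnit.trop_ofComplex, zero_add, trop_monomial] at hr
      exact hr
    rw [hi.nhds_eq] at h1
    simpa using h1.self_of_nhds
  obtain ⟨M, hM⟩ := exists_nonneg_add_nsmul hq hc
  set A := s.filter (fun l => affEval l q.trop = 0)
  set e : ℝ × (Fin m → ℤ) := ∑ l ∈ A, l
  have he : ∀ x ∈ P, 0 ≤ affEval e x := by
    intro x hx
    rw [hPst] at hx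
    rw [affEval_sum]
    exact Finset.sum_nonneg fun l hl => hx.1 l (Finset.mem_filter.1 hl).1
  -- The exponent of `c` may be negative elsewhere on `P`. Adding `M` times the active constraints
  -- corrects this, and their monomial `e'` has exponent 0 and nonzero smooth part near `q`, so it
  -- can be divided out again.
  let d : NonnegMonomial P := ⟨c + M • e, fun x hx => hM x (hPst ▸ hx)⟩
  let e' : NonnegMonomial P := ⟨e, he⟩
  have heq : affEval e q.trop = 0 := by
    rw [affEval_sum]
    exact Finset.sum_eq_zero fun l hl => (Finset.mem_filter.1 hl).2
  have hζ : zeta e' q ≠ 0 := zeta_ne_zero_iff.2 heq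
  refine ((hσ.mul (smoothFormAt_zeta q d)).mul (((smoothFormAt_zeta q e').pow M).inv
    (pow_ne_zero _ hζ))).congr ?_
  filter_upwards [hgf, hσ.continuousAt.eventually_ne hσ0,
    (continuous_zeta e').continuousAt.eventually_ne hζ] with r hr hσr hζr
  have her : affEval e r.trop = 0 := zeta_ne_zero_iff.1 hζr
  have h1 : zeta d r = (monomial c r.z).smoothPart * zeta e' r ^ M := by
    unfold zeta
    rw [show d.1 = c + M • e from rfl, monomial_mul, monomial_nsmul, mul_comm,
      ExplUnit.smoothPart_mul_of_trop_eq_zero, mul_comm,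
      ExplUnit.smoothPart_of_trop_eq_zero (a := monomial e'.1 r.z)]
    · simp [e']
    · rw [trop_monomial]; exact her
    · rw [← zpow_natCast, ExplUnit.trop_zpow, trop_monomial]
      change _ * affEval e r.trop = 0
      rw [her, mul_zero]
  rw [hr, ExplUnit.smoothPart_mul_of_trop_eq_zero (ExplUnit.trop_ofComplex _),
    ExplUnit.coeff_ofComplex hσr, h1]
  field_simp

theorem smoothFormAt_of_smoothFnAt (hP : IsIntegralAffinePolytope P) {q : Model n m P}
    {E : Type*} [NormedAddCommGroup E] [NormedSpace ℝ E] {s : Model n m P → E}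
    (hs : (space n m P).SmoothFnAt q s) : SmoothFormAt q s := by
  obtain ⟨ι, _, g, k, h1, h2, h3⟩ := hs
  have h4 : SmoothFormAt q fun r i => (g i r).smoothPart :=
    smoothFormAt_pi fun i => smoothFormAt_smoothPart hP (h1 i).1 (h1 i).2
  exact (h4.comp h2).congr h3

theorem goodAt (hP : IsIntegralAffinePolytope P) (q : Model n m P) : (space n m P).GoodAt q where
  continuousAt _ hg h0 := (smoothFormAt_smoothPart hP hg h0).continuousAt
  secAt _ hs h0 := secAt_of_smoothFormAt (smoothFormAt_of_smoothFnAt hP hs) h0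

theorem smoothFnAt_zeta (q : Model n m P) (c : NonnegMonomial P) :
    (space n m P).SmoothFnAt q (zeta c) :=
  (secAt_monomial q c.1).smoothFnAt (Eventually.of_forall fun r => trop_monomial_nonneg c r)

/-- `SmoothFnAt` only allows smooth parts of exploded functions, so a real coordinate is recovered
as the logarithm of the exploded function exp(x_i). -/
theorem smoothFnAt_x (q : Model n m P) : (space n m P).SmoothFnAt q (Model.x : Model n m P → _) := by
  refine ExplodedSpace.smoothFnAt_pi fun i => ?_
  have h1 : (space n m P).SecAt q fun r => ExplUnit.ofComplex (Complex.exp (r.x i)) := by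
    refine secAt_of_smoothFormAt ((smoothFormAt_x q).comp
      (k := fun x : Fin n → ℝ => Complex.exp (x i)) ?_) (Complex.exp_ne_zero _)
    exact ContDiff.smoothNear (by
      have : ContDiff ℝ ∞ fun x : Fin n → ℝ => ((x i : ℝ) : ℂ) :=
        Complex.ofRealCLM.contDiff.comp (by fun_prop)
      exact this.cexp) _
  have h2 := (h1.smoothFnAt (Eventually.of_forall fun r => (ExplUnit.trop_ofComplex _).ge)).comp
    (k := fun y => (Complex.log y).re) ?_
  · refine h2.congr (Eventually.of_forall fun r => ?_)
    dsimp only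
    rw [ExplUnit.smoothPart_ofComplex (Complex.exp_ne_zero _), ← Complex.ofReal_exp,
      ← Complex.ofReal_log (Real.exp_pos _).le, Complex.ofReal_re, Real.log_exp]
  · refine SmoothNear.comp (h := Complex.re) (ContDiff.smoothNear Complex.reCLM.contDiff _) ?_
    refine smoothNear_log ?_
    rw [ExplUnit.smoothPart_ofComplex (Complex.exp_ne_zero _), ← Complex.ofReal_exp]
    exact Complex.ofReal_mem_slitPlane.2 (Real.exp_pos _)

theorem SmoothFormAt.smoothFnAt {q : Model n m P} {E : Type*} [NormedAddCommGroup E]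
    [NormedSpace ℝ E] {s : Model n m P → E} (hs : SmoothFormAt q s) :
    (space n m P).SmoothFnAt q s := by
  obtain ⟨ι, _, ζ, k, h1, h2⟩ := hs
  exact (((smoothFnAt_x q).prodMk
    (ExplodedSpace.smoothFnAt_pi fun i => smoothFnAt_zeta q (ζ i))).comp h1).congr h2

open ExplodedSpace in
/-- A map to a local model is a morphism if its components are smooth, resp. exploded,
functions. -/
theorem morphAt_of_components {X : Type*} [TopologicalSpace X] {A : ExplodedSpace X} {p : X}
    (hA : A.GoodAt p) {θ : X → Model n m P} (hx : A.SmoothFnAt p fun q => (θ q).x)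
    (hz : ∀ i, A.SecAt p fun q => (θ q).z i) : MorphAt A (space n m P) θ p := by
  have hζ : ∀ c : NonnegMonomial P, A.SmoothFnAt p fun q => zeta c (θ q) := fun c =>
    (ExplodedSpace.secAt_monomial c.1 hz).smoothFnAt
      (Eventually.of_forall fun q => trop_monomial_nonneg c (θ q))
  have hcont : ContinuousAt θ p := by
    refine tendsto_nhds_iff.2 ⟨hx.continuousAt hA, fun c => (hζ c).continuousAt hA⟩
  refine ⟨hcont, fun g hg => ?_⟩
  obtain ⟨s, c, ⟨ι, _, ζ, k, h1, h2⟩, h0, hgf⟩ := secAt_iff.1 hg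
  have h3 : A.SmoothFnAt p fun q => k ((θ q).x, fun i => zeta (ζ i) (θ q)) :=
    (hx.prodMk (smoothFnAt_pi fun i => hζ (ζ i))).comp h1
  have h4 : s (θ p) = k ((θ p).x, fun i => zeta (ζ i) (θ p)) := h2.self_of_nhds
  refine ((hA.secAt _ h3 (by rwa [← h4])).mul (ExplodedSpace.secAt_monomial c hz)).congr ?_
  filter_upwards [hcont.eventually hgf, hcont.eventually h2] with q a b
  rw [a, b]

end Model

/-! ### Arithmetic in the exploded semiring -/

namespace Expl

theorem mul_coeff (a b : Expl) : (a * b).coeff = a.coeff * b.coeff := rfl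

theorem mul_exp (a b : Expl) : (a * b).exp = a.exp + b.exp := rfl

theorem add_of_lt {a b : Expl} (h : a.exp < b.exp) : a + b = a := if_pos h

theorem add_of_gt {a b : Expl} (h : b.exp < a.exp) : a + b = b := by
  change ite _ _ _ = _
  rw [if_neg (not_lt.2 h.le), if_pos h]

theorem add_of_eq {a b : Expl} (h : a.exp = b.exp) : a + b = ⟨a.coeff + b.coeff, a.exp⟩ := by
  change ite _ _ _ = _
  rw [if_neg h.not_lt, if_neg h.symm.not_lt]

theorem mk_add_mk (a b : ℂ) (x : ℝ) : (⟨a, x⟩ + ⟨b, x⟩ : Expl) = ⟨a + b, x⟩ := add_of_eq rfl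

theorem mk_mul_mk (a b : ℂ) (x y : ℝ) : (⟨a, x⟩ * ⟨b, y⟩ : Expl) = ⟨a * b, x + y⟩ := rfl

theorem add_exp (a b : Expl) : (a + b).exp = min a.exp b.exp := by
  rcases lt_trichotomy a.exp b.exp with h | h | h
  · rw [add_of_lt h, min_eq_left h.le]
  · rw [add_of_eq h, min_eq_left h.le]
  · rw [add_of_gt h, min_eq_right h.le]

end Expl

namespace ExplUnit

theorem toExpl_mul (a b : ExplUnit) : (a * b).toExpl = a.toExpl * b.toExpl := by
  ext1
  · simp [toExpl, Expl.mul_coeff]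
  · rfl

theorem toExpl_one : (1 : ExplUnit).toExpl = ⟨1, 0⟩ := by
  ext1
  · simp [toExpl]
  · rfl

/-- Adding `1` takes the smooth part. -/
theorem one_add_toExpl {a : ExplUnit} (h : 0 ≤ a.trop) :
    (⟨1, 0⟩ + a.toExpl : Expl) = ⟨1 + a.smoothPart, 0⟩ := by
  rcases h.eq_or_lt with h | h
  · rw [Expl.add_of_eq (by exact h), smoothPart_of_trop_eq_zero h.symm]
    rfl
  · rw [Expl.add_of_lt (by exact h), smoothPart_of_trop_ne_zero h.ne', add_zero]

end ExplUnit

namespace ExplodedSpace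

variable {X : Type*} {Y : Type*} [TopologicalSpace X] [TopologicalSpace Y]
  {A : ExplodedSpace X} {B : ExplodedSpace Y}

/-! ### Germs of tropical functions -/

theorem tropicalAt_iff {p : X} {f : X → Expl} : A.TropicalAt p f ↔
    ∃ (g₀ : X → ExplUnit) (l : List (X → ExplUnit)), A.SecAt p g₀ ∧ (∀ g ∈ l, A.SecAt p g) ∧
      ∀ᶠ q in 𝓝 p, f q = l.foldl (fun s g => s + (g q).toExpl) (g₀ q).toExpl := by
  constructor
  · rintro ⟨U, hp, hU⟩
    obtain ⟨V, hpV, -, g₀, l, h1, h2, h3⟩ := hU p hp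
    refine ⟨g₀, l, secAt_of_mem h1 hpV, fun g hg => secAt_of_mem (h2 g hg) hpV, ?_⟩
    filter_upwards [V.isOpen.mem_nhds hpV] with q hq using h3 q hq
  · rintro ⟨g₀, l, h1, h2, h3⟩
    have h4 : ∀ᶠ q in 𝓝 p, ∀ g ∈ l, A.SecAt q g := by
      clear h3
      induction l with
      | nil => simp
      | cons g l ih =>
        filter_upwards [(h2 g (by simp)).eventually, ih fun g hg => h2 g (by simp [hg])] with q a b
        intro g' hg'
        rcases List.mem_cons.1 hg' with rfl | h
        · exact a
        · exact b g' h
    obtain ⟨S, hS, hSo, hpS⟩ := eventually_nhds_iff.1 ((h1.eventually.and h4).and h3)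
    let V : Opens X := ⟨S, hSo⟩
    refine ⟨V, hpS, fun q hq => ⟨V, hq, le_rfl, g₀, l, ?_, ?_, ?_⟩⟩
    · exact mem_sec_iff.2 fun r hr => (hS r hr).1.1
    · exact fun g hg => mem_sec_iff.2 fun r hr => (hS r hr).1.2 g hg
    · exact fun r hr => (hS r hr).2

theorem SecAt.tropicalAt {p : X} {g : X → ExplUnit} (h : A.SecAt p g) :
    A.TropicalAt p fun q => (g q).toExpl :=
  tropicalAt_iff.2 ⟨g, [], h, by simp, Eventually.of_forall fun q => rfl⟩

theorem TropicalAt.congr {p : X} {f f' : X → Expl} (h : A.TropicalAt p f) (hf : f' =ᶠ[𝓝 p] f) :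
    A.TropicalAt p f' := by
  obtain ⟨g₀, l, h1, h2, h3⟩ := tropicalAt_iff.1 h
  exact tropicalAt_iff.2 ⟨g₀, l, h1, h2, by filter_upwards [hf, h3] with q a b; rw [a, b]⟩

theorem TropicalAt.add_secAt {p : X} {f : X → Expl} (h : A.TropicalAt p f) {g : X → ExplUnit}
    (hg : A.SecAt p g) : A.TropicalAt p fun q => f q + (g q).toExpl := by
  obtain ⟨g₀, l, h1, h2, h3⟩ := tropicalAt_iff.1 h
  refine tropicalAt_iff.2 ⟨g₀, l ++ [g], h1, ?_, ?_⟩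
  · intro g' hg'
    rcases List.mem_append.1 hg' with h | h
    · exact h2 g' h
    · rw [List.mem_singleton.1 h]
      exact hg
  · filter_upwards [h3] with q hq
    rw [hq, List.foldl_append]
    rfl

/-- A real function may vanish and is then not exploded, but y + i never vanishes. Writing y = (y +
i) + (-i) makes every smooth real function a tropical one. -/
theorem mem_realLine_add_I : (fun y : ℝ => ExplUnit.ofComplex ((y : ℂ) + Complex.I)) ∈
    realLine.sec ⊤ := by
  have hne : ∀ y : ℝ, (y : ℂ) + Complex.I ≠ 0 := fun y h => by
    have := congrArg Complex.im h
    simp at this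
  intro y _
  refine ⟨⊤, trivial, le_rfl, fun y => (y : ℂ) + Complex.I, hne, 0, ?_, fun y _ => ?_⟩
  · exact Complex.ofRealCLM.contDiff.add contDiff_const
  · exact ExplUnit.ofComplex_of_ne_zero (hne y)

theorem SmoothAt.secAt_add_I {p : X} {f : X → ℝ} (h : A.SmoothAt p f) :
    A.SecAt p fun q => ExplUnit.ofComplex ((f q : ℂ) + Complex.I) := by
  obtain ⟨U, hp, hU⟩ := h
  exact secAt_of_mem (hU.pullback ⊤ _ mem_realLine_add_I) ⟨hp, trivial⟩

theorem ofReal_add_I_ne_zero (y : ℝ) : (y : ℂ) + Complex.I ≠ 0 := fun h => by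
  have := congrArg Complex.im h
  simp at this

theorem ofReal_eq_add (y : ℝ) : Expl.ofReal y =
    (ExplUnit.ofComplex ((y : ℂ) + Complex.I)).toExpl +
      (ExplUnit.ofComplex (-Complex.I)).toExpl := by
  rw [ExplUnit.toExpl_ofComplex (ofReal_add_I_ne_zero y),
    ExplUnit.toExpl_ofComplex (neg_ne_zero.2 Complex.I_ne_zero), Expl.mk_add_mk]
  simp [Expl.ofReal]

theorem SmoothAt.tropicalAt_ofReal {p : X} {f : X → ℝ} (h : A.SmoothAt p f) :
    A.TropicalAt p fun q => Expl.ofReal (f q) := by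
  simp only [ofReal_eq_add]
  exact h.secAt_add_I.tropicalAt.add_secAt (secAt_const _ _)

/-- Tangent vectors are determined by their values on exploded functions. -/
theorem TangentVector.ext_of_secAt {p : X} {v w : A.TangentVector p}
    (h : ∀ g, A.SecAt p g → v.onTropical (fun q => (g q).toExpl) =
      w.onTropical fun q => (g q).toExpl) :
    (∀ f, A.TropicalAt p f → v.onTropical f = w.onTropical f) ∧
      ∀ f, A.SmoothAt p f → v.onSmooth f = w.onSmooth f := by
  have h1 : ∀ f, A.TropicalAt p f → v.onTropical f = w.onTropical f := by
    intro f hf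
    obtain ⟨g₀, l, h1, h2, h3⟩ := tropicalAt_iff.1 hf
    have key : ∀ (l : List (X → ExplUnit)) (F : X → Expl), A.TropicalAt p F →
        v.onTropical F = w.onTropical F → (∀ g ∈ l, A.SecAt p g) →
        v.onTropical (fun q => l.foldl (fun s g => s + (g q).toExpl) (F q)) =
          w.onTropical fun q => l.foldl (fun s g => s + (g q).toExpl) (F q) := by
      intro l
      induction l with
      | nil => intro F _ hF _; exact hF
      | cons g l ih =>
        intro F hF hvw hl
        have hg := hl g (by simp)
        refine ih (fun q => F q + (g q).toExpl) (hF.add_secAt hg) ?_ fun g hg => hl g (by simp [hg])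
        rw [v.tropical_add _ _ hF hg.tropicalAt, w.tropical_add _ _ hF hg.tropicalAt, hvw, h g hg]
    rw [v.tropical_germ _ _ hf h3, w.tropical_germ _ _ hf h3]
    exact key l _ h1.tropicalAt (h g₀ h1) h2
  refine ⟨h1, fun f hf => ?_⟩
  have h2 := h1 _ hf.tropicalAt_ofReal
  rw [v.compat f hf, w.compat f hf] at h2
  have := congrArg Expl.coeff h2
  exact Complex.ofReal_injective this

/-! ### Derivatives along curves -/

/-- Along `γ`, the exponents of exploded functions near `p` are constant and their coefficients are
differentiable. -/
structure CurveAt (A : ExplodedSpace X) (p : X) (γ : ℝ → X) : Prop where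
  zero : γ 0 = p
  continuousAt : ContinuousAt γ 0
  trop : ∀ g, A.SecAt p g → ∀ᶠ s in 𝓝 (0 : ℝ), (g (γ s)).trop = (g p).trop
  differentiableAt : ∀ g, A.SecAt p g → DifferentiableAt ℝ (fun s => ((g (γ s)).1 : ℂ)) 0

theorem CurveAt.map {p : X} {γ : ℝ → X} (h : A.CurveAt p γ) {θ : X → Y} (hθ : MorphAt A B θ p) :
    B.CurveAt (θ p) fun s => θ (γ s) where
  zero := by rw [h.zero]
  continuousAt := ContinuousAt.comp (by rw [h.zero]; exact hθ.1) h.continuousAt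
  trop g hg := h.trop _ (hθ.2 g hg)
  differentiableAt g hg := h.differentiableAt _ (hθ.2 g hg)

/-- Along `γ`, the exponent of `f` is constant and its coefficient is differentiable. -/
def DiffAlong {Z : Type*} (γ : ℝ → Z) (f : Z → Expl) : Prop :=
  (∀ᶠ s in 𝓝 (0 : ℝ), (f (γ s)).exp = (f (γ 0)).exp) ∧
    DifferentiableAt ℝ (fun s => (f (γ s)).coeff) 0

/-- The derivative along `γ`. -/
def derivAlong {Z : Type*} (γ : ℝ → Z) (f : Z → Expl) : Expl :=
  ⟨deriv (fun s => (f (γ s)).coeff) 0, (f (γ 0)).exp⟩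

/-- Both exponents are constant along the curve near 0, so the same case of the tropical addition
applies at all small times. -/
theorem DiffAlong.add {Z : Type*} {γ : ℝ → Z} {f g : Z → Expl} (hf : DiffAlong γ f) (hg : DiffAlong γ g) :
    DiffAlong γ (fun q => f q + g q) ∧
      derivAlong γ (fun q => f q + g q) = derivAlong γ f + derivAlong γ g := by
  have hexp : ∀ᶠ s in 𝓝 (0 : ℝ), (f (γ s) + g (γ s)).exp = (f (γ 0) + g (γ 0)).exp := by
    filter_upwards [hf.1, hg.1] with s a b
    rw [Expl.add_exp, Expl.add_exp, a, b]
  rcases lt_trichotomy (f (γ 0)).exp (g (γ 0)).exp with h | h | h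
  · have h1 : (fun s => (f (γ s) + g (γ s)).coeff) =ᶠ[𝓝 0] fun s => (f (γ s)).coeff := by
      filter_upwards [hf.1, hg.1] with s a b
      rw [Expl.add_of_lt (by rwa [a, b])]
    refine ⟨⟨hexp, hf.2.congr_of_eventuallyEq h1⟩, ?_⟩
    rw [Expl.add_of_lt (a := derivAlong γ f) (by exact h), derivAlong, derivAlong, h1.deriv_eq,
      Expl.add_of_lt h]
  · have h1 : (fun s => (f (γ s) + g (γ s)).coeff) =ᶠ[𝓝 0]
        fun s => (f (γ s)).coeff + (g (γ s)).coeff := by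
      filter_upwards [hf.1, hg.1] with s a b
      rw [Expl.add_of_eq (by rw [a, b, h])]
    refine ⟨⟨hexp, (hf.2.add hg.2).congr_of_eventuallyEq h1⟩, ?_⟩
    rw [Expl.add_of_eq (a := derivAlong γ f) (by exact h), derivAlong, derivAlong, h1.deriv_eq,
      Expl.add_of_eq h, deriv_fun_add hf.2 hg.2]
    rfl
  · have h1 : (fun s => (f (γ s) + g (γ s)).coeff) =ᶠ[𝓝 0] fun s => (g (γ s)).coeff := by
      filter_upwards [hf.1, hg.1] with s a b
      rw [Expl.add_of_gt (by rwa [a, b])]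
    refine ⟨⟨hexp, hg.2.congr_of_eventuallyEq h1⟩, ?_⟩
    rw [Expl.add_of_gt (a := derivAlong γ f) (by exact h), derivAlong, derivAlong, h1.deriv_eq,
      Expl.add_of_gt h]

theorem DiffAlong.congr {p : X} {γ : ℝ → X} (hγ : A.CurveAt p γ) {f g : X → Expl}
    (hf : DiffAlong γ f) (h : f =ᶠ[𝓝 p] g) : DiffAlong γ g := by
  have h1 : ∀ᶠ s in 𝓝 (0 : ℝ), f (γ s) = g (γ s) :=
    hγ.continuousAt.eventually (by rw [hγ.zero]; exact h)
  have h2 : f (γ 0) = g (γ 0) := h1.self_of_nhds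
  refine ⟨?_, hf.2.congr_of_eventuallyEq ?_⟩
  · filter_upwards [hf.1, h1] with s a b
    rw [← b, a, h2]
  · filter_upwards [h1] with s b
    rw [b]

theorem CurveAt.diffAlong {p : X} {γ : ℝ → X} (hγ : A.CurveAt p γ) {f : X → Expl}
    (hf : A.TropicalAt p f) : DiffAlong γ f := by
  obtain ⟨g₀, l, h1, h2, h3⟩ := tropicalAt_iff.1 hf
  have hsec : ∀ g, A.SecAt p g → DiffAlong γ fun q => (g q).toExpl := fun g hg =>
    ⟨by rw [hγ.zero]; exact hγ.trop g hg, hγ.differentiableAt g hg⟩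
  have key : ∀ (l : List (X → ExplUnit)) (F : X → Expl), DiffAlong γ F →
      (∀ g ∈ l, A.SecAt p g) →
      DiffAlong γ (fun q => l.foldl (fun s g => s + (g q).toExpl) (F q)) := by
    intro l
    induction l with
    | nil => intro F hF _; exact hF
    | cons g l ih =>
      intro F hF hl
      exact ih _ (hF.add (hsec g (hl g (by simp)))).1 fun g hg => hl g (by simp [hg])
  exact (key l _ (hsec g₀ h1) h2).congr hγ (EventuallyEq.symm h3)

theorem CurveAt.differentiableAt_smooth {p : X} {γ : ℝ → X} (hγ : A.CurveAt p γ) {f : X → ℝ}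
    (hf : A.SmoothAt p f) : DifferentiableAt ℝ (fun s => f (γ s)) 0 := by
  have h1 := hγ.differentiableAt _ hf.secAt_add_I
  simp only [ExplUnit.coeff_ofComplex (ofReal_add_I_ne_zero _)] at h1
  have h2 := Complex.reCLM.differentiableAt.comp (0 : ℝ) h1
  refine h2.congr_of_eventuallyEq (Eventually.of_forall fun s => ?_)
  simp

/-- The tangent vector of a curve. -/
def CurveAt.tangentVector {p : X} {γ : ℝ → X} (hγ : A.CurveAt p γ) : A.TangentVector p where
  onSmooth f := deriv (fun s => f (γ s)) 0
  onTropical f := derivAlong γ f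
  smooth_germ f g _ h := by
    refine EventuallyEq.deriv_eq ?_
    exact hγ.continuousAt.eventually (by rw [hγ.zero]; exact h)
  tropical_germ f g _ h := by
    have h1 : ∀ᶠ s in 𝓝 (0 : ℝ), f (γ s) = g (γ s) :=
      hγ.continuousAt.eventually (by rw [hγ.zero]; exact h)
    unfold derivAlong
    rw [h1.self_of_nhds]
    congr 1
    refine EventuallyEq.deriv_eq ?_
    filter_upwards [h1] with s hs
    rw [hs]
  smooth_add f g hf hg :=
    deriv_fun_add (hγ.differentiableAt_smooth hf) (hγ.differentiableAt_smooth hg)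
  tropical_add f g hf hg := ((hγ.diffAlong hf).add (hγ.diffAlong hg)).2
  smooth_mul f g hf hg := by
    rw [deriv_fun_mul (hγ.differentiableAt_smooth hf) (hγ.differentiableAt_smooth hg), hγ.zero]
  tropical_mul f g hf hg := by
    have h1 := hγ.diffAlong hf
    have h2 := hγ.diffAlong hg
    unfold derivAlong
    simp only [Expl.mul_coeff, Expl.mul_exp]
    rw [deriv_fun_mul h1.2 h2.2, hγ.zero]
    exact (Expl.add_of_eq (a := ⟨deriv (fun s => (f (γ s)).coeff) 0, (f p).exp⟩ * g p)
      (b := f p * ⟨deriv (fun s => (g (γ s)).coeff) 0, (g p).exp⟩) rfl).symm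
  tropical_smul a f hf := by
    have h1 := hγ.diffAlong hf
    unfold derivAlong
    simp only [Expl.mul_coeff, Expl.mul_exp]
    rw [deriv_const_mul_field]
    rfl
  compat f hf := by
    have h1 := (hγ.differentiableAt_smooth hf).hasDerivAt.ofReal_comp
    unfold derivAlong
    simp only [Expl.ofReal]
    rw [h1.deriv]

end ExplodedSpace

namespace Model

variable {n m : ℕ} {P : Set (Fin m → ℝ)}

/-! ### Curves in the local models -/

/-- The curve `(x + s ξ, exp (s λ) z̃)`. -/
def curve (q : Model n m P) (ξ : Fin n → ℝ) (lam : Fin m → ℂ) (s : ℝ) : Model n m P where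
  x := q.x + s • ξ
  z i := ExplUnit.ofComplex (Complex.exp (s * lam i)) * q.z i
  mem := by
    simp only [ExplUnit.trop_mul, ExplUnit.trop_ofComplex, zero_add]
    exact q.mem

/-- The logarithmic derivative of the monomial `t^a z̃^α` in the direction `λ`. -/
def logDot (c : ℝ × (Fin m → ℤ)) (lam : Fin m → ℂ) : ℂ := ∑ i, c.2 i * lam i

theorem curve_zero (q : Model n m P) (ξ : Fin n → ℝ) (lam : Fin m → ℂ) : q.curve ξ lam 0 = q := by
  ext1
  · simp [curve]
  · funext i
    simp only [curve, Complex.ofReal_zero, zero_mul, Complex.exp_zero]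
    rw [ExplUnit.ofComplex_of_ne_zero one_ne_zero]
    ext <;> simp

theorem trop_curve (q : Model n m P) (ξ : Fin n → ℝ) (lam : Fin m → ℂ) (s : ℝ) :
    (q.curve ξ lam s).trop = q.trop := by
  funext i
  simp [trop, curve]

theorem coeff_monomial_curve (q : Model n m P) (ξ : Fin n → ℝ) (lam : Fin m → ℂ) (s : ℝ)
    (c : ℝ × (Fin m → ℤ)) : ((monomial c (q.curve ξ lam s).z).1 : ℂ) =
      Complex.exp (s * logDot c lam) * (monomial c q.z).1 := by
  rw [coeff_monomial, coeff_monomial]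
  simp only [curve, Prod.fst_mul, mul_zpow, Finset.prod_mul_distrib, Units.val_mul,
    Units.coe_prod, Units.val_zpow_eq_zpow_val, ExplUnit.coeff_ofComplex (Complex.exp_ne_zero _)]
  congr 1
  rw [logDot, Finset.mul_sum, Complex.exp_sum]
  refine Finset.prod_congr rfl fun i _ => ?_
  rw [← Complex.exp_int_mul]
  congr 1
  ring

theorem trop_monomial_curve (q : Model n m P) (ξ : Fin n → ℝ) (lam : Fin m → ℂ) (s : ℝ)
    (c : ℝ × (Fin m → ℤ)) : (monomial c (q.curve ξ lam s).z).trop = (monomial c q.z).trop := by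
  rw [trop_monomial, trop_monomial]
  exact congrArg _ (trop_curve q ξ lam s)

theorem zeta_curve (q : Model n m P) (ξ : Fin n → ℝ) (lam : Fin m → ℂ) (s : ℝ)
    (c : NonnegMonomial P) :
    zeta c (q.curve ξ lam s) = Complex.exp (s * logDot c.1 lam) * zeta c q := by
  unfold zeta
  by_cases h : (monomial c.1 q.z).trop = 0
  · rw [ExplUnit.smoothPart_of_trop_eq_zero h, ExplUnit.smoothPart_of_trop_eq_zero
      (by rwa [trop_monomial_curve]), coeff_monomial_curve]
  · rw [ExplUnit.smoothPart_of_trop_ne_zero h, ExplUnit.smoothPart_of_trop_ne_zero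
      (by rwa [trop_monomial_curve]), mul_zero]

theorem hasDerivAt_exp_mul (a : ℂ) : HasDerivAt (fun s : ℝ => Complex.exp (s * a)) a 0 := by
  have h1 : HasDerivAt (fun s : ℝ => (s : ℂ) * a) a 0 := by
    simpa using (hasDerivAt_id (0 : ℝ)).ofReal_comp.mul_const a
  simpa using h1.cexp

theorem hasDerivAt_coords_curve (q : Model n m P) (ξ : Fin n → ℝ) (lam : Fin m → ℂ) {ι : Type}
    [Fintype ι] (ζ : ι → NonnegMonomial P) :
    HasDerivAt (fun s : ℝ => ((q.curve ξ lam s).x, fun i => zeta (ζ i) (q.curve ξ lam s)))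
      (ξ, fun i => logDot (ζ i).1 lam * zeta (ζ i) q) 0 := by
  refine HasDerivAt.prodMk ?_ (hasDerivAt_pi.2 fun i => ?_)
  · simpa [curve] using ((hasDerivAt_id (0 : ℝ)).smul_const ξ).const_add q.x
  · simp only [zeta_curve]
    exact (hasDerivAt_exp_mul _).mul_const _

theorem continuousAt_curve (q : Model n m P) (ξ : Fin n → ℝ) (lam : Fin m → ℂ) :
    ContinuousAt (q.curve ξ lam) 0 := by
  unfold ContinuousAt
  rw [curve_zero]
  refine tendsto_nhds_iff.2 ⟨?_, fun c => ?_⟩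
  · have : Continuous fun s => (q.curve ξ lam s).x := by
      change Continuous fun s : ℝ => q.x + s • ξ
      fun_prop
    have h := this.tendsto 0
    rwa [curve_zero] at h
  · have : Continuous fun s => zeta c (q.curve ξ lam s) := by
      simp only [zeta_curve]
      fun_prop
    have h := this.tendsto 0
    rwa [curve_zero] at h

theorem hasDerivAt_smoothForm_curve (q : Model n m P) (ξ : Fin n → ℝ) (lam : Fin m → ℂ) {ι : Type}
    [Fintype ι] (ζ : ι → NonnegMonomial P) {h : (Fin n → ℝ) × (ι → ℂ) → ℂ}
    (hh : SmoothNear h (q.x, fun i => zeta (ζ i) q)) {s : Model n m P → ℂ}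
    (hs : s =ᶠ[𝓝 q] fun r => h (r.x, fun i => zeta (ζ i) r)) :
    HasDerivAt (fun t => s (q.curve ξ lam t))
      (fderiv ℝ h (q.x, fun i => zeta (ζ i) q) (ξ, fun i => logDot (ζ i).1 lam * zeta (ζ i) q))
      0 := by
  have h1 : HasFDerivAt h (fderiv ℝ h (q.x, fun i => zeta (ζ i) q))
      ((q.curve ξ lam 0).x, fun i => zeta (ζ i) (q.curve ξ lam 0)) := by
    rw [curve_zero]
    exact hh.differentiableAt.hasFDerivAt
  have h2 := h1.comp_hasDerivAt (0 : ℝ) (hasDerivAt_coords_curve q ξ lam ζ)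
  refine h2.congr_of_eventuallyEq ?_
  exact (continuousAt_curve q ξ lam).eventually (by rw [curve_zero]; exact hs)

/-- The coefficient of an exploded function along a curve. -/
theorem hasDerivAt_coeff_curve (q : Model n m P) (ξ : Fin n → ℝ) (lam : Fin m → ℂ)
    {g : Model n m P → ExplUnit} {s : Model n m P → ℂ} {c : ℝ × (Fin m → ℤ)} {s' : ℂ}
    (hs : HasDerivAt (fun t => s (q.curve ξ lam t)) s' 0) (h0 : s q ≠ 0)
    (hg : g =ᶠ[𝓝 q] fun r => ExplUnit.ofComplex (s r) * monomial c r.z) :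
    HasDerivAt (fun t => ((g (q.curve ξ lam t)).1 : ℂ))
      ((s' + s q * logDot c lam) * (monomial c q.z).1) 0 := by
  have h1 := (hs.mul (hasDerivAt_exp_mul (logDot c lam))).mul_const ((monomial c q.z).1 : ℂ)
  simp only [Complex.ofReal_zero, zero_mul, Complex.exp_zero, curve_zero, mul_one] at h1
  refine h1.congr_of_eventuallyEq ?_
  have h2 : ∀ᶠ t in 𝓝 (0 : ℝ), s (q.curve ξ lam t) ≠ 0 :=
    hs.continuousAt.eventually_ne (by rwa [curve_zero])
  have h3 := (continuousAt_curve q ξ lam).eventually (by rw [curve_zero]; exact hg)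
  filter_upwards [h2, h3] with t a b
  rw [b, Prod.fst_mul, Units.val_mul, ExplUnit.coeff_ofComplex a, coeff_monomial_curve, ← mul_assoc]
  rfl

theorem curveAt (q : Model n m P) (ξ : Fin n → ℝ) (lam : Fin m → ℂ) :
    (space n m P).CurveAt q (q.curve ξ lam) where
  zero := curve_zero q ξ lam
  continuousAt := continuousAt_curve q ξ lam
  trop g hg := by
    obtain ⟨s, c, -, -, hgf⟩ := secAt_iff.1 hg
    have h1 := (continuousAt_curve q ξ lam).eventually (by rw [curve_zero]; exact hgf)
    filter_upwards [h1] with t ht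
    rw [ht, hgf.self_of_nhds]
    simp [trop_monomial_curve]
  differentiableAt g hg := by
    obtain ⟨s, c, ⟨ι, _, ζ, h, hh, hs⟩, h0, hgf⟩ := secAt_iff.1 hg
    exact (hasDerivAt_coeff_curve q ξ lam (hasDerivAt_smoothForm_curve q ξ lam ζ hh hs)
      h0 hgf).differentiableAt

end Model

/-! ### Every tangent vector is the tangent vector of a curve -/

namespace ExplodedSpace

variable {X : Type*} [TopologicalSpace X] {B : ExplodedSpace X} {p : X}

theorem smoothAt_const (p : X) (c : ℝ) : B.SmoothAt p fun _ => c :=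
  ⟨⊤, trivial, continuousOn_const, fun _ g _ => B.const _ (g c)⟩

/-- A smooth real-valued function on a good space is a morphism to the real line. -/
theorem SmoothFnAt.smoothAt (hB : ∀ q, B.GoodAt q) {f : X → ℝ} (hf : B.SmoothFnAt p f) :
    B.SmoothAt p f := by
  obtain ⟨S, hS, hSo, hpS⟩ := eventually_nhds_iff.1 (hf.eventually (hB p))
  refine ⟨⟨S, hSo⟩, hpS, ⟨fun q hq => ((hS q hq).continuousAt (hB q)).continuousWithinAt, ?_⟩⟩
  intro V g hg
  refine mem_sec_iff.2 fun q hq => ?_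
  obtain ⟨W, hqW, -, h, hne, a, hh, hW⟩ := hg (f q) hq.2
  have hfq := hS q hq.1
  have h1 : B.SmoothFnAt q fun r => h (f r) := hfq.comp (hh.smoothNear _)
  refine (((hB q).secAt _ h1 (hne _)).mul (secAt_const q (1, Multiplicative.ofAdd a))).congr ?_
  filter_upwards [(hfq.continuousAt (hB q)).eventually (W.isOpen.mem_nhds hqW)] with r hr
  rw [Function.comp_apply, hW _ hr, ExplUnit.ofComplex_of_ne_zero (hne _)]
  ext <;> simp

/-! ### Logarithmic derivatives and the chain rule for abstract tangent vectors. -/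

namespace TangentVector

variable (w : B.TangentVector p)

theorem onSmooth_one : w.onSmooth (fun _ => 1) = 0 := by
  have h := w.smooth_mul _ _ (smoothAt_const p 1) (smoothAt_const p 1)
  simp only [mul_one, one_mul] at h
  linarith

theorem onTropical_one : w.onTropical (fun _ => ⟨1, 0⟩) = ⟨0, 0⟩ := by
  have h := w.compat _ (smoothAt_const p 1)
  rw [w.onSmooth_one] at h
  simpa [Expl.ofReal] using h

theorem tropicalAt_one : B.TropicalAt p fun _ => ⟨1, 0⟩ := by
  have := (secAt_const (A := B) p 1).tropicalAt
  simpa only [ExplUnit.toExpl_one] using this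

theorem onTropical_mul_secAt {g h : X → ExplUnit} (hg : B.SecAt p g) (hh : B.SecAt p h) :
    w.onTropical (fun q => (g q * h q).toExpl) =
      w.onTropical (fun q => (g q).toExpl) * (h p).toExpl +
        (g p).toExpl * w.onTropical fun q => (h q).toExpl := by
  rw [← w.tropical_mul _ _ hg.tropicalAt hh.tropicalAt]
  simp only [ExplUnit.toExpl_mul]

/-- The exponent of a sum is the minimum of the exponents, so the Leibniz rule gives inequalities: g
= g · 1 bounds the exponent of v(g) from above and g · g⁻¹ = 1 from below. -/
theorem onTropical_secAt_exp {g : X → ExplUnit} (hg : B.SecAt p g) :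
    (w.onTropical fun q => (g q).toExpl).exp = (g p).trop := by
  apply le_antisymm
  · have h := w.onTropical_mul_secAt hg (secAt_const p 1)
    simp only [mul_one, ExplUnit.toExpl_one] at h
    rw [w.onTropical_one] at h
    have h2 := congrArg Expl.exp h
    rw [Expl.add_exp, Expl.mul_exp, Expl.mul_exp] at h2
    simp only [add_zero] at h2
    rw [h2]
    exact min_le_right _ _
  · have h := w.onTropical_mul_secAt hg hg.inv
    simp only [mul_inv_cancel, ExplUnit.toExpl_one] at h
    rw [w.onTropical_one] at h
    have h2 := congrArg Expl.exp h
    rw [Expl.add_exp, Expl.mul_exp, Expl.mul_exp] at h2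
    simp only [ExplUnit.toExpl, ExplUnit.trop_inv] at h2
    have := h2 ▸ min_le_left _ _
    simp only [ExplUnit.toExpl]
    linarith

/-- The logarithmic derivative of an exploded function. -/
def logDeriv (g : X → ExplUnit) : ℂ :=
  (w.onTropical fun q => (g q).toExpl).coeff / (g p).1

theorem onTropical_secAt {g : X → ExplUnit} (hg : B.SecAt p g) :
    w.onTropical (fun q => (g q).toExpl) = ⟨w.logDeriv g * (g p).1, (g p).trop⟩ := by
  ext1
  · simp [logDeriv]
  · exact w.onTropical_secAt_exp hg

theorem logDeriv_mul {g h : X → ExplUnit} (hg : B.SecAt p g) (hh : B.SecAt p h) :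
    w.logDeriv (fun q => g q * h q) = w.logDeriv g + w.logDeriv h := by
  have h1 := w.onTropical_mul_secAt hg hh
  rw [w.onTropical_secAt hg, w.onTropical_secAt hh, w.onTropical_secAt (hg.mul hh)] at h1
  simp only [ExplUnit.toExpl, Expl.mk_mul_mk, Expl.mk_add_mk] at h1
  have h2 := congrArg Expl.coeff h1
  simp only [Prod.fst_mul, Units.val_mul] at h2
  have hg0 : ((g p).1 : ℂ) ≠ 0 := (g p).1.ne_zero
  have hh0 : ((h p).1 : ℂ) ≠ 0 := (h p).1.ne_zero
  have h3 : w.logDeriv (fun q => g q * h q) * (((g p).1 : ℂ) * (h p).1) =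
      (w.logDeriv g + w.logDeriv h) * (((g p).1 : ℂ) * (h p).1) := by rw [h2]; ring
  exact mul_right_cancel₀ (mul_ne_zero hg0 hh0) h3

theorem logDeriv_const (a : ExplUnit) : w.logDeriv (fun _ => a) = 0 := by
  have h1 := w.tropical_smul a.toExpl _ tropicalAt_one
  rw [w.onTropical_one] at h1
  have h2 : (fun _ : X => a.toExpl * (⟨1, 0⟩ : Expl)) = fun _ => a.toExpl := by
    funext _
    rw [← ExplUnit.toExpl_one, ← ExplUnit.toExpl_mul, mul_one]
  rw [h2] at h1
  simp [logDeriv, h1, Expl.mul_coeff]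

theorem logDeriv_inv {g : X → ExplUnit} (hg : B.SecAt p g) :
    w.logDeriv (fun q => (g q)⁻¹) = -w.logDeriv g := by
  have h1 := w.logDeriv_mul hg hg.inv
  simp only [mul_inv_cancel, w.logDeriv_const] at h1
  exact (neg_eq_of_add_eq_zero_right h1.symm).symm

theorem logDeriv_zpow {g : X → ExplUnit} (hg : B.SecAt p g) (k : ℤ) :
    w.logDeriv (fun q => g q ^ k) = k * w.logDeriv g := by
  have hnat : ∀ k : ℕ, w.logDeriv (fun q => g q ^ (k : ℤ)) = k * w.logDeriv g := by
    intro k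
    induction k with
    | zero => simpa using w.logDeriv_const 1
    | succ k ih =>
      have h1 := w.logDeriv_mul (hg.zpow k) hg
      rw [ih] at h1
      have : (fun q => g q ^ ((k + 1 : ℕ) : ℤ)) = fun q => g q ^ (k : ℤ) * g q := by
        funext q
        push_cast
        rw [zpow_add_one]
      rw [this, h1]
      push_cast
      ring
  obtain ⟨k, rfl | rfl⟩ := k.eq_nat_or_neg
  · simpa using hnat k
  · have h1 := w.logDeriv_inv (hg.zpow k)
    simp only [zpow_neg]
    rw [h1, hnat]
    push_cast
    ring

theorem logDeriv_prod {ι : Type*} (s : Finset ι) {g : ι → X → ExplUnit}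
    (hg : ∀ i, B.SecAt p (g i)) :
    w.logDeriv (fun q => ∏ i ∈ s, g i q) = ∑ i ∈ s, w.logDeriv (g i) := by
  classical
  induction s using Finset.induction_on with
  | empty => simpa using w.logDeriv_const 1
  | insert i s hi ih =>
    simp only [Finset.prod_insert hi, Finset.sum_insert hi]
    rw [w.logDeriv_mul (hg i) (SecAt.prod s fun j _ => hg j), ih]

theorem logDeriv_monomial {m : ℕ} (c : ℝ × (Fin m → ℤ)) {z : X → Fin m → ExplUnit}
    (hz : ∀ i, B.SecAt p fun q => z q i) :
    w.logDeriv (fun q => monomial c (z q)) =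
      Model.logDot c fun i => w.logDeriv fun q => z q i := by
  unfold monomial
  rw [w.logDeriv_mul (secAt_const p _) (SecAt.prod _ fun i _ => (hz i).zpow _), w.logDeriv_const,
    zero_add, w.logDeriv_prod _ fun i => (hz i).zpow _]
  exact Finset.sum_congr rfl fun i _ => w.logDeriv_zpow (hz i) _

/-- The derivative of a smooth complex function. -/
def onComplex (s : X → ℂ) : ℂ := (w.onTropical fun q => ⟨s q, 0⟩).coeff

/-- `s` may vanish at `p`. A constant C avoiding 0 and -s(p) writes it as (s + C) + (-C), a sum of
two exploded functions. -/
theorem onTropical_ofComplex {s : X → ℂ} (hB : B.GoodAt p) (hs : B.SmoothFnAt p s) :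
    B.TropicalAt p (fun q => ⟨s q, 0⟩) ∧ w.onTropical (fun q => ⟨s q, 0⟩) = ⟨w.onComplex s, 0⟩ := by
  obtain ⟨C, hC⟩ := (Set.toFinite ({0, -s p} : Set ℂ)).infinite_compl.nonempty
  have hC0 : C ≠ 0 := fun h => hC (by simp [h])
  have hC1 : s p + C ≠ 0 := fun h => hC (by simp [eq_neg_of_add_eq_zero_right h])
  have h1 : B.SmoothFnAt p fun q => s q + C :=
    hs.comp (k := fun y => y + C) (ContDiff.smoothNear (by fun_prop) _)
  have h2 := hB.secAt _ h1 hC1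
  have h3 := secAt_const (A := B) p (ExplUnit.ofComplex (-C))
  have h4 : (fun q => (⟨s q, 0⟩ : Expl)) =ᶠ[𝓝 p] fun q =>
      (ExplUnit.ofComplex (s q + C)).toExpl + (ExplUnit.ofComplex (-C)).toExpl := by
    filter_upwards [(h1.continuousAt hB).eventually_ne hC1] with q hq
    rw [ExplUnit.toExpl_ofComplex hq, ExplUnit.toExpl_ofComplex (neg_ne_zero.2 hC0),
      Expl.mk_add_mk]
    simp
  have h5 : B.TropicalAt p (fun q => ⟨s q, 0⟩) := (h2.tropicalAt.add_secAt h3).congr h4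
  refine ⟨h5, ?_⟩
  ext1
  · rfl
  · rw [w.tropical_germ _ _ h5 h4, w.tropical_add _ _ h2.tropicalAt h3.tropicalAt, Expl.add_exp,
      w.onTropical_secAt_exp h2, w.onTropical_secAt_exp h3]
    simp

theorem onComplex_congr {s t : X → ℂ} (hB : B.GoodAt p) (hs : B.SmoothFnAt p s)
    (h : s =ᶠ[𝓝 p] t) : w.onComplex s = w.onComplex t := by
  unfold onComplex
  rw [w.tropical_germ _ (fun q => ⟨t q, 0⟩) (w.onTropical_ofComplex hB hs).1 ?_]
  filter_upwards [h] with q hq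
  rw [hq]

theorem onComplex_add {s t : X → ℂ} (hB : B.GoodAt p) (hs : B.SmoothFnAt p s)
    (ht : B.SmoothFnAt p t) : w.onComplex (fun q => s q + t q) = w.onComplex s + w.onComplex t := by
  have h1 := w.tropical_add _ _ (w.onTropical_ofComplex hB hs).1 (w.onTropical_ofComplex hB ht).1
  rw [(w.onTropical_ofComplex hB hs).2, (w.onTropical_ofComplex hB ht).2] at h1
  simp only [Expl.mk_add_mk] at h1
  exact congrArg Expl.coeff h1

theorem onComplex_mul {s t : X → ℂ} (hB : B.GoodAt p) (hs : B.SmoothFnAt p s)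
    (ht : B.SmoothFnAt p t) :
    w.onComplex (fun q => s q * t q) = w.onComplex s * t p + s p * w.onComplex t := by
  have h1 := w.tropical_mul _ _ (w.onTropical_ofComplex hB hs).1 (w.onTropical_ofComplex hB ht).1
  rw [(w.onTropical_ofComplex hB hs).2, (w.onTropical_ofComplex hB ht).2] at h1
  simp only [Expl.mk_mul_mk, add_zero, Expl.mk_add_mk] at h1
  exact congrArg Expl.coeff h1

theorem onComplex_const (c : ℂ) : w.onComplex (fun _ => c) = 0 := by
  have h1 := w.tropical_smul ⟨c, 0⟩ _ tropicalAt_one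
  rw [w.onTropical_one] at h1
  simp only [Expl.mk_mul_mk, add_zero, mul_one, mul_zero] at h1
  exact congrArg Expl.coeff h1

theorem onComplex_sum {ι : Type*} (S : Finset ι) {s : ι → X → ℂ} (hB : B.GoodAt p)
    (hs : ∀ i, B.SmoothFnAt p (s i)) :
    B.SmoothFnAt p (fun q => ∑ i ∈ S, s i q) ∧
      w.onComplex (fun q => ∑ i ∈ S, s i q) = ∑ i ∈ S, w.onComplex (s i) := by
  classical
  induction S using Finset.induction_on with
  | empty =>
    simp only [Finset.sum_empty]
    exact ⟨smoothFnAt_const _ _, w.onComplex_const 0⟩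
  | insert i S hi ih =>
    simp only [Finset.sum_insert hi]
    refine ⟨((hs i).prodMk ih.1).comp (k := fun y : ℂ × ℂ => y.1 + y.2)
      (ContDiff.smoothNear (by fun_prop) _), ?_⟩
    rw [w.onComplex_add hB (hs i) ih.1, ih.2]

theorem onComplex_real (hB : ∀ q, B.GoodAt q) {f : X → ℝ} (hf : B.SmoothFnAt p f) :
    w.onComplex (fun q => (f q : ℂ)) = (w.onSmooth f : ℂ) :=
  congrArg Expl.coeff (w.compat f (hf.smoothAt hB))

theorem onComplex_ofComplex {s : X → ℂ} (hB : B.GoodAt p) (hs : B.SmoothFnAt p s) (h0 : s p ≠ 0) :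
    w.logDeriv (fun q => ExplUnit.ofComplex (s q)) = w.onComplex s / s p := by
  have h1 : ∀ᶠ q in 𝓝 p, (⟨s q, 0⟩ : Expl) = (ExplUnit.ofComplex (s q)).toExpl := by
    filter_upwards [(hs.continuousAt hB).eventually_ne h0] with q hq
    rw [ExplUnit.toExpl_ofComplex hq]
  unfold logDeriv onComplex
  rw [w.tropical_germ _ _ (w.onTropical_ofComplex hB hs).1 h1, ExplUnit.coeff_ofComplex h0]

/-- Smooth parts are reached by semiring operations, since 1 + g equals 1 plus the smooth part of g
when the exponent is nonnegative. If the exponent of g at `p` is positive, then v(g) is absorbed by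
v(1) = 0 t^0 and the derivative is 0. -/
theorem onComplex_smoothPart {g : X → ExplUnit} (hB : B.GoodAt p) (hg : B.SecAt p g)
    (h0 : ∀ q, 0 ≤ (g q).trop) :
    w.onComplex (fun q => (g q).smoothPart) = w.logDeriv g * (g p).smoothPart := by
  have hs := hg.smoothFnAt (Eventually.of_forall h0)
  have h1 := w.onComplex_add hB (smoothFnAt_const p 1) hs
  rw [w.onComplex_const, zero_add] at h1
  rw [← h1]
  unfold onComplex
  simp only [← ExplUnit.one_add_toExpl (h0 _)]
  rw [w.tropical_add _ _ tropicalAt_one hg.tropicalAt, w.onTropical_one, w.onTropical_secAt hg]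
  rcases (h0 p).eq_or_lt with h | h
  · rw [Expl.add_of_eq (by exact h), ExplUnit.smoothPart_of_trop_eq_zero h.symm]
    simp
  · rw [Expl.add_of_lt (by exact h), ExplUnit.smoothPart_of_trop_ne_zero h.ne']
    simp

/-- The chain rule. -/
theorem onComplex_comp (hB : ∀ q, B.GoodAt q) {n : ℕ} {ι : Type} [Fintype ι]
    {x : X → Fin n → ℝ} {ζ : X → ι → ℂ} (hx : B.SmoothFnAt p x) (hζ : B.SmoothFnAt p ζ)
    {h : (Fin n → ℝ) × (ι → ℂ) → ℂ} (hh : SmoothNear h (x p, ζ p)) :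
    w.onComplex (fun q => h (x q, ζ q)) = fderiv ℝ h (x p, ζ p)
      (fun i => w.onSmooth fun q => x q i, fun i => w.onComplex fun q => ζ q i) := by
  classical
  -- Hadamard's lemma expresses `h` minus its value as a finite sum of coordinate increments times
  -- smooth functions. The increments vanish at `p`, so the Leibniz rule retains only their
  -- derivatives, multiplied by the coefficients at `p`.
  obtain ⟨A, hA, hA0, hAh⟩ := hh.exists_hadamard
  have hxi : ∀ i, B.SmoothFnAt p fun q => x q i - x p i := fun i =>
    hx.comp (k := fun y => y i - x p i) (ContDiff.smoothNear (by fun_prop) _)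
  have hre : ∀ i, B.SmoothFnAt p fun q => (ζ q i - ζ p i).re := fun i =>
    hζ.comp (k := fun y => (y i - ζ p i).re) (ContDiff.smoothNear
      (Complex.reCLM.contDiff.comp (f := fun y : ι → ℂ => y i - ζ p i) (by fun_prop)) _)
  have him : ∀ i, B.SmoothFnAt p fun q => (ζ q i - ζ p i).im := fun i =>
    hζ.comp (k := fun y => (y i - ζ p i).im) (ContDiff.smoothNear
      (Complex.imCLM.contDiff.comp (f := fun y : ι → ℂ => y i - ζ p i) (by fun_prop)) _)
  -- The family `A` is only ℝ-linear, so every complex coordinate is split into its real and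
  -- imaginary parts.
  let co : Fin n ⊕ ι ⊕ ι → X → ℝ := Sum.elim (fun i q => x q i - x p i)
    (Sum.elim (fun i q => (ζ q i - ζ p i).re) fun i q => (ζ q i - ζ p i).im)
  let vec : Fin n ⊕ ι ⊕ ι → (Fin n → ℝ) × (ι → ℂ) := Sum.elim (fun i => (Pi.single i 1, 0))
    (Sum.elim (fun i => (0, Pi.single i 1)) fun i => (0, Pi.single i Complex.I))
  have hdec : ∀ (a : Fin n → ℝ) (b b' : ι → ℝ),
      ∑ k, (Sum.elim a (Sum.elim b b') k : ℝ) • vec k = (a, fun i => (b i : ℂ) + b' i * Complex.I) := by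
    intro a b b'
    rw [Fintype.sum_sum_type, Fintype.sum_sum_type]
    ext i
    · simp [vec, Prod.fst_sum, Finset.sum_apply, Pi.single_apply]
    · simp [vec, Prod.snd_sum, Finset.sum_apply, Pi.single_apply]
  have hco : ∀ k, B.SmoothFnAt p (co k) := by
    rintro (i | i | i)
    · exact hxi i
    · exact hre i
    · exact him i
  have hcoC : ∀ k, B.SmoothFnAt p fun q => (co k q : ℂ) := fun k =>
    (hco k).comp (k := fun y : ℝ => (y : ℂ)) (ContDiff.smoothNear Complex.ofRealCLM.contDiff _)
  have hxζ := hx.prodMk hζ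
  have hAk : ∀ k, B.SmoothFnAt p fun q => A (x q, ζ q) (vec k) := fun k =>
    hxζ.comp (k := fun y => A y (vec k)) (ContDiff.smoothNear (by fun_prop) _)
  have hprod : ∀ k, B.SmoothFnAt p fun q => (co k q : ℂ) * A (x q, ζ q) (vec k) := fun k =>
    ((hcoC k).prodMk (hAk k)).comp (k := fun y : ℂ × ℂ => y.1 * y.2)
      (ContDiff.smoothNear (by fun_prop) _)
  have heq : (fun q => h (x q, ζ q)) =ᶠ[𝓝 p] fun q =>
      h (x p, ζ p) + ∑ k, (co k q : ℂ) * A (x q, ζ q) (vec k) := by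
    filter_upwards [(hxζ.continuousAt (hB p)).eventually hAh] with q hq
    rw [hq]
    congr 1
    have h1 : (x q, ζ q) - (x p, ζ p) = ∑ k, co k q • vec k := by
      have h2 := hdec (fun i => x q i - x p i) (fun i => (ζ q i - ζ p i).re)
        (fun i => (ζ q i - ζ p i).im)
      have h3 : ∀ k, (Sum.elim (fun i => x q i - x p i) (Sum.elim (fun i => (ζ q i - ζ p i).re)
        (fun i => (ζ q i - ζ p i).im)) k : ℝ) = co k q := by
        rintro (i | i | i) <;> rfl
      simp only [h3] at h2
      rw [h2]
      simp only [Complex.re_add_im]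
      rfl
    rw [h1, map_sum]
    refine Finset.sum_congr rfl fun k _ => ?_
    rw [map_smul, Complex.real_smul]
  have hfn : B.SmoothFnAt p fun q => h (x q, ζ q) := hxζ.comp hh
  have hsum := w.onComplex_sum Finset.univ (hB p) hprod
  rw [w.onComplex_congr (hB p) hfn heq, w.onComplex_add (hB p) (smoothFnAt_const _ _) hsum.1,
    w.onComplex_const, zero_add, hsum.2]
  have hco0 : ∀ k, co k p = 0 := by
    rintro (i | i | i) <;> simp [co]
  have hterm : ∀ k, w.onComplex (fun q => (co k q : ℂ) * A (x q, ζ q) (vec k)) =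
      A (x p, ζ p) (w.onSmooth (co k) • vec k) := by
    intro k
    rw [w.onComplex_mul (hB p) (hcoC k) (hAk k), hco0, w.onComplex_real hB (hco k), map_smul,
      Complex.real_smul]
    simp
  rw [Finset.sum_congr rfl fun k _ => hterm k, ← map_sum, hA0]
  congr 1
  have hsub : ∀ (f : X → ℝ) (c : ℝ), B.SmoothFnAt p f →
      w.onSmooth (fun q => f q - c) = w.onSmooth f := by
    intro f c hf
    have h1 : B.SmoothFnAt p fun q => f q - c :=
      hf.comp (k := fun y => y - c) (ContDiff.smoothNear (by fun_prop) _)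
    have h2 := w.onComplex_add (hB p) (s := fun q => ((f q - c : ℝ) : ℂ)) (t := fun _ => (c : ℂ))
      (h1.comp (k := fun y : ℝ => (y : ℂ)) (ContDiff.smoothNear Complex.ofRealCLM.contDiff _))
      (smoothFnAt_const _ _)
    have h3 : (fun q => ((f q - c : ℝ) : ℂ) + (c : ℂ)) = fun q => (f q : ℂ) := by
      funext q
      push_cast
      ring
    rw [h3, w.onComplex_real hB hf, w.onComplex_real hB h1, w.onComplex_const, add_zero] at h2
    exact_mod_cast h2.symm
  have hlast := hdec (fun i => w.onSmooth fun q => x q i)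
    (fun i => w.onSmooth fun q => (ζ q i - ζ p i).re)
    (fun i => w.onSmooth fun q => (ζ q i - ζ p i).im)
  have hk : ∀ k, (Sum.elim (fun i => w.onSmooth fun q => x q i)
      (Sum.elim (fun i => w.onSmooth fun q => (ζ q i - ζ p i).re)
      (fun i => w.onSmooth fun q => (ζ q i - ζ p i).im)) k : ℝ) = w.onSmooth (co k) := by
    rintro (i | i | i)
    · exact (hsub _ (x p i) (hx.comp (k := fun y => y i)
        (ContDiff.smoothNear (by fun_prop) _))).symm
    · rfl
    · rfl
  simp only [hk] at hlast
  rw [hlast]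
  congr 1
  funext i
  have hζi : B.SmoothFnAt p fun q => ζ q i - ζ p i :=
    hζ.comp (k := fun y => y i - ζ p i) (ContDiff.smoothNear (by fun_prop) _)
  have h1 := w.onComplex_add (hB p) hζi (smoothFnAt_const p (ζ p i))
  simp only [sub_add_cancel] at h1
  rw [h1, w.onComplex_const, add_zero]
  have hreC := (hre i).comp (k := fun y : ℝ => (y : ℂ))
    (ContDiff.smoothNear Complex.ofRealCLM.contDiff _)
  have himC := (him i).comp (k := fun y : ℝ => (y : ℂ) * Complex.I)
    (ContDiff.smoothNear (Complex.ofRealCLM.contDiff.mul contDiff_const) _)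
  have h2 := w.onComplex_add (hB p) hreC himC
  simp only [Complex.re_add_im] at h2
  rw [h2, w.onComplex_real hB (hre i)]
  congr 1
  have h3 := w.onComplex_mul (hB p) ((him i).comp (k := fun y : ℝ => (y : ℂ))
    (ContDiff.smoothNear Complex.ofRealCLM.contDiff _)) (smoothFnAt_const p Complex.I)
  rw [w.onComplex_const, mul_zero, add_zero, w.onComplex_real hB (him i)] at h3
  exact h3.symm

open Model in
/-- In a chart, every tangent vector is the tangent vector of a curve. -/
theorem exists_eq_curve (hB : ∀ q, B.GoodAt q) {n m : ℕ} {P : Set (Fin m → ℝ)}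
    {κ : Model n m P → X} {q₀ : Model n m P} (hκ : LocalIsoAt (space n m P) B κ q₀)
    (w : B.TangentVector (κ q₀)) : ∃ (ξ : Fin n → ℝ) (lam : Fin m → ℂ),
      (∀ f, B.TropicalAt (κ q₀) f →
        w.onTropical f = derivAlong (fun s => κ (q₀.curve ξ lam s)) f) ∧
      ∀ f, B.SmoothAt (κ q₀) f → w.onSmooth f = deriv (fun s => f (κ (q₀.curve ξ lam s))) 0 := by
  obtain ⟨hM, η, hη, hη0, hκη, hηκ⟩ := hκ
  have hx : B.SmoothFnAt (κ q₀) fun q => (η q).x :=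
    hη.smoothFnAt (by rw [hη0]; exact smoothFnAt_x q₀)
  have hz : ∀ i, B.SecAt (κ q₀) fun q => (η q).z i := fun i =>
    hη.2 _ (by rw [hη0]; exact secAt_z q₀ i)
  -- The direction of the curve is read off from `w`: its values on the real coordinates and its
  -- logarithmic derivatives of the exploded ones. Since tangent vectors are determined on exploded
  -- functions, the chain rule and `onComplex_smoothPart` complete the comparison.
  set ξ : Fin n → ℝ := fun i => w.onSmooth fun q => (η q).x i with hξ
  set lam : Fin m → ℂ := fun i => w.logDeriv fun q => (η q).z i with hlam
  have hcurve : B.CurveAt (κ q₀) fun s => κ (q₀.curve ξ lam s) := (curveAt q₀ ξ lam).map hM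
  have key := TangentVector.ext_of_secAt (v := w) (w := hcurve.tangentVector) (by
    intro g hg
    obtain ⟨s, c, ⟨ι, _, ζ, h, hh, hs⟩, h0, hgf⟩ := secAt_iff.1 (hM.2 g hg)
    have hder := hasDerivAt_coeff_curve q₀ ξ lam (hasDerivAt_smoothForm_curve q₀ ξ lam ζ hh hs)
      h0 hgf
    change _ = derivAlong _ _
    unfold derivAlong
    simp only [ExplUnit.toExpl]
    rw [hder.deriv, curve_zero]
    change w.onTropical (fun q => (g q).toExpl) = _
    rw [w.onTropical_secAt hg]
    congr 1
    have hζ : ∀ c : NonnegMonomial P, B.SmoothFnAt (κ q₀) fun q => zeta c (η q) := fun c =>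
      hη.smoothFnAt (by rw [hη0]; exact smoothFnAt_zeta q₀ c)
    have hζp : B.SmoothFnAt (κ q₀) fun q i => zeta (ζ i) (η q) := smoothFnAt_pi fun i => hζ (ζ i)
    have hh' : SmoothNear h ((η (κ q₀)).x, fun i => zeta (ζ i) (η (κ q₀))) := by rwa [hη0]
    have hsη : B.SmoothFnAt (κ q₀) fun q => h ((η q).x, fun i => zeta (ζ i) (η q)) :=
      (hx.prodMk hζp).comp hh'
    have hs0 : s q₀ = h (q₀.x, fun i => zeta (ζ i) q₀) := hs.self_of_nhds
    have hg1 : g =ᶠ[𝓝 (κ q₀)] fun q =>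
        ExplUnit.ofComplex (h ((η q).x, fun i => zeta (ζ i) (η q))) * monomial c (η q).z := by
      have h1 : ∀ᶠ q in 𝓝 (η (κ q₀)), g (κ q) = ExplUnit.ofComplex
          (h (q.x, fun i => zeta (ζ i) q)) * monomial c q.z := by
        rw [hη0]
        filter_upwards [hgf, hs] with q a b
        rw [a, b]
      filter_upwards [hη.1.eventually h1, hκη] with q a b
      rw [b] at a
      exact a
    have hL : w.logDeriv g = w.logDeriv fun q =>
        ExplUnit.ofComplex (h ((η q).x, fun i => zeta (ζ i) (η q))) * monomial c (η q).z := by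
      unfold logDeriv
      rw [w.tropical_germ _ (fun q => (ExplUnit.ofComplex (h ((η q).x, fun i => zeta (ζ i) (η q)))
        * monomial c (η q).z).toExpl) hg.tropicalAt
        (by filter_upwards [hg1] with q hq; rw [hq]), hg1.self_of_nhds]
    have hh0 : h ((η (κ q₀)).x, fun i => zeta (ζ i) (η (κ q₀))) ≠ 0 := by rwa [hη0, ← hs0]
    rw [hL, w.logDeriv_mul ((hB _).secAt _ hsη hh0) (ExplodedSpace.secAt_monomial c hz),
      w.onComplex_ofComplex (hB _) hsη hh0, w.logDeriv_monomial c hz,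
      w.onComplex_comp hB hx hζp hh']
    have hζv : ∀ i, w.onComplex (fun q => zeta (ζ i) (η q)) =
        logDot (ζ i).1 lam * zeta (ζ i) q₀ := by
      intro i
      have h1 := w.onComplex_smoothPart (hB _) (ExplodedSpace.secAt_monomial (ζ i).1 hz)
        (fun q => trop_monomial_nonneg (ζ i) (η q))
      rw [w.logDeriv_monomial _ hz, hη0] at h1
      exact h1
    have hgq : g (κ q₀) = ExplUnit.ofComplex (s q₀) * monomial c q₀.z := hgf.self_of_nhds
    simp only [hζv, hη0]
    rw [hgq, Prod.fst_mul, Units.val_mul, ExplUnit.coeff_ofComplex h0, ← hs0]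
    field_simp
    rfl)
  exact ⟨ξ, lam, key.1, key.2⟩

end TangentVector

end ExplodedSpace

/-! ### Local decompositions of tropical functions -/

-- The exponent of a tropical sum is the minimum of the exponents, and its coefficient collects
-- exactly the summands attaining it. The induction peels off the last summand, since the fold adds
-- from the left.
open Classical in
theorem foldl_toExpl (a : ExplUnit) (l : List ExplUnit) (R : Expl)
    (hR : l.foldl (fun s b => s + b.toExpl) a.toExpl = R) :
    (∀ b ∈ a :: l, R.exp ≤ b.trop) ∧ (∃ b ∈ a :: l, R.exp = b.trop) ∧
    R.coeff = ((a :: l).map fun b => if b.trop = R.exp then (b.1 : ℂ) else 0).sum := by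
  induction l using List.reverseRecOn generalizing R with
  | nil => subst hR; simp [ExplUnit.toExpl]
  | append_singleton l b ih =>
    rw [List.foldl_append] at hR
    simp only [List.foldl_cons, List.foldl_nil] at hR
    obtain ⟨F, hF⟩ : ∃ F, l.foldl (fun s b => s + b.toExpl) a.toExpl = F := ⟨_, rfl⟩
    rw [hF] at hR
    obtain ⟨h1, ⟨b₀, hb₀, h2⟩, h3⟩ := ih F hF
    have hsplit : ∀ ψ : ExplUnit → ℂ, ((a :: (l ++ [b])).map ψ).sum = ((a :: l).map ψ).sum + ψ b := by
      intro ψ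
      rw [← List.cons_append, List.map_append, List.sum_append]
      simp
    have hmem : ∀ c, c ∈ a :: (l ++ [b]) ↔ c ∈ a :: l ∨ c = b := by
      intro c
      rw [← List.cons_append, List.mem_append, List.mem_singleton]
    rw [hsplit]
    rcases lt_trichotomy F.exp b.trop with h | h | h
    · rw [Expl.add_of_lt (by exact h)] at hR
      subst hR
      refine ⟨fun c hc => ?_, ⟨b₀, (hmem _).2 (.inl hb₀), h2⟩, ?_⟩
      · rcases (hmem c).1 hc with hc | rfl
        · exact h1 c hc
        · exact h.le
      · rw [if_neg h.ne', add_zero]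
        exact h3
    · rw [Expl.add_of_eq (by exact h)] at hR
      subst hR
      refine ⟨fun c hc => ?_, ⟨b₀, (hmem _).2 (.inl hb₀), h2⟩, ?_⟩
      · rcases (hmem c).1 hc with hc | rfl
        · exact h1 c hc
        · exact h.le
      · dsimp only
        rw [if_pos h.symm, ← h3]
        rfl
    · rw [Expl.add_of_gt (by exact h)] at hR
      subst hR
      refine ⟨fun c hc => ?_, ⟨b, (hmem _).2 (.inr rfl), rfl⟩, ?_⟩
      · rcases (hmem c).1 hc with hc | rfl
        · exact h.le.trans (h1 c hc)
        · exact le_rfl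
      · have : ((a :: l).map fun c => if c.trop = b.toExpl.exp then (c.1 : ℂ) else 0).sum = 0 := by
          refine List.sum_eq_zero fun x hx => ?_
          obtain ⟨c, hc, rfl⟩ := List.mem_map.1 hx
          exact if_neg (h.trans_le (h1 c hc)).ne'
        rw [this, zero_add]
        exact (if_pos rfl).symm

namespace ExplodedSpace

variable {X : Type u} [TopologicalSpace X] {B : ExplodedSpace X} {f : X → Expl}

/-- On `U`, the tropical function `f` is the sum of the exploded functions `g j`. -/
structure Decomposes (B : ExplodedSpace X) (f : X → Expl) (U : Opens X) {N : ℕ}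
    (g : Fin N → X → ExplUnit) : Prop where
  mem : ∀ j, g j ∈ B.sec U
  exp_le : ∀ q ∈ U, ∀ j, (f q).exp ≤ (g j q).trop
  exists_exp_eq : ∀ q ∈ U, ∃ j, (f q).exp = (g j q).trop
  coeff_eq : ∀ q ∈ U, ∀ i, (f q).exp = (g i q).trop →
    (f q).coeff = (g i q).1 * ∑ j, (g j q / g i q).smoothPart

theorem IsTropicalOn.exists_decomposes (hf : B.IsTropicalOn ⊤ f) (p : X) :
    ∃ (U : Opens X) (N : ℕ) (g : Fin N → X → ExplUnit), p ∈ U ∧ B.Decomposes f U g := by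
  classical
  obtain ⟨U, hp, -, g₀, l, h1, h2, h3⟩ := hf p trivial
  have h4 : ∀ q, l.foldl (fun s g => s + (g q).toExpl) (g₀ q).toExpl =
      (l.map fun g => g q).foldl (fun s b => s + b.toExpl) (g₀ q).toExpl := by
    intro q
    rw [List.foldl_map]
  have h5 : ∀ q, g₀ q :: l.map (fun g => g q) = (g₀ :: l).map fun g => g q := fun q => rfl
  refine ⟨U, (g₀ :: l).length, fun j => (g₀ :: l)[j], hp, ?_, ?_, ?_, ?_⟩
  · intro j
    rcases List.mem_cons.1 (List.getElem_mem (l := g₀ :: l) j.2) with h | h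
    · exact h.symm ▸ h1
    · exact h2 _ h
  · intro q hq j
    refine (foldl_toExpl (g₀ q) _ _ ((h4 q).symm.trans (h3 q hq).symm)).1 _ ?_
    rw [h5]
    exact List.mem_map.2 ⟨_, List.getElem_mem j.2, rfl⟩
  · intro q hq
    obtain ⟨b, hb, hb'⟩ := (foldl_toExpl (g₀ q) _ _ ((h4 q).symm.trans (h3 q hq).symm)).2.1
    rw [h5] at hb
    obtain ⟨g, hg, rfl⟩ := List.mem_map.1 hb
    obtain ⟨j, hj, rfl⟩ := List.mem_iff_getElem.1 hg
    exact ⟨⟨j, hj⟩, hb'⟩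
  · intro q hq i hi
    have h6 := (foldl_toExpl (g₀ q) _ _ ((h4 q).symm.trans (h3 q hq).symm)).2.2
    rw [h5, List.map_map] at h6
    rw [h6, Finset.mul_sum, ← Fin.sum_univ_fun_getElem]
    refine Finset.sum_congr rfl fun j _ => ?_
    have hd : ((g₀ :: l)[j] q / (g₀ :: l)[i] q).trop = ((g₀ :: l)[j] q).trop - (f q).exp := by
      rw [ExplUnit.trop_div, hi]
    by_cases h : ((g₀ :: l)[j] q).trop = (f q).exp
    · refine (if_pos h).trans ?_
      rw [ExplUnit.smoothPart_of_trop_eq_zero (hd.trans (sub_eq_zero.2 h)), Prod.fst_div,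
        Units.val_div_eq_div_val]
      exact (mul_div_cancel₀ _ (Units.ne_zero _)).symm
    · refine (if_neg h).trans ?_
      rw [ExplUnit.smoothPart_of_trop_ne_zero (hd.trans_ne (sub_ne_zero.2 h)), mul_zero]

/-! ### The refinement defined by a tropical function -/

/-- The basic open sets of the refinement: open sets of `X`, the loci where `f` has the same
exponent as an exploded function whose exponents are at least those of `f`, and preimages of open
sets under smooth parts. -/
inductive RefinedOpen (B : ExplodedSpace X) (f : X → Expl) : Set X → Prop
  | of_open (U : Opens X) : RefinedOpen B f U
  | inter (V W : Set X) : RefinedOpen B f V → RefinedOpen B f W → RefinedOpen B f (V ∩ W)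
  | face (U : Opens X) (g : X → ExplUnit) (hg : g ∈ B.sec U)
      (hle : ∀ q ∈ U, (f q).exp ≤ (g q).trop) :
      RefinedOpen B f {q | q ∈ U ∧ (f q).exp = (g q).trop}
  | smooth (V : Set X) (hV : RefinedOpen B f V) (U : Opens X) (hVU : V ⊆ U) (k : X → ExplUnit)
      (hk : k ∈ B.sec U) (h0 : ∀ q ∈ V, 0 ≤ (k q).trop) (O : Set ℂ) (hO : IsOpen O) :
      RefinedOpen B f {q | q ∈ V ∧ (k q).smoothPart ∈ O}

/-- The underlying set of the refinement of `B` defined by `f`. -/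
def Refined (_ : ExplodedSpace X) (_ : X → Expl) : Type u := X

instance : TopologicalSpace (Refined B f) :=
  generateFrom {V : Set (Refined B f) | RefinedOpen B f V}

theorem isTopologicalBasis_refinedOpen :
    IsTopologicalBasis {V : Set (Refined B f) | RefinedOpen B f V} where
  exists_subset_inter V hV W hW _ hq := ⟨V ∩ W, RefinedOpen.inter (B := B) (f := f) V W hV hW, hq, subset_rfl⟩
  sUnion_eq := Set.eq_univ_of_forall fun _ =>
    Set.mem_sUnion.2 ⟨Set.univ, RefinedOpen.of_open ⊤, trivial⟩
  eq_generateFrom := rfl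

theorem mem_nhds_refined {p : Refined B f} {S : Set (Refined B f)} :
    S ∈ 𝓝 p ↔ ∃ V, RefinedOpen B f V ∧ p ∈ V ∧ V ⊆ S :=
  isTopologicalBasis_refinedOpen.mem_nhds_iff

theorem RefinedOpen.mem_nhds {V : Set X} (hV : RefinedOpen B f V) {p : Refined B f} (hp : p ∈ V) :
    (V : Set (Refined B f)) ∈ 𝓝 p :=
  mem_nhds_refined.2 ⟨V, hV, hp, subset_rfl⟩

/-- The refinement map. -/
def refinedMap (B : ExplodedSpace X) (f : X → Expl) : Refined B f → X := id

theorem continuous_refinedMap : Continuous (refinedMap B f) :=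
  continuous_def.2 fun U hU => isTopologicalBasis_refinedOpen.isOpen
    (RefinedOpen.of_open (⟨U, hU⟩ : Opens X))

/-- The generators `RefinedOpen.smooth` are designed for this. Nonnegativity is needed only on a
neighbourhood in the finer topology, which is why quotients by a minimal summand qualify. -/
theorem continuousAt_smoothPart_refined {p : Refined B f} {k : X → ExplUnit}
    (hk : B.SecAt p k) (h0 : ∀ᶠ q : Refined B f in 𝓝 p, 0 ≤ (k q).trop) :
    ContinuousAt (fun q : Refined B f => (k q).smoothPart) p := by
  obtain ⟨U, hp, hU⟩ := hk
  obtain ⟨V, hV, hpV, hVS⟩ := mem_nhds_refined.1 h0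
  rw [continuousAt_def]
  intro S hS
  obtain ⟨O, hOS, hO, hpO⟩ := mem_nhds_iff.1 hS
  have h1 : RefinedOpen B f (V ∩ U) := .inter _ _ hV (.of_open U)
  have h2 := RefinedOpen.smooth _ h1 U Set.inter_subset_right k hU (fun q hq => hVS hq.1) O hO
  exact mem_of_superset (h2.mem_nhds ⟨⟨hpV, hp⟩, hpO⟩) fun q hq => hOS hq.2

/-- The form of the exploded functions on the refinement. -/
def RefinedForm (B : ExplodedSpace X) (f : X → Expl) (V : Set (Refined B f))
    (φ : Refined B f → ExplUnit) : Prop :=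
  ∃ (U : Opens X) (ι : Type) (_ : Fintype ι) (h : ι → X → ExplUnit) (H : (ι → ℂ) → ℂ)
    (k : X → ExplUnit), (∀ q ∈ V, refinedMap B f q ∈ U) ∧ (∀ i, h i ∈ B.sec U) ∧ k ∈ B.sec U ∧
    ∀ q ∈ V, (∀ i, 0 ≤ (h i q).trop) ∧ SmoothNear H (fun i => (h i q).smoothPart) ∧
      H (fun i => (h i q).smoothPart) ≠ 0 ∧
      φ q = ExplUnit.ofComplex (H fun i => (h i q).smoothPart) * k q

theorem ofComplex_mul {a b : ℂ} (ha : a ≠ 0) (hb : b ≠ 0) :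
    ExplUnit.ofComplex (a * b) = ExplUnit.ofComplex a * ExplUnit.ofComplex b := by
  apply ExplUnit.ext_coeff_trop
  · rw [ExplUnit.coeff_ofComplex (mul_ne_zero ha hb), Prod.fst_mul, Units.val_mul,
      ExplUnit.coeff_ofComplex ha, ExplUnit.coeff_ofComplex hb]
  · simp

theorem ofComplex_inv {a : ℂ} (ha : a ≠ 0) :
    ExplUnit.ofComplex a⁻¹ = (ExplUnit.ofComplex a)⁻¹ := by
  apply ExplUnit.ext_coeff_trop
  · rw [ExplUnit.coeff_ofComplex (inv_ne_zero ha), Prod.fst_inv, Units.val_inv_eq_inv_val,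
      ExplUnit.coeff_ofComplex ha]
  · simp

/-- The refinement of `B` defined by the tropical function `f`. -/
def refine (B : ExplodedSpace X) (f : X → Expl) : ExplodedSpace (Refined B f) :=
  ofForm (RefinedForm B f)
    (fun _ _ _ hWV ⟨U, ι, i, h, H, k, h1, h2, h3, h4⟩ =>
      ⟨U, ι, i, h, H, k, fun q hq => h1 q (hWV hq), h2, h3, fun q hq => h4 q (hWV hq)⟩)
    (fun _ _ _ hfg ⟨U, ι, i, h, H, k, h1, h2, h3, h4⟩ =>
      ⟨U, ι, i, h, H, k, h1, h2, h3, fun q hq => ⟨(h4 q hq).1, (h4 q hq).2.1, (h4 q hq).2.2.1,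
        (hfg q hq).symm.trans (h4 q hq).2.2.2⟩⟩)
    (fun _ a => ⟨⊤, Empty, inferInstance, Empty.elim, fun _ => 1, fun _ => a, fun _ _ => trivial,
      fun i => i.elim, B.const _ _, fun q _ => ⟨fun i => i.elim, smoothNear_const _ _,
      one_ne_zero, by
        rw [ExplUnit.ofComplex_of_ne_zero one_ne_zero]
        ext <;> simp⟩⟩)
    (fun V φ ψ ⟨U, ι, i, h, H, k, h1, h2, h3, h4⟩ ⟨U', ι', i', h', H', k', h1', h2', h3', h4'⟩ =>
      ⟨U ⊓ U', ι ⊕ ι', inferInstance, Sum.elim h h',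
        fun y => H (fun i => y (.inl i)) * H' (fun i => y (.inr i)), k * k',
        fun q hq => ⟨h1 q hq, h1' q hq⟩, by
          rintro (i | i)
          · exact B.restrict _ _ inf_le_left _ (h2 i)
          · exact B.restrict _ _ inf_le_right _ (h2' i),
        (B.sec _).mul_mem (B.restrict _ _ inf_le_left _ h3) (B.restrict _ _ inf_le_right _ h3'),
        fun q hq => ⟨by
          rintro (i | i)
          · exact (h4 q hq).1 i
          · exact (h4' q hq).1 i, by
          refine SmoothNear.mul ?_ ?_
          · exact SmoothNear.comp (k := fun (y : ι ⊕ ι' → ℂ) i => y (.inl i)) (h4 q hq).2.1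
              (ContDiff.smoothNear (by fun_prop) _)
          · exact SmoothNear.comp (k := fun (y : ι ⊕ ι' → ℂ) i => y (.inr i)) (h4' q hq).2.1
              (ContDiff.smoothNear (by fun_prop) _),
          mul_ne_zero (h4 q hq).2.2.1 (h4' q hq).2.2.1, by
          simp only [Sum.elim_inl, Sum.elim_inr]
          rw [ofComplex_mul (h4 q hq).2.2.1 (h4' q hq).2.2.1, Pi.mul_apply, (h4 q hq).2.2.2,
            (h4' q hq).2.2.2, mul_mul_mul_comm]
          rfl⟩⟩)
    (fun V φ ⟨U, ι, i, h, H, k, h1, h2, h3, h4⟩ =>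
      ⟨U, ι, i, h, fun y => (H y)⁻¹, k⁻¹, h1, h2, (B.sec _).inv_mem h3, fun q hq =>
        ⟨(h4 q hq).1, (h4 q hq).2.1.inv (h4 q hq).2.2.1, inv_ne_zero (h4 q hq).2.2.1, by
          rw [ofComplex_inv (h4 q hq).2.2.1, Pi.inv_apply, (h4 q hq).2.2.2, mul_inv]
          rfl⟩⟩)

/-- Near `p`, `s` is a smooth function of smooth parts of exploded functions on `X`. -/
def RefinedSmoothAt {E : Type*} [NormedAddCommGroup E] [NormedSpace ℝ E] (p : Refined B f)
    (s : Refined B f → E) : Prop :=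
  ∃ (ι : Type) (_ : Fintype ι) (h : ι → X → ExplUnit) (H : (ι → ℂ) → E),
    (∀ i, B.SecAt p (h i) ∧ ∀ᶠ q : Refined B f in 𝓝 p, 0 ≤ (h i q).trop) ∧
    SmoothNear H (fun i => (h i p).smoothPart) ∧
    ∀ᶠ q : Refined B f in 𝓝 p, s q = H fun i => (h i q).smoothPart

/-! ### Smooth and exploded germs on the refinement. -/

section RefinedSmooth

variable {E : Type*} [NormedAddCommGroup E] [NormedSpace ℝ E]
  {F : Type*} [NormedAddCommGroup F] [NormedSpace ℝ F] {p : Refined B f}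

theorem RefinedSmoothAt.comp {s : Refined B f → E} (hs : RefinedSmoothAt p s) {k : E → F}
    (hk : SmoothNear k (s p)) : RefinedSmoothAt p fun q => k (s q) := by
  obtain ⟨ι, _, h, H, h1, h2, h3⟩ := hs
  refine ⟨ι, _, h, fun y => k (H y), h1, SmoothNear.comp ?_ h2, ?_⟩
  · have h4 : s p = H fun i => (h i p).smoothPart := h3.self_of_nhds
    rwa [← h4]
  · filter_upwards [h3] with q hq
    rw [hq]

theorem refinedSmoothAt_pi {ι : Type} [Fintype ι] {s : Refined B f → ι → E}
    (hs : ∀ i, RefinedSmoothAt p fun q => s q i) : RefinedSmoothAt p s := by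
  choose κ hκ g k h1 h2 h3 using hs
  refine ⟨Σ i, κ i, inferInstance, fun x => g x.1 x.2, fun y i => k i fun j => y ⟨i, j⟩,
    fun x => h1 x.1 x.2, smoothNear_pi fun i => ?_, ?_⟩
  · refine SmoothNear.comp (k := fun (y : (Σ i, κ i) → ℂ) j => y ⟨i, j⟩) (h2 i) ?_
    exact ContDiff.smoothNear (by fun_prop) _
  · filter_upwards [eventually_all.2 h3] with q hq
    funext i
    exact hq i

theorem refinedSmoothAt_smoothPart {k : X → ExplUnit} (hk : B.SecAt p k)
    (h0 : ∀ᶠ q : Refined B f in 𝓝 p, 0 ≤ (k q).trop) :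
    RefinedSmoothAt p fun q : Refined B f => (k q).smoothPart :=
  ⟨Unit, inferInstance, fun _ => k, fun y => y (), fun _ => ⟨hk, h0⟩,
    ContDiff.smoothNear (by fun_prop) _, Eventually.of_forall fun _ => rfl⟩

theorem RefinedSmoothAt.continuousAt {s : Refined B f → E} (hs : RefinedSmoothAt p s) :
    ContinuousAt s p := by
  obtain ⟨ι, _, h, H, h1, h2, h3⟩ := hs
  have : ContinuousAt (fun q : Refined B f => H fun i => (h i q).smoothPart) p :=
    ContinuousAt.comp (f := fun (q : Refined B f) i => (h i q).smoothPart) h2.continuousAt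
      (continuousAt_pi.2 fun i => continuousAt_smoothPart_refined (h1 i).1 (h1 i).2)
  exact this.congr (EventuallyEq.symm h3)

/-- All requirements of `RefinedForm` are open conditions for the refined topology, so they can be
imposed on germs. -/
theorem secAt_refine_iff {φ : Refined B f → ExplUnit} : (B.refine f).SecAt p φ ↔
    ∃ (s : Refined B f → ℂ) (k : X → ExplUnit), RefinedSmoothAt p s ∧ s p ≠ 0 ∧ B.SecAt p k ∧
      ∀ᶠ q : Refined B f in 𝓝 p, φ q = ExplUnit.ofComplex (s q) * k q := by
  constructor
  · rintro ⟨V, hp, hV⟩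
    obtain ⟨W, hpW, -, U, ι, _, h, H, k, h1, h2, h3, h4⟩ := hV p hp
    refine ⟨fun q => H fun i => (h i q).smoothPart, k, ⟨ι, _, h, H, fun i =>
      ⟨secAt_of_mem (h2 i) (h1 p hpW), ?_⟩, (h4 p hpW).2.1, Eventually.of_forall fun _ => rfl⟩,
      (h4 p hpW).2.2.1, secAt_of_mem h3 (h1 p hpW), ?_⟩
    · filter_upwards [W.isOpen.mem_nhds hpW] with q hq using (h4 q hq).1 i
    · filter_upwards [W.isOpen.mem_nhds hpW] with q hq using (h4 q hq).2.2.2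
  · rintro ⟨s, k, ⟨ι, _, h, H, h1, h2, h3⟩, h0, hk, hφ⟩
    have hc : ContinuousAt (fun (q : Refined B f) i => (h i q).smoothPart) p :=
      continuousAt_pi.2 fun i => continuousAt_smoothPart_refined (h1 i).1 (h1 i).2
    have hs0 : s p = H fun i => (h i p).smoothPart := h3.self_of_nhds
    have hH0 : ∀ᶠ q : Refined B f in 𝓝 p, H (fun i => (h i q).smoothPart) ≠ 0 :=
      (ContinuousAt.comp (f := fun (q : Refined B f) i => (h i q).smoothPart) h2.continuousAt
        hc).eventually_ne (by rwa [Function.comp_apply, ← hs0])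
    have hU : ∀ᶠ q : X in 𝓝 (refinedMap B f p), (∀ i, B.SecAt q (h i)) ∧ B.SecAt q k :=
      (eventually_all.2 fun i => (h1 i).1.eventually).and hk.eventually
    obtain ⟨T, hT, hTo, hpT⟩ := eventually_nhds_iff.1 hU
    obtain ⟨S, hS, hSo, hpS⟩ := eventually_nhds_iff.1 ((((eventually_all.2 fun i => (h1 i).2).and
      (hc.eventually h2.eventually)).and hH0).and ((h3.and hφ).and
      (continuous_refinedMap.continuousAt.eventually (hTo.mem_nhds hpT))))
    let V : Opens (Refined B f) := ⟨S, hSo⟩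
    let U : Opens X := ⟨T, hTo⟩
    refine ⟨V, hpS, fun q hq => ⟨V, hq, le_rfl, U, ι, _, h, H, k, fun r hr => (hS r hr).2.2, ?_, ?_,
      fun r hr => ⟨(hS r hr).1.1.1, (hS r hr).1.1.2, (hS r hr).1.2, ?_⟩⟩⟩
    · exact fun i => mem_sec_iff.2 fun r hr => (hT r hr).1 i
    · exact mem_sec_iff.2 fun r hr => (hT r hr).2
    · rw [(hS r hr).2.1.2, (hS r hr).2.1.1]

theorem secAt_refine_of_secAt {k : X → ExplUnit} (hk : B.SecAt p k) :
    (B.refine f).SecAt p (k : Refined B f → ExplUnit) := by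
  refine secAt_refine_iff.2 ⟨fun _ => 1, k, ⟨Empty, inferInstance, Empty.elim, fun _ => 1,
    fun i => i.elim, smoothNear_const _ _, Eventually.of_forall fun _ => rfl⟩, one_ne_zero, hk,
    Eventually.of_forall fun q => ?_⟩
  rw [ExplUnit.ofComplex_of_ne_zero one_ne_zero]
  ext <;> simp

theorem morphAt_refinedMap (p : Refined B f) : MorphAt (B.refine f) B (refinedMap B f) p :=
  ⟨continuous_refinedMap.continuousAt, fun _ hg => secAt_refine_of_secAt hg⟩

/-- Iterating the construction adds nothing: an exploded function of the refinement is a smooth unit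
s times some k on `B`, with the same exponents as k, and its smooth part is s times that of k. -/
theorem refinedSmoothAt_of_smoothFnAt {s : Refined B f → E} (hs : (B.refine f).SmoothFnAt p s) :
    RefinedSmoothAt p s := by
  obtain ⟨ι, _, g, H, h1, h2, h3⟩ := hs
  have h4 : ∀ i, RefinedSmoothAt p fun q => (g i q).smoothPart := by
    intro i
    obtain ⟨s, k, hs, hs0, hk, hφ⟩ := secAt_refine_iff.1 (h1 i).1
    have hk0 : ∀ᶠ q : Refined B f in 𝓝 p, 0 ≤ (k q).trop := by
      filter_upwards [(h1 i).2, hφ] with q a b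
      rw [b, ExplUnit.trop_mul, ExplUnit.trop_ofComplex, zero_add] at a
      exact a
    have h5 : RefinedSmoothAt p fun q : Refined B f => ![s q, (k q).smoothPart] :=
      refinedSmoothAt_pi fun j => by
        fin_cases j
        · exact hs
        · exact refinedSmoothAt_smoothPart hk hk0
    have h6 := h5.comp (k := fun y : Fin 2 → ℂ => y 0 * y 1) (ContDiff.smoothNear (by fun_prop) _)
    obtain ⟨ι', _, h, H', a, b, c⟩ := h6
    refine ⟨ι', _, h, H', a, b, ?_⟩
    filter_upwards [c, hφ, hs.continuousAt.eventually_ne hs0] with q hq hq' hq0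
    rw [← hq, hq', ExplUnit.smoothPart_mul_of_trop_eq_zero (ExplUnit.trop_ofComplex _),
      ExplUnit.coeff_ofComplex hq0]
    rfl
  obtain ⟨ι', _, h, H', a, b, c⟩ := (refinedSmoothAt_pi h4).comp h2
  refine ⟨ι', _, h, H', a, b, ?_⟩
  filter_upwards [c, h3] with q hq hq'
  rw [hq', ← hq]

end RefinedSmooth

theorem goodAt_refine (p : Refined B f) : (B.refine f).GoodAt p where
  continuousAt _ hg h0 := (refinedSmoothAt_of_smoothFnAt (hg.smoothFnAt h0)).continuousAt
  secAt s hs h0 := secAt_refine_iff.2 ⟨s, fun _ => 1, refinedSmoothAt_of_smoothFnAt hs, h0,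
    secAt_const _ _, Eventually.of_forall fun q => by rw [mul_one]⟩

/-- The loci where `f` has the exponent of a given summand are open in the refinement. -/
theorem Decomposes.mem_nhds_face {U : Opens X} {N : ℕ} {g : Fin N → X → ExplUnit}
    (h : B.Decomposes f U g) {p : Refined B f} (hp : p ∈ U) {j : Fin N}
    (hj : (f p).exp = (g j p).trop) :
    ∀ᶠ q : Refined B f in 𝓝 p, q ∈ U ∧ (f q).exp = (g j q).trop :=
  (RefinedOpen.face U (g j) (h.mem j) fun q hq => h.exp_le q hq j).mem_nhds
    (V := {q | q ∈ U ∧ (f q).exp = (g j q).trop}) ⟨hp, hj⟩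

/-! ### The refinement is Hausdorff -/

/-- If `x` and `y` have no disjoint neighbourhoods, an ultrafilter converges to both, and their
images in `X` are inseparable. Induction over the basic open sets then shows that every one
containing `y` contains `x`. -/
theorem r1Space_refined (hf : B.IsTropicalOn ⊤ f) [R1Space X] : R1Space (Refined B f) := by
  refine ⟨fun x y => ?_⟩
  by_contra hcon
  push Not at hcon
  obtain ⟨hxy, hdis⟩ := hcon
  apply hxy
  rw [disjoint_iff, ← Ne, ← neBot_iff] at hdis
  have : (𝓝 x ⊓ 𝓝 y).NeBot := hdis
  set 𝒰 := Ultrafilter.of (𝓝 x ⊓ 𝓝 y)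
  have hx : (𝒰 : Filter (Refined B f)) ≤ 𝓝 x := (Ultrafilter.of_le _).trans inf_le_left
  have hy : (𝒰 : Filter (Refined B f)) ≤ 𝓝 y := (Ultrafilter.of_le _).trans inf_le_right
  have hins : Inseparable (refinedMap B f x) (refinedMap B f y) := by
    have h1 : Tendsto (refinedMap B f) 𝒰 (𝓝 (refinedMap B f x)) :=
      continuous_refinedMap.continuousAt.mono_left hx
    have h2 : Tendsto (refinedMap B f) 𝒰 (𝓝 (refinedMap B f y)) :=
      continuous_refinedMap.continuousAt.mono_left hy
    exact tendsto_nhds_unique_inseparable h1 h2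
  have key : ∀ V : Set X, RefinedOpen B f V → refinedMap B f y ∈ V → refinedMap B f x ∈ V := by
    intro V hV
    induction hV with
    | of_open U => exact fun h => (hins.mem_open_iff U.isOpen).2 h
    | inter V W hV hW ihV ihW => exact fun h => ⟨ihV h.1, ihW h.2⟩
    | face U g hg hle =>
      rintro ⟨hyU, hyg⟩
      have hxU : refinedMap B f x ∈ U := (hins.mem_open_iff U.isOpen).2 hyU
      refine ⟨hxU, ?_⟩
      by_contra hne
      obtain ⟨U₀, N, g', hxU₀, hdec⟩ := hf.exists_decomposes (refinedMap B f x)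
      have hyU₀ : refinedMap B f y ∈ U₀ := (hins.mem_open_iff U₀.isOpen).1 hxU₀
      obtain ⟨j, hj⟩ := hdec.exists_exp_eq _ hxU₀
      have hfx : ∀ᶠ q : Refined B f in 𝓝 x, (q ∈ U₀ ∧ (f q).exp = (g' j q).trop) ∧ q ∈ U :=
        (hdec.mem_nhds_face hxU₀ hj).and ((RefinedOpen.of_open U).mem_nhds hxU)
      have hfy₀ : ∀ᶠ q : Refined B f in 𝓝 y, q ∈ U ∧ (f q).exp = (g q).trop :=
        (RefinedOpen.face U g hg hle).mem_nhds ⟨hyU, hyg⟩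
      have hfy : ∀ᶠ q : Refined B f in 𝓝 y, (q ∈ U ∧ (f q).exp = (g q).trop) ∧ q ∈ U₀ :=
        hfy₀.and ((RefinedOpen.of_open U₀).mem_nhds hyU₀)
      have hsx : B.SecAt (refinedMap B f x) fun q => g q / g' j q :=
        (secAt_of_mem hg hxU).div (secAt_of_mem (hdec.mem j) hxU₀)
      have hsy : B.SecAt (refinedMap B f y) fun q => g' j q / g q :=
        (secAt_of_mem (hdec.mem j) hyU₀).div (secAt_of_mem hg hyU)
      have hcx := continuousAt_smoothPart_refined hsx (by
        filter_upwards [hfx] with q hq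
        rw [ExplUnit.trop_div, ← hq.1.2]
        exact sub_nonneg.2 (hle q hq.2))
      have hcy := continuousAt_smoothPart_refined hsy (by
        filter_upwards [hfy] with q hq
        rw [ExplUnit.trop_div, ← hq.1.2]
        exact sub_nonneg.2 (hdec.exp_le q hq.2 j))
      -- If `g` were not minimal at `x`, the smooth part of g/g'_j would tend to 0 along the
      -- ultrafilter while that of g'_j/g converges. Along the ultrafilter both exponents are 0 and
      -- the product is 1, a contradiction.
      have hprod := (hcx.tendsto.mono_left hx).mul (hcy.tendsto.mono_left hy)
      have h0 : (g (refinedMap B f x) / g' j (refinedMap B f x)).smoothPart = 0 :=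
        ExplUnit.smoothPart_of_trop_ne_zero (by
          rw [ExplUnit.trop_div, ← hj]
          exact sub_ne_zero.2 (Ne.symm hne))
      have h1 : ∀ᶠ q : Refined B f in 𝒰,
          (g q / g' j q).smoothPart * (g' j q / g q).smoothPart = 1 := by
        filter_upwards [hx hfx, hy hfy] with q hq hq'
        rw [← ExplUnit.smoothPart_mul]
        · rw [div_mul_div_cancel, div_self']
          exact ExplUnit.smoothPart_one
        · rw [ExplUnit.trop_div, ← hq.1.2, ← hq'.1.2, sub_self]
        · rw [ExplUnit.trop_div, ← hq.1.2, ← hq'.1.2, sub_self]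
      have h2 := tendsto_nhds_unique (tendsto_const_nhds.congr' (h1.mono fun _ h => h.symm)) hprod
      change 1 = (g x / g' j x).smoothPart * _ at h2
      rw [show (g x / g' j x).smoothPart = 0 from h0, zero_mul] at h2
      exact one_ne_zero h2
    | smooth V hV U hVU k hk h0 O hO ih =>
      rintro ⟨hyV, hyO⟩
      have hxV := ih hyV
      refine ⟨hxV, ?_⟩
      have hcx := continuousAt_smoothPart_refined (f := f) (secAt_of_mem hk (hVU hxV))
        (mem_of_superset (hV.mem_nhds hxV) h0)
      have hcy := continuousAt_smoothPart_refined (f := f) (secAt_of_mem hk (hVU hyV))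
        (mem_of_superset (hV.mem_nhds hyV) h0)
      have := tendsto_nhds_unique (hcx.tendsto.mono_left hx) (hcy.tendsto.mono_left hy)
      change (k x).smoothPart ∈ O
      rw [show (k x).smoothPart = (k y).smoothPart from this]
      exact hyO
  intro S hS
  obtain ⟨V, hV, hyV, hVS⟩ := mem_nhds_refined.1 hS
  exact mem_of_superset (hV.mem_nhds (key V hV hyV)) hVS

/-! ### The refinement map is a submersion -/

/-- Exponents are constant along the curve, so it stays in every locus where `f` has the exponent of
a given exploded function. It is therefore continuous in the finer topology too. -/
theorem CurveAt.refine {p : X} {γ : ℝ → X} (hγ : B.CurveAt p γ) (hf : B.IsTropicalOn ⊤ f) :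
    (B.refine f).CurveAt (X := Refined B f) p γ := by
  have hfp : B.TropicalAt p f := ⟨⊤, trivial, hf⟩
  have hexp := (hγ.diffAlong hfp).1
  have hsm : ∀ k, B.SecAt p k → DifferentiableAt ℝ (fun s => (k (γ s)).smoothPart) 0 := by
    intro k hk
    by_cases h : (k p).trop = 0
    · refine (hγ.differentiableAt k hk).congr_of_eventuallyEq ?_
      filter_upwards [hγ.trop k hk] with s hs
      rw [ExplUnit.smoothPart_of_trop_eq_zero (hs.trans h)]
    · refine (differentiableAt_const (0 : ℂ)).congr_of_eventuallyEq ?_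
      filter_upwards [hγ.trop k hk] with s hs
      rw [ExplUnit.smoothPart_of_trop_ne_zero (by rwa [hs])]
  have hmem : ∀ V : Set X, RefinedOpen B f V → p ∈ V → ∀ᶠ s in 𝓝 (0 : ℝ), γ s ∈ V := by
    intro V hV
    induction hV with
    | of_open U =>
      exact fun h => hγ.continuousAt.eventually (by rw [hγ.zero]; exact U.isOpen.mem_nhds h)
    | inter V W hV hW ihV ihW => exact fun h => (ihV h.1).and (ihW h.2)
    | face U g hg hle =>
      rintro ⟨hU, he⟩
      filter_upwards [hγ.continuousAt.eventually (by rw [hγ.zero]; exact U.isOpen.mem_nhds hU),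
        hγ.trop g (secAt_of_mem hg hU), hexp] with s a b c
      exact ⟨a, by rw [b, c, hγ.zero, he]⟩
    | smooth V hV U hVU k hk h0 O hO ih =>
      rintro ⟨hpV, hpO⟩
      have h1 := (hsm k (secAt_of_mem hk (hVU hpV))).continuousAt
      exact (ih hpV).and (h1.eventually (hO.mem_nhds (by simpa only [hγ.zero] using hpO)))
  have hcont : Tendsto (β := Refined B f) γ (𝓝 0) (𝓝 p) := by
    intro S hS
    obtain ⟨V, hV, hpV, hVS⟩ := mem_nhds_refined.1 hS
    exact mem_of_superset (hmem V hV hpV) fun s hs => hVS hs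
  refine ⟨hγ.zero, by rw [← hγ.zero] at hcont; exact hcont, fun φ hφ => ?_, fun φ hφ => ?_⟩
  all_goals
    obtain ⟨s, k, ⟨ι, _, h, H, h1, h2, h3⟩, h0, hk, hφ⟩ := secAt_refine_iff.1 hφ
    have hφγ := hcont.eventually hφ
  · filter_upwards [hφγ, hγ.trop k hk] with t a b
    rw [a, hφ.self_of_nhds]
    simp only [ExplUnit.trop_mul, ExplUnit.trop_ofComplex, zero_add]
    exact b
  · have h4 : DifferentiableAt ℝ (fun t i => (h i (γ t)).smoothPart) 0 :=
      differentiableAt_pi.2 fun i => hsm _ (h1 i).1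
    have h5 : DifferentiableAt ℝ (fun t => H fun i => (h i (γ t)).smoothPart) 0 :=
      DifferentiableAt.comp (f := fun t i => (h i (γ t)).smoothPart) (0 : ℝ)
        (by rw [hγ.zero]; exact h2.differentiableAt) h4
    have h6 := h5.mul (hγ.differentiableAt k hk)
    refine h6.congr_of_eventuallyEq ?_
    have h7 : s p = H fun i => (h i p).smoothPart := h3.self_of_nhds
    have h8 : ∀ᶠ t in 𝓝 (0 : ℝ), H (fun i => (h i (γ t)).smoothPart) ≠ 0 :=
      h5.continuousAt.eventually_ne (by
        simp only [hγ.zero]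
        rw [← h7]
        exact h0)
    filter_upwards [hφγ, hcont.eventually h3, h8] with t a b c
    rw [a, b, Prod.fst_mul, Units.val_mul, ExplUnit.coeff_ofComplex c]
    rfl

theorem IsExplodedManifold.goodAt (hB : B.IsExplodedManifold) (p : X) : B.GoodAt p := by
  obtain ⟨n, m, P, φ, hP, hφ, q, rfl⟩ := hB p
  exact (hφ.localIsoAt q).goodAt (Model.goodAt hP q)

/-- A tangent vector of `B` is the velocity of a model curve, and that curve lifts. -/
theorem derivSurjectiveAt_refinedMap (hB : B.IsExplodedManifold) (hf : B.IsTropicalOn ⊤ f)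
    (p : Refined B f) : DerivSurjectiveAt (B.refine f) B (refinedMap B f) p := by
  intro w
  obtain ⟨n, m, P, φ, hP, hφ, q, hq⟩ := hB (refinedMap B f p)
  have hp : p = φ q := hq.symm
  subst hp
  obtain ⟨ξ, lam, h1, h2⟩ := TangentVector.exists_eq_curve hB.goodAt (hφ.localIsoAt q) w
  have hγ := ((Model.curveAt q ξ lam).map (hφ.localIsoAt q).1).refine hf
  exact ⟨hγ.tangentVector, fun g hg => (h2 g hg).symm, fun g hg => (h1 g hg).symm⟩

end ExplodedSpace

/-! ### Limits of monomials along ultrafilters -/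

theorem Ultrafilter.exists_tendsto_or_atBot {α : Type*} (l : Ultrafilter α) {g : α → ℝ} {C : ℝ}
    (hC : ∀ᶠ a in l, g a ≤ C) : (∃ x, Tendsto g l (𝓝 x)) ∨ Tendsto g l atBot := by
  by_cases h : ∃ M, ∀ᶠ a in l, M ≤ g a
  · obtain ⟨M, hM⟩ := h
    obtain ⟨x, -, hx⟩ := (isCompact_Icc (a := M) (b := C)).ultrafilter_le_nhds (l.map g)
      (le_principal_iff.2 (hM.and hC))
    exact .inl ⟨x, hx⟩
  · push Not at h
    refine .inr (tendsto_atBot.2 fun b => ?_)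
    filter_upwards [h b] with a ha using ha.le

/-- Used to replace divergent logarithms by convergent ones without changing those linear forms of
them that converge. -/
theorem LinearMap.exists_generalizedInverse {K V W : Type*} [Field K] [AddCommGroup V] [Module K V]
    [AddCommGroup W] [Module K W] (L : V →ₗ[K] W) :
    ∃ S : W →ₗ[K] V, ∀ v, L (S (L v)) = L v := by
  obtain ⟨S₀, hS₀⟩ := L.rangeRestrict.exists_rightInverse_of_surjective L.range_rangeRestrict
  obtain ⟨S, hS⟩ := S₀.exists_extend
  refine ⟨S, fun v => ?_⟩
  have h1 : S (L v) = S₀ (L.rangeRestrict v) := congrArg (fun T => T (L.rangeRestrict v)) hS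
  rw [h1]
  exact congrArg Subtype.val (congrArg (fun T => T (L.rangeRestrict v)) hS₀)

section MonomialLimit

variable {m : ℕ}

/-- The logarithms of the absolute values of the coefficients. -/
def logNorm (z : Fin m → ExplUnit) : Fin m → ℝ := fun i => Real.log ‖((z i).1 : ℂ)‖

/-- The phases of the coefficients. -/
def phase (z : Fin m → ExplUnit) (i : Fin m) : ℂ := ((z i).1 : ℂ) / ‖((z i).1 : ℂ)‖

theorem norm_phase (z : Fin m → ExplUnit) (i : Fin m) : ‖phase z i‖ = 1 := by
  rw [phase, norm_div, Complex.norm_real, norm_norm]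
  exact div_self (norm_ne_zero_iff.2 (Units.ne_zero _))

theorem coeff_eq_exp_mul_phase (z : Fin m → ExplUnit) (i : Fin m) :
    ((z i).1 : ℂ) = Real.exp (logNorm z i) * phase z i := by
  have : ‖((z i).1 : ℂ)‖ ≠ 0 := norm_ne_zero_iff.2 (Units.ne_zero _)
  rw [logNorm, Real.exp_log (norm_pos_iff.2 (Units.ne_zero _)), phase, mul_div_cancel₀]
  exact_mod_cast this

theorem prod_exp_zpow (α : Fin m → ℤ) (v : Fin m → ℝ) :
    ∏ i, ((Real.exp (v i) : ℝ) : ℂ) ^ α i = Real.exp (linEval α v) := by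
  have : ∀ i, ((Real.exp (v i) : ℝ) : ℂ) ^ α i = (Real.exp (v i * α i) : ℝ) := by
    intro i
    rw [← Complex.ofReal_zpow, Real.exp_mul, Real.rpow_intCast]
  simp only [this]
  rw [← Complex.ofReal_prod, ← Real.exp_sum]
  rfl

theorem coeff_monomial_eq_exp (c : ℝ × (Fin m → ℤ)) (z : Fin m → ExplUnit) :
    ((monomial c z).1 : ℂ) = Real.exp (linEval c.2 (logNorm z)) * ∏ i, phase z i ^ c.2 i := by
  rw [coeff_monomial, Units.coe_prod, ← prod_exp_zpow, ← Finset.prod_mul_distrib]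
  refine Finset.prod_congr rfl fun i _ => ?_
  rw [Units.val_zpow_eq_zpow_val, coeff_eq_exp_mul_phase z i, mul_zpow]

theorem norm_coeff_monomial (c : ℝ × (Fin m → ℤ)) (z : Fin m → ExplUnit) :
    ‖((monomial c z).1 : ℂ)‖ = Real.exp (linEval c.2 (logNorm z)) := by
  rw [coeff_monomial_eq_exp, norm_mul, norm_prod]
  simp [norm_zpow, norm_phase]

/-- If the smooth parts of the monomials that cut out a polytope stay bounded, then there is a
point of the polytope to which all monomials that are smooth near it converge. -/
theorem exists_tendsto_smoothPart_monomial {α : Type*} (l : Ultrafilter α)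
    (z : α → Fin m → ExplUnit) {s t : Finset (ℝ × (Fin m → ℤ))}
    (hmem : ∀ᶠ q in l, (fun i => (z q i).trop) ∈ polytope s t)
    (hbdd : ∀ c ∈ s, ∃ C, ∀ᶠ q in l, ‖(monomial c (z q)).smoothPart‖ ≤ C) :
    ∃ z' : Fin m → ExplUnit, (fun i => (z' i).trop) ∈ polytope s t ∧
      ∀ d, (∀ x ∈ SameFace s t (fun i => (z' i).trop), 0 ≤ affEval d x) →
        Tendsto (fun q => (monomial d (z q)).smoothPart) l (𝓝 (monomial d z').smoothPart) := by
  classical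
  let y : α → Fin m → ℝ := fun q i => (z q i).trop
  let lam : α → Fin m → ℝ := fun q => logNorm (z q)
  let Z : ℝ × (Fin m → ℤ) → Prop := fun c => ∀ᶠ q in l, affEval c (y q) = 0
  -- `K` selects the constraints that remain active in the limit: zero exponent along `l` and
  -- coefficient bounded away from 0 and ∞. A constraint in `Z` but not in `K` has smooth part
  -- tending to 0, so it must be strictly positive at the limit point.
  let K : ℝ × (Fin m → ℤ) → Prop := fun c => Z c ∧ ∃ x, Tendsto (fun q => linEval c.2 (lam q)) l (𝓝 x)
  have hsp : ∀ c q, affEval c (y q) = 0 → (monomial c (z q)).smoothPart = (monomial c (z q)).1 :=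
    fun c q h => ExplUnit.smoothPart_of_trop_eq_zero ((trop_monomial c (z q)).trans h)
  have hbot : ∀ c ∈ s, Z c → ¬ K c → Tendsto (fun q => linEval c.2 (lam q)) l atBot := by
    intro c hc hZ hK
    obtain ⟨C, hC⟩ := hbdd c hc
    refine (l.exists_tendsto_or_atBot (C := Real.log C) ?_).resolve_left fun h => hK ⟨hZ, h⟩
    filter_upwards [hC, hZ] with q h1 h2
    rw [hsp c q h2, norm_coeff_monomial] at h1
    exact (Real.le_log_iff_exp_le ((Real.exp_pos _).trans_le h1)).2 h1
  have hpos : ∀ c ∈ s, ¬ Z c → ∀ᶠ q in l, 0 < affEval c (y q) := by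
    intro c hc hZ
    filter_upwards [Ultrafilter.eventually_not.2 hZ, hmem] with q h1 h2
    exact lt_of_le_of_ne (h2.1 c hc) (Ne.symm h1)
  let I := {c : ℝ × (Fin m → ℤ) // c ∈ s ∧ K c}
  have : Finite I := Set.Finite.to_subtype (s.finite_toSet.subset fun c hc => hc.1)
  have : Fintype I := Fintype.ofFinite I
  let L : (Fin m → ℝ) →ₗ[ℝ] (I → ℝ) :=
    { toFun := fun v c => linEval c.1.2 v
      map_add' := fun v w => funext fun c => linEval_add_right _ _ _
      map_smul' := fun r v => funext fun c => linEval_smul_right _ _ _ }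
  obtain ⟨S, hS⟩ := L.exists_generalizedInverse
  -- `μ` converges and agrees with the logarithms `lam` on the constraints in `K`. The discrepancy
  -- `δ` is killed by `K` and tends to +∞ on `Z` minus `K`, so it points from the face of the
  -- sequence into the limit face.
  let μ : α → Fin m → ℝ := fun q => S (L (lam q))
  let δ : α → Fin m → ℝ := fun q => μ q - lam q
  have hK0 : ∀ c ∈ s, K c → ∀ q, linEval c.2 (δ q) = 0 := by
    intro c hc hK q
    rw [linEval_sub_right, sub_eq_zero]
    exact congrFun (hS (lam q)) ⟨c, hc, hK⟩
  obtain ⟨μ', hμ'⟩ : ∃ μ', Tendsto μ l (𝓝 μ') := by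
    choose x hx using fun c : I => c.2.2.2
    have h1 : Tendsto (fun q => L (lam q)) l (𝓝 x) := tendsto_pi_nhds.2 fun c => hx c
    exact ⟨S x, (S.continuous_of_finiteDimensional.tendsto x).comp h1⟩
  have hlinμ : ∀ β : Fin m → ℤ, Tendsto (fun q => linEval β (μ q)) l (𝓝 (linEval β μ')) := by
    intro β
    have : Continuous (linEval β) := by unfold linEval; fun_prop
    exact (this.tendsto μ').comp hμ'
  have hδ : ∀ c ∈ s, Z c → ¬ K c → Tendsto (fun q => linEval c.2 (δ q)) l atTop := by
    intro c hc hZ hK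
    have h1 : ∀ q, linEval c.2 (δ q) = linEval c.2 (μ q) + -linEval c.2 (lam q) := by
      intro q
      rw [linEval_sub_right, sub_eq_add_neg]
    simp only [h1]
    exact (hlinμ c.2).add_atTop (tendsto_neg_atBot_atTop.comp (hbot c hc hZ hK))
  obtain ⟨θ, hθ⟩ : ∃ θ : Fin m → ℂ, Tendsto (fun q => phase (z q)) l (𝓝 θ) := by
    have : ∀ i, ∃ θ, Tendsto (fun q => phase (z q) i) l (𝓝 θ) := by
      intro i
      obtain ⟨x, -, hx⟩ := (isCompact_sphere (0 : ℂ) 1).ultrafilter_le_nhds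
        (l.map fun q => phase (z q) i) (le_principal_iff.2 (mem_map.2 (Eventually.of_forall
          fun q => mem_sphere_zero_iff_norm.2 (norm_phase (z q) i))))
      exact ⟨x, hx⟩
    choose θ hθ using this
    exact ⟨θ, tendsto_pi_nhds.2 hθ⟩
  have hθ1 : ∀ i, ‖θ i‖ = 1 := by
    intro i
    have := (tendsto_pi_nhds.1 hθ i).norm
    simp only [norm_phase] at this
    exact (tendsto_nhds_unique tendsto_const_nhds this).symm
  have hθ0 : ∀ i, θ i ≠ 0 := fun i h => by simpa [h] using hθ1 i
  -- the faces of the points along `l`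
  let G : (Fin m → ℝ) → Prop := fun x => x ∈ polytope s t ∧ ∀ c ∈ s, affEval c x = 0 ↔ Z c
  have hG : ∀ᶠ q in l, G (y q) := by
    refine hmem.and ((eventually_all_finset s).2 fun c hc => ?_)
    by_cases hZ : Z c
    · have hZ' : ∀ᶠ q in l, affEval c (y q) = 0 := hZ
      filter_upwards [hZ'] with q hq using iff_of_true hq hZ
    · filter_upwards [hpos c hc hZ] with q hq using iff_of_false hq.ne' hZ
  -- A short move from the common face of the points along `l`, in a direction killed by `K` and
  -- positive on `Z` minus `K`, reaches the limit face.
  have hface : ∀ x v y', G x → (∀ c ∈ s, K c → linEval c.2 v = 0) →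
      (∀ c ∈ s, Z c → ¬ K c → 0 < linEval c.2 v) → (∀ c ∈ s, affEval c y' = 0 ↔ K c) →
      ∀ᶠ r : ℝ in 𝓝[>] 0, x + r • v ∈ SameFace s t y' := by
    intro x v y' hx h1 h2 h3
    have h4 := eventually_mem_polytope (v := v) hx.1 fun c hc h => by
      by_cases hK : K c
      · exact (h1 c hc hK).ge
      · exact (h2 c hc ((hx.2 c hc).1 h) hK).le
    filter_upwards [h4, self_mem_nhdsWithin] with r hr (hr0 : 0 < r)
    refine ⟨hr.1, fun c hc => ?_⟩
    rw [h3 c hc]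
    by_cases hZ : Z c
    · rw [affEval_add_smul, (hx.2 c hc).2 hZ, zero_add]
      by_cases hK : K c
      · exact iff_of_true (by rw [h1 c hc hK, mul_zero]) hK
      · exact iff_of_false (mul_pos hr0 (h2 c hc hZ hK)).ne' hK
    · exact iff_of_false (hr.2 c hc fun h => hZ ((hx.2 c hc).1 h)).ne' fun h => hZ h.1
  have hdir : ∀ᶠ q in l, ∀ c ∈ s, Z c → ¬ K c → 0 < linEval c.2 (δ q) := by
    refine (eventually_all_finset s).2 fun c hc => ?_
    by_cases h : Z c ∧ ¬ K c
    · filter_upwards [(hδ c hc h.1 h.2).eventually_gt_atTop 0] with q hq _ _ using hq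
    · exact Eventually.of_forall fun q h1 h2 => absurd ⟨h1, h2⟩ h
  obtain ⟨q₁, hq₁, hw⟩ := (hG.and hdir).exists
  let w := δ q₁
  obtain ⟨r₁, hr₁, hr₁'⟩ : ∃ r : ℝ, 0 < r ∧ (y q₁ + r • w ∈ polytope s t ∧
      ∀ c ∈ s, affEval c (y q₁) ≠ 0 → 0 < affEval c (y q₁ + r • w)) := by
    have h4 := eventually_mem_polytope (v := w) hq₁.1 fun c hc h => by
      by_cases hK : K c
      · exact (hK0 c hc hK q₁).ge
      · exact (hw c hc ((hq₁.2 c hc).1 h) hK).le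
    obtain ⟨r, h, h'⟩ := (h4.and self_mem_nhdsWithin).exists
    exact ⟨r, h', h⟩
  -- One step along `δ q₁` gives the tropical part of the limit; its active constraints are exactly
  -- those in `K`.
  let y' := y q₁ + r₁ • w
  have hy' : ∀ c ∈ s, affEval c y' = 0 ↔ K c := by
    intro c hc
    by_cases hZ : Z c
    · rw [affEval_add_smul, (hq₁.2 c hc).2 hZ, zero_add]
      by_cases hK : K c
      · exact iff_of_true (by rw [hK0 c hc hK, mul_zero]) hK
      · exact iff_of_false (mul_pos hr₁ (hw c hc hZ hK)).ne' hK
    · exact iff_of_false (hr₁'.2 c hc fun h => hZ ((hq₁.2 c hc).1 h)).ne' fun h => hZ h.1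
  -- The coefficients combine the limits of the corrected logarithms and of the phases.
  let z' : Fin m → ExplUnit := fun i =>
    (Units.mk0 (Real.exp (μ' i) * θ i) (mul_ne_zero (by exact_mod_cast (Real.exp_pos _).ne')
      (hθ0 i)), Multiplicative.ofAdd (y' i))
  have hz' : (fun i => (z' i).trop) = y' := rfl
  refine ⟨z', hr₁'.1, fun d hd => ?_⟩
  rw [hz'] at hd
  by_cases hd0 : affEval d y' = 0
  -- A monomial of exponent 0 at `y'` has exponent 0 on the whole open face, so its linear part
  -- vanishes wherever all constraints in `K` do. It thus takes the same value on `lam` as on `μ`,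
  -- which converges.
  · have hker : ∀ v, (∀ c ∈ s, K c → linEval c.2 v = 0) → linEval d.2 v = 0 := by
      intro v hv
      obtain ⟨r, hr, hr0 : 0 < r⟩ := ((eventually_mem_sameFace (v := v) hr₁'.1 fun c hc h =>
        hv c hc ((hy' c hc).1 h)).and self_mem_nhdsWithin).exists
      have h1 := affEval_eq_zero_of_sameFace hr₁'.1 hr hd hd0
      rw [affEval_add_smul] at h1
      change affEval d y' + _ = 0 at h1
      rw [hd0, zero_add] at h1
      exact (mul_eq_zero.1 h1).resolve_left hr0.ne'
    have h1 : ∀ᶠ q in l, (monomial d (z q)).smoothPart =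
        Real.exp (linEval d.2 (μ q)) * ∏ i, phase (z q) i ^ d.2 i := by
      filter_upwards [hG] with q hq
      have h2 : affEval d (y q) = 0 := by
        have h3 := hker (y q - y') fun c hc hK => by
          have h4 := (hq.2 c hc).2 hK.1
          have h5 := (hy' c hc).2 hK
          rw [affEval_eq] at h4 h5
          rw [linEval_sub_right]
          linarith
        rw [affEval_eq] at hd0 ⊢
        rw [linEval_sub_right] at h3
        linarith
      have h3 := hker (δ q) fun c hc hK => hK0 c hc hK q
      rw [linEval_sub_right, sub_eq_zero] at h3
      rw [hsp d q h2, coeff_monomial_eq_exp, h3]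
    have h2 : (monomial d z').smoothPart = Real.exp (linEval d.2 μ') * ∏ i, θ i ^ d.2 i := by
      rw [ExplUnit.smoothPart_of_trop_eq_zero ((trop_monomial d z').trans hd0), coeff_monomial,
        Units.coe_prod, ← prod_exp_zpow, ← Finset.prod_mul_distrib]
      refine Finset.prod_congr rfl fun i _ => ?_
      rw [Units.val_zpow_eq_zpow_val, ← mul_zpow]
      rfl
    rw [h2]
    refine Tendsto.congr' (h1.mono fun _ h => h.symm) (Tendsto.mul ?_ ?_)
    · exact ((Complex.continuous_ofReal.comp Real.continuous_exp).tendsto _).comp (hlinμ d.2)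
    · exact tendsto_finsetProd _ fun i _ =>
        (tendsto_pi_nhds.1 hθ i).zpow₀ _ (.inl (hθ0 i))
  · have hdy' : 0 < affEval d y' := lt_of_le_of_ne (hd y' (SameFace.self hr₁'.1)) (Ne.symm hd0)
    rw [ExplUnit.smoothPart_of_trop_ne_zero (by rw [trop_monomial]; exact hd0)]
    rcases l.em fun q => affEval d (y q) = 0 with hZd | hZd
    -- The remaining delicate case: exponent 0 along `l` but positive at `y'`. The smooth part has
    -- to tend to 0, which is forced by growth of the linear part of `d` along `δ`.
    · have hdw : 0 < linEval d.2 w := by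
        obtain ⟨q, hq, hdq⟩ := (hG.and hZd).exists
        have h1 : ∀ x ∈ SameFace s t (y q), 0 ≤ affEval d x := by
          intro x hx
          have h2 := hface x w y' ⟨hx.1, fun c hc => (hx.2 c hc).trans (hq.2 c hc)⟩
            (fun c hc hK => hK0 c hc hK q₁) hw hy'
          have h3 : Tendsto (fun r : ℝ => affEval d x + r * linEval d.2 w) (𝓝[>] 0)
              (𝓝 (affEval d x + 0 * linEval d.2 w)) :=
            Tendsto.mono_left (Continuous.tendsto (by fun_prop) _) nhdsWithin_le_nhds
          rw [zero_mul, add_zero] at h3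
          refine ge_of_tendsto h3 ?_
          filter_upwards [h2] with r hr
          rw [← affEval_add_smul]
          exact hd _ hr
        have h2 := affEval_eq_zero_of_sameFace hq.1 (x := y q₁)
          ⟨hq₁.1, fun c hc => (hq₁.2 c hc).trans (hq.2 c hc).symm⟩ h1 hdq
        have h3 : affEval d y' = affEval d (y q₁) + r₁ * linEval d.2 w := affEval_add_smul _ _ _ _
        rw [h2, zero_add] at h3
        rw [h3] at hdy'
        exact pos_of_mul_pos_right hdy' hr₁.le
      -- Eventually δ - M w still points into the limit face, for any fixed M, so `d` is nonnegative
      -- on it. This gives d(δ) ≥ M d(w), and d(w) > 0 makes this bound arbitrarily large.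
      have htop : Tendsto (fun q => linEval d.2 (δ q)) l atTop := by
        refine tendsto_atTop.2 fun b => ?_
        obtain ⟨M, hM⟩ : ∃ M : ℝ, b ≤ M * linEval d.2 w :=
          ⟨b / linEval d.2 w, (div_mul_cancel₀ b hdw.ne').ge⟩
        have h1 : ∀ᶠ q in l, ∀ c ∈ s, Z c → ¬ K c → 0 < linEval c.2 (δ q - M • w) := by
          refine (eventually_all_finset s).2 fun c hc => ?_
          by_cases h : Z c ∧ ¬ K c
          · filter_upwards [(hδ c hc h.1 h.2).eventually_gt_atTop (M * linEval c.2 w)]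
              with q hq _ _
            rw [linEval_sub_right, linEval_smul_right]
            exact sub_pos.2 hq
          · exact Eventually.of_forall fun q h1 h2 => absurd ⟨h1, h2⟩ h
        filter_upwards [h1, hG, hZd] with q hq hGq hdq
        refine hM.trans ?_
        have h2 := hface (y q) (δ q - M • w) y' hGq (fun c hc hK => by
          rw [linEval_sub_right, linEval_smul_right, hK0 c hc hK q, hK0 c hc hK q₁]
          ring) hq hy'
        obtain ⟨r, hr, hr0 : 0 < r⟩ := (h2.and self_mem_nhdsWithin).exists
        have h3 := hd _ hr
        rw [affEval_add_smul, hdq, zero_add] at h3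
        have h4 := nonneg_of_mul_nonneg_right h3 hr0
        rw [linEval_sub_right, linEval_smul_right] at h4
        linarith
      have hlam : Tendsto (fun q => linEval d.2 (lam q)) l atBot := by
        have h1 : ∀ q, linEval d.2 (lam q) = linEval d.2 (μ q) + -linEval d.2 (δ q) := by
          intro q
          rw [linEval_sub_right]
          ring
        simp only [h1]
        exact (hlinμ d.2).add_atBot (tendsto_neg_atTop_atBot.comp htop)
      rw [tendsto_zero_iff_norm_tendsto_zero]
      refine (Real.tendsto_exp_atBot.comp hlam).congr' ?_
      filter_upwards [hZd] with q hq
      rw [hsp d q hq, norm_coeff_monomial]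
      rfl
    · refine tendsto_const_nhds.congr' ?_
      filter_upwards [hZd] with q hq
      exact (ExplUnit.smoothPart_of_trop_ne_zero (by rw [trop_monomial]; exact hq)).symm

end MonomialLimit

/-! ### The refinement map is proper -/

theorem ContinuousAt.eq_of_inseparable {X Y : Type*} [TopologicalSpace X] [TopologicalSpace Y]
    [T2Space Y] {s : X → Y} {p q : X} (hs : ContinuousAt s p) (h : Inseparable p q) :
    s q = s p := by
  have h1 : Tendsto s (pure q) (𝓝 (s p)) := hs.tendsto.mono_left (by
    rw [h.nhds_eq]
    exact pure_le_nhds q)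
  exact tendsto_nhds_unique (tendsto_pure_nhds s q) h1

namespace ExplodedSpace

variable {X : Type u} [TopologicalSpace X] {B : ExplodedSpace X} {f : X → Expl}

/-- A summand that dominates all others. -/
theorem Decomposes.exists_dominant {U : Opens X} {N : ℕ} {g : Fin N → X → ExplUnit}
    (h : B.Decomposes f U g) {q : X} (hq : q ∈ U) :
    ∃ i, (f q).exp = (g i q).trop ∧ ∀ j, ‖(g j q / g i q).smoothPart‖ ≤ 1 := by
  classical
  obtain ⟨j₀, hj₀⟩ := h.exists_exp_eq q hq
  obtain ⟨i, hi, hmax⟩ := (Finset.univ.filter fun j => (f q).exp = (g j q).trop).exists_max_image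
    (fun j => ‖((g j q).1 : ℂ)‖) ⟨j₀, by simpa using hj₀⟩
  have hi' : (f q).exp = (g i q).trop := by simpa using hi
  refine ⟨i, hi', fun j => ?_⟩
  by_cases hj : (f q).exp = (g j q).trop
  · rw [ExplUnit.smoothPart_of_trop_eq_zero (by rw [ExplUnit.trop_div, ← hj, ← hi', sub_self]),
      Prod.fst_div, Units.val_div_eq_div_val, norm_div]
    exact div_le_one_of_le₀ (hmax j (by simpa using hj)) (norm_nonneg _)
  · rw [ExplUnit.smoothPart_of_trop_ne_zero (by
      rw [ExplUnit.trop_div, ← hi']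
      exact sub_ne_zero.2 (Ne.symm hj)), norm_zero]
    exact zero_le_one

/-- The compactness behind properness. In a chart the ultrafilter is concentrated where one summand
dominates; adding the inequalities that make it minimal cuts out a cell in which the monomial limit
lemma finds a limit point. Its image is inseparable from `p`. -/
theorem exists_le_nhds_refined (hB : B.IsExplodedManifold) (hf : B.IsTropicalOn ⊤ f)
    (l : Ultrafilter (Refined B f)) {p : X} (hl : Tendsto (refinedMap B f) l (𝓝 p)) :
    ∃ p' : Refined B f, Inseparable p (refinedMap B f p') ∧ (l : Filter (Refined B f)) ≤ 𝓝 p' := by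
  classical
  obtain ⟨n, m, P, φ, hP, hφ, q₀, rfl⟩ := hB p
  obtain ⟨-, s, t, hPst⟩ := id hP
  change P = polytope s t at hPst
  have hφq := hφ.localIsoAt q₀
  obtain ⟨-, η, hη, hη0, hφη, -⟩ := id hφq
  let l' : Ultrafilter (Model n m P) := l.map fun q => η (refinedMap B f q)
  have hl' : Tendsto id (l' : Filter (Model n m P)) (𝓝 q₀) := by
    have := hη.1.tendsto.comp hl
    rw [hη0] at this
    exact this
  have hback : ∀ᶠ q in (l : Filter (Refined B f)), φ (η (refinedMap B f q)) = refinedMap B f q :=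
    hl.eventually hφη
  have form : ∀ k : X → ExplUnit, B.SecAt (φ q₀) k → ∃ (σ : Model n m P → ℂ)
      (c : ℝ × (Fin m → ℤ)), ContinuousAt σ q₀ ∧ σ q₀ ≠ 0 ∧ ∀ᶠ r in 𝓝 q₀, σ r ≠ 0 ∧
        k (φ r) = ExplUnit.ofComplex (σ r) * monomial c r.z := by
    intro k hk
    obtain ⟨σ, c, h1, h2, h3⟩ := Model.secAt_iff.1 (hφq.1.2 k hk)
    exact ⟨σ, c, h1.continuousAt, h2, (h1.continuousAt.eventually_ne h2).and h3⟩
  obtain ⟨U₀, N, g, hpU₀, hdec⟩ := hf.exists_decomposes (φ q₀)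
  have hφc : Continuous φ := hφ.isOpenEmbedding.continuous
  have hU₀ : ∀ᶠ r in 𝓝 q₀, φ r ∈ U₀ := hφc.continuousAt (U₀.isOpen.mem_nhds hpU₀)
  -- There are finitely many summands and some one dominates at each point, so an ultrafilter
  -- selects one of them. Taking the largest coefficient among those of minimal exponent gives the
  -- bound 1.
  obtain ⟨i, hi⟩ : ∃ i, ∀ᶠ r in (l' : Filter (Model n m P)), (f (φ r)).exp = (g i (φ r)).trop ∧
      ∀ j, ‖(g j (φ r) / g i (φ r)).smoothPart‖ ≤ 1 := by
    by_contra hcon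
    have h1 := eventually_all.2 fun i => Ultrafilter.eventually_not.2 (not_exists.1 hcon i)
    obtain ⟨r, hr, hr'⟩ := (h1.and (hl'.eventually hU₀)).exists
    obtain ⟨i, hi⟩ := hdec.exists_dominant hr'
    exact hr i hi
  choose σ c hσ hσ0 hform using fun j => form (fun q => g j q / g i q)
    ((secAt_of_mem (hdec.mem j) hpU₀).div (secAt_of_mem (hdec.mem i) hpU₀))
  have htrop : ∀ j, ∀ᶠ r in 𝓝 q₀, (g j (φ r) / g i (φ r)).trop = affEval (c j) r.trop := by
    intro j
    filter_upwards [hform j] with r hr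
    rw [hr.2, ExplUnit.trop_mul, ExplUnit.trop_ofComplex, zero_add, trop_monomial]
    rfl
  let s' := s ∪ Finset.univ.image c
  have hs' : ∀ x, x ∈ polytope s' t ↔ x ∈ P ∧ ∀ j, 0 ≤ affEval (c j) x := by
    intro x
    rw [hPst]
    constructor
    · exact fun h => ⟨⟨fun d hd => h.1 d (Finset.mem_union_left _ hd), h.2⟩,
        fun j => h.1 _ (Finset.mem_union_right _ (Finset.mem_image_of_mem _ (Finset.mem_univ _)))⟩
    · rintro ⟨h1, h2⟩
      refine ⟨fun d hd => ?_, h1.2⟩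
      rcases Finset.mem_union.1 hd with hd | hd
      · exact h1.1 d hd
      · obtain ⟨j, -, rfl⟩ := Finset.mem_image.1 hd
        exact h2 j
  obtain ⟨z', hz', hlim⟩ := exists_tendsto_smoothPart_monomial l' Model.z (s := s') (t := t) (by
    filter_upwards [hi, hl'.eventually (eventually_all.2 htrop), hl'.eventually hU₀] with r h1 h2 h3
    refine (hs' _).2 ⟨r.mem, fun j => ?_⟩
    refine le_of_le_of_eq ?_ (h2 j)
    rw [ExplUnit.trop_div, id_eq, ← h1.1]
    exact sub_nonneg.2 (hdec.exp_le _ h3 j)) (by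
    intro d hd
    rcases Finset.mem_union.1 hd with hd | hd
    · let d' : NonnegMonomial P := ⟨d, fun x hx => (hPst ▸ hx : x ∈ polytope s t).1 d hd⟩
      have h1 : Tendsto (fun r => ‖Model.zeta d' r‖) (l' : Filter (Model n m P)) (𝓝 ‖Model.zeta d' q₀‖) :=
        (((Model.continuous_zeta d').tendsto q₀).comp hl').norm
      exact ⟨_, h1.eventually (ge_mem_nhds (lt_add_one _))⟩
    · obtain ⟨j, -, rfl⟩ := Finset.mem_image.1 hd
      have h0 : 0 < ‖σ j q₀‖ := norm_pos_iff.2 (hσ0 j)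
      have h1 : Tendsto (fun r => ‖σ j r‖) (l' : Filter (Model n m P)) (𝓝 ‖σ j q₀‖) := ((hσ j).tendsto.comp hl').norm
      -- The unit `σ j` eventually exceeds half its absolute value at `q₀`, while its product with
      -- the monomial's smooth part is at most 1.
      refine ⟨2 / ‖σ j q₀‖, ?_⟩
      filter_upwards [hi, hl'.eventually (hform j),
        h1.eventually (lt_mem_nhds (half_lt_self h0))] with r h2 h3 h4
      have h5 := h2.2 j
      rw [id_eq] at h3
      rw [h3.2, ExplUnit.smoothPart_mul_of_trop_eq_zero (ExplUnit.trop_ofComplex _),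
        ExplUnit.coeff_ofComplex h3.1, norm_mul] at h5
      rw [le_div_iff₀ h0]
      nlinarith [norm_nonneg (monomial (c j) r.z).smoothPart])
  let F : Set (Fin m → ℝ) := SameFace s' t fun i => (z' i).trop
  have hFP : ∀ x ∈ F, x ∈ P := fun x hx => ((hs' x).1 hx.1).1
  have hself : (fun i => (z' i).trop) ∈ F := SameFace.self hz'
  let p' : Model n m P := ⟨q₀.x, z', hFP _ hself⟩
  -- Every smooth monomial of the model converges along `l'` both to its value at `q₀` and to its
  -- value at `p'`.
  have hins₀ : Inseparable q₀ p' := by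
    refine Model.inseparable_of_eq rfl fun d => ?_
    have h1 : Tendsto (fun r => Model.zeta d r) (l' : Filter (Model n m P)) (𝓝 (Model.zeta d q₀)) :=
      ((Model.continuous_zeta d).tendsto q₀).comp hl'
    exact tendsto_nhds_unique h1 (hlim d.1 fun x hx => d.2 x (hFP x hx))
  have hins : ∀ x (hx : x ∈ F), Inseparable q₀ (p'.withTrop x (hFP x hx)) := by
    intro x hx
    refine hins₀.trans (Model.inseparable_withTrop hPst p' (x := x) ?_)
    have h1 : x ∈ polytope s t := hPst ▸ hFP x hx
    exact ⟨h1, fun d hd => hx.2 d (Finset.mem_union_left _ hd)⟩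
  have hp' : p' = p'.withTrop _ (hFP _ hself) := rfl
  have hat : ∀ {Q : Model n m P → Prop}, (∀ᶠ r in 𝓝 q₀, Q r) → ∀ x (hx : x ∈ F),
      Q (p'.withTrop x (hFP x hx)) := by
    intro Q hQ x hx
    rw [(hins x hx).nhds_eq] at hQ
    exact hQ.self_of_nhds
  -- behaviour of the exploded functions
  have sec : ∀ k : X → ExplUnit, B.SecAt (φ q₀) k →
      (∀ x (hx : x ∈ F), 0 ≤ (k (φ (p'.withTrop x (hFP x hx)))).trop) →
      Tendsto (fun r => (k (φ r)).smoothPart) l' (𝓝 (k (φ p')).smoothPart) ∧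
      ∀ x (hx : x ∈ F), (k (φ (p'.withTrop x (hFP x hx)))).smoothPart = (k (φ p')).smoothPart := by
    intro k hk h0
    obtain ⟨τ, d, hτ, hτ0, hkd⟩ := form k hk
    have hd : ∀ x ∈ F, 0 ≤ affEval d x := by
      intro x hx
      have h1 := h0 x hx
      rw [(hat hkd x hx).2, ExplUnit.trop_mul, ExplUnit.trop_ofComplex, zero_add,
        trop_monomial] at h1
      exact h1
    have hsp : ∀ r, (τ r ≠ 0 ∧ k (φ r) = ExplUnit.ofComplex (τ r) * monomial d r.z) →
        (k (φ r)).smoothPart = τ r * (monomial d r.z).smoothPart := by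
      intro r hr
      rw [hr.2, ExplUnit.smoothPart_mul_of_trop_eq_zero (ExplUnit.trop_ofComplex _),
        ExplUnit.coeff_ofComplex hr.1]
    have hspx : ∀ x (hx : x ∈ F), (k (φ (p'.withTrop x (hFP x hx)))).smoothPart =
        τ q₀ * (monomial d (p'.withTrop x (hFP x hx)).z).smoothPart := by
      intro x hx
      rw [hsp _ (hat hkd x hx), hτ.eq_of_inseparable (hins x hx)]
    constructor
    · have h1 := (hτ.tendsto.comp hl').mul (hlim d hd)
      rw [hp', hspx _ hself]
      refine h1.congr' ?_
      filter_upwards [hl'.eventually hkd] with r hr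
      exact (hsp r hr).symm
    · intro x hx
      conv_rhs => rw [hp']
      rw [hspx x hx, hspx _ hself]
      congr 1
      have hiff : affEval d x = 0 ↔ affEval d (fun i => (z' i).trop) = 0 := by
        refine ⟨fun h => ?_, fun h => affEval_eq_zero_of_sameFace hz' hx hd h⟩
        refine affEval_eq_zero_of_sameFace hx.1 (SameFace.symm hz' hx) (fun w hw => hd w ?_) h
        exact ⟨hw.1, fun e he => (hw.2 e he).trans (hx.2 e he)⟩
      by_cases h : affEval d x = 0
      · rw [ExplUnit.smoothPart_of_trop_eq_zero, ExplUnit.smoothPart_of_trop_eq_zero,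
          coeff_monomial, coeff_monomial]
        · rfl
        · rw [trop_monomial]
          exact hiff.1 h
        · rw [trop_monomial]
          exact h
      · rw [ExplUnit.smoothPart_of_trop_ne_zero, ExplUnit.smoothPart_of_trop_ne_zero]
        · rw [trop_monomial]
          exact fun h' => h (hiff.2 h')
        · rw [trop_monomial]
          exact h
  have hopen : ∀ (U : Opens X), φ p' ∈ U → φ q₀ ∈ U := fun U h =>
    ((hins₀.map hφc).mem_open_iff U.isOpen).2 h
  -- The added inequalities say that no summand has smaller exponent than `g i` on the cell, so `f`
  -- has the exponent of `g i` over all of `F`.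
  have hfexp : ∀ x (hx : x ∈ F), (f (φ (p'.withTrop x (hFP x hx)))).exp =
      (g i (φ (p'.withTrop x (hFP x hx)))).trop := by
    intro x hx
    have hU := hat hU₀ x hx
    obtain ⟨j, hj⟩ := hdec.exists_exp_eq _ hU
    refine le_antisymm (hdec.exp_le _ hU i) ?_
    have h1 := ((hs' x).1 hx.1).2 j
    have h2 := hat (htrop j) x hx
    rw [Model.trop_withTrop, ExplUnit.trop_div, ← hj] at h2
    rw [← h2] at h1
    linarith
  -- The induction carries the claim for the whole open face `F`, not only for `p'`: convergence of
  -- a smooth part needs nonnegative exponents on all of `F`.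
  have key : ∀ V, RefinedOpen B f V → φ p' ∈ V →
      (∀ᶠ r in (l' : Filter (Model n m P)), φ r ∈ V) ∧
      ∀ x (hx : x ∈ F), φ (p'.withTrop x (hFP x hx)) ∈ V := by
    intro V hV
    induction hV with
    | of_open U =>
      intro h
      have h1 : ∀ᶠ r in 𝓝 q₀, φ r ∈ U := hφc.continuousAt (U.isOpen.mem_nhds (hopen U h))
      exact ⟨hl'.eventually h1, fun x hx => hat h1 x hx⟩
    | inter V W hV hW ihV ihW =>
      intro h
      exact ⟨(ihV h.1).1.and (ihW h.2).1, fun x hx => ⟨(ihV h.1).2 x hx, (ihW h.2).2 x hx⟩⟩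
    | face U k hk hle =>
      rintro ⟨hU, he⟩
      have hU' := hopen U hU
      have h1 : ∀ᶠ r in 𝓝 q₀, φ r ∈ U := hφc.continuousAt (U.isOpen.mem_nhds hU')
      obtain ⟨h2, h3⟩ := sec (fun q => k q / g i q)
        ((secAt_of_mem hk hU').div (secAt_of_mem (hdec.mem i) hpU₀)) (by
          intro x hx
          rw [ExplUnit.trop_div, ← hfexp x hx]
          exact sub_nonneg.2 (hle _ (hat h1 x hx)))
      have h4 : (k (φ p') / g i (φ p')).smoothPart ≠ 0 := by
        have h5 := hfexp _ hself
        rw [← hp'] at h5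
        rw [ExplUnit.smoothPart_ne_zero_iff, ExplUnit.trop_div, ← h5, he, sub_self]
      constructor
      · filter_upwards [h2.eventually_ne h4, hi, hl'.eventually h1] with r h5 h6 h7
        rw [ExplUnit.smoothPart_ne_zero_iff, ExplUnit.trop_div, ← h6.1, sub_eq_zero] at h5
        exact ⟨h7, h5.symm⟩
      · intro x hx
        have h5 := h3 x hx ▸ h4
        rw [ExplUnit.smoothPart_ne_zero_iff, ExplUnit.trop_div, ← hfexp x hx, sub_eq_zero] at h5
        exact ⟨hat h1 x hx, h5.symm⟩
    | smooth V hV U hVU k hk h0 O hO ih =>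
      rintro ⟨hV', hO'⟩
      obtain ⟨h1, h2⟩ := ih hV'
      obtain ⟨h3, h4⟩ := sec k (secAt_of_mem hk (hopen U (hVU hV')))
        fun x hx => h0 _ (h2 x hx)
      refine ⟨h1.and (h3.eventually (hO.mem_nhds hO')), fun x hx => ⟨h2 x hx, ?_⟩⟩
      rw [h4 x hx]
      exact hO'
  refine ⟨φ p', hins₀.map hφc, fun S hS => ?_⟩
  obtain ⟨V, hV, hpV, hVS⟩ := mem_nhds_refined.1 hS
  have h1 := (key V hV hpV).1
  have h2 : ∀ᶠ q in (l : Filter (Refined B f)), φ (η (refinedMap B f q)) ∈ V := h1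
  filter_upwards [h2, hback] with q h3 h4
  rw [h4] at h3
  exact hVS h3

/-- An ultrafilter on the smooth part is pushed up by a set-theoretic section of the quotient map;
the limit upstairs descends because inseparable points are identified. -/
theorem isProperMap_smoothPartMap_refinedMap (hB : B.IsExplodedManifold)
    (hf : B.IsTropicalOn ⊤ f) :
    IsProperMap (smoothPartMap (refinedMap B f) continuous_refinedMap) := by
  refine isProperMap_iff_ultrafilter.2 ⟨SeparationQuotient.continuous_lift ?_, ?_⟩
  · exact SeparationQuotient.continuous_mk.comp continuous_refinedMap
  · intro l y hl
    obtain ⟨p, rfl⟩ := SeparationQuotient.surjective_mk y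
    let σ : SeparationQuotient (Refined B f) → Refined B f :=
      Function.surjInv SeparationQuotient.surjective_mk
    have hσ : ∀ x, SeparationQuotient.mk (σ x) = x :=
      Function.surjInv_eq SeparationQuotient.surjective_mk
    have h1 : Tendsto (refinedMap B f) (l.map σ : Ultrafilter (Refined B f)) (𝓝 p) := by
      rw [← SeparationQuotient.comap_mk_nhds_mk, tendsto_comap_iff, Ultrafilter.coe_map,
        tendsto_map'_iff]
      refine hl.congr fun x => ?_
      conv_lhs => rw [← hσ x]
      rfl
    obtain ⟨p', hp', hle⟩ := exists_le_nhds_refined hB hf _ h1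
    refine ⟨SeparationQuotient.mk p', (SeparationQuotient.mk_eq_mk.2 hp').symm, ?_⟩
    have h2 : Tendsto (fun x => SeparationQuotient.mk (σ x)) l (𝓝 (SeparationQuotient.mk p')) :=
      (SeparationQuotient.continuous_mk.tendsto p').comp hle
    simp only [hσ] at h2
    exact h2

end ExplodedSpace

/-! ### The inverse function theorem for germs of smooth functions -/

/-- The source is shrunk until `Φ` is smooth with invertible derivative at each of its points, so
that the inverse is smooth on the entire target. -/
theorem SmoothNear.exists_localInverse {E : Type*} [NormedAddCommGroup E] [NormedSpace ℝ E]
    [FiniteDimensional ℝ E] {Φ : E → E} {a : E} (hΦ : SmoothNear Φ a)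
    (hinj : Function.Injective (fderiv ℝ Φ a)) :
    ∃ e : OpenPartialHomeomorph E E, a ∈ e.source ∧ (∀ x, e x = Φ x) ∧
      (∀ x ∈ e.source, SmoothNear Φ x) ∧ ∀ y ∈ e.target, SmoothNear e.symm y := by
  have : CompleteSpace E := FiniteDimensional.complete ℝ E
  let f' : E ≃L[ℝ] E :=
    (LinearEquiv.ofInjectiveEndo (fderiv ℝ Φ a : E →ₗ[ℝ] E) hinj).toContinuousLinearEquiv
  have hf'c : (f' : E →L[ℝ] E) = fderiv ℝ Φ a := by
    ext x
    rfl
  have hf' : HasFDerivAt Φ (f' : E →L[ℝ] E) a := by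
    rw [hf'c]
    exact hΦ.differentiableAt.hasFDerivAt
  let e₀ := hΦ.contDiffAt.toOpenPartialHomeomorph Φ hf' (by simp)
  have hS : {x | SmoothNear Φ x ∧ fderiv ℝ Φ x ∈ Set.range ((↑) : (E ≃L[ℝ] E) → E →L[ℝ] E)} ∈ 𝓝 a := by
    have h1 : ContinuousAt (fderiv ℝ Φ) a :=
      (hΦ.contDiffAt.fderiv_right (m := 0) (by simp)).continuousAt
    have h2 : Set.range ((↑) : (E ≃L[ℝ] E) → E →L[ℝ] E) ∈ 𝓝 (fderiv ℝ Φ a) := by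
      rw [← hf'c]
      exact ContinuousLinearEquiv.nhds f'
    exact hΦ.eventually.and (h1.eventually h2)
  obtain ⟨S, hSS, hSo, haS⟩ := mem_nhds_iff.1 hS
  refine ⟨e₀.restrOpen S hSo, ⟨?_, haS⟩, fun x => rfl, fun x hx => (hSS hx.2).1, fun y hy => ?_⟩
  · exact hΦ.contDiffAt.mem_toOpenPartialHomeomorph_source hf' (by simp)
  · filter_upwards [(e₀.restrOpen S hSo).open_target.mem_nhds hy] with x hx
    have hx' : (e₀.restrOpen S hSo).symm x ∈ S := ((e₀.restrOpen S hSo).map_target hx).2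
    obtain ⟨h1, g', hg'⟩ := hSS hx'
    refine (e₀.restrOpen S hSo).contDiffAt_symm (f₀' := g') hx ?_ h1.contDiffAt
    rw [hg']
    exact h1.differentiableAt.hasFDerivAt

theorem linEval_single {m : ℕ} (β : Fin m → ℤ) (j : Fin m) : linEval β (Pi.single j 1) = β j := by
  unfold linEval
  rw [Finset.sum_eq_single j (fun k _ hk => by rw [Pi.single_eq_of_ne hk, zero_mul])
    (fun h => absurd (Finset.mem_univ j) h), Pi.single_eq_same, one_mul]

/-! ### A strictly monotone system of equations -/

section Retract

variable {m : ℕ} {ι : Type}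

/-- The weights `s i * exp (2 α i · u)`. -/
def weight (α : ι → Fin m → ℤ) (s : ι → ℝ) (u : Fin m → ℝ) (i : ι) : ℝ :=
  s i * Real.exp (2 * linEval (α i) u)

theorem continuous_weight (α : ι → Fin m → ℤ) (s : ι → ℝ) (i : ι) :
    Continuous fun u => weight α s u i := by
  unfold weight linEval
  fun_prop

variable [Fintype ι]

/-- The strictly monotone vector field `u + ∑ i, w i / (1 - w i) α i`. -/
def weightField (α : ι → Fin m → ℤ) (s : ι → ℝ) (u : Fin m → ℝ) (j : Fin m) : ℝ :=
  u j + ∑ i, (α i j : ℝ) * (weight α s u i / (1 - weight α s u i))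

variable {α : ι → Fin m → ℤ} {s : ι → ℝ}

theorem div_one_sub_le {a b : ℝ} (hab : a ≤ b) (hb : b < 1) : a / (1 - a) ≤ b / (1 - b) := by
  rw [div_le_div_iff₀ (by linarith) (by linarith)]
  nlinarith

/-- Each weight increases with α i · u, and t ↦ t/(1 - t) is increasing below 1. Every summand thus
contributes nonnegatively, and the identity term contributes |u - v|². -/
theorem weightField_monotone (hs : ∀ i, 0 ≤ s i) {u v : Fin m → ℝ}
    (hu : ∀ i, weight α s u i < 1) (hv : ∀ i, weight α s v i < 1) :
    ∑ j, (u j - v j) ^ 2 ≤ ∑ j, (u j - v j) * (weightField α s u j - weightField α s v j) := by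
  have h1 : ∑ j, (u j - v j) * (weightField α s u j - weightField α s v j) =
      ∑ j, (u j - v j) ^ 2 + ∑ i, (linEval (α i) u - linEval (α i) v) *
        (weight α s u i / (1 - weight α s u i) - weight α s v i / (1 - weight α s v i)) := by
    have h2 : ∀ j, (u j - v j) * (weightField α s u j - weightField α s v j) = (u j - v j) ^ 2 +
        ∑ i, (u j - v j) * (α i j : ℝ) *
          (weight α s u i / (1 - weight α s u i) - weight α s v i / (1 - weight α s v i)) := by
      intro j
      have h3 : weightField α s u j - weightField α s v j = (u j - v j) + ∑ i, (α i j : ℝ) *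
          (weight α s u i / (1 - weight α s u i) - weight α s v i / (1 - weight α s v i)) := by
        simp only [weightField, mul_sub, Finset.sum_sub_distrib]
        ring
      rw [h3, mul_add, Finset.mul_sum, ← sq]
      simp only [mul_assoc]
    simp only [h2]
    rw [Finset.sum_add_distrib, Finset.sum_comm]
    congr 1
    refine Finset.sum_congr rfl fun i _ => ?_
    rw [← Finset.sum_mul, ← linEval_sub_right]
    rfl
  rw [h1]
  refine le_add_of_nonneg_right (Finset.sum_nonneg fun i _ => ?_)
  have key : ∀ u v : Fin m → ℝ, (∀ i, weight α s u i < 1) → linEval (α i) v ≤ linEval (α i) u →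
      weight α s v i / (1 - weight α s v i) ≤ weight α s u i / (1 - weight α s u i) := by
    intro u v hu h
    refine div_one_sub_le ?_ (hu i)
    exact mul_le_mul_of_nonneg_left (Real.exp_le_exp.2 (by linarith)) (hs i)
  rcases le_total (linEval (α i) v) (linEval (α i) u) with h | h
  · exact mul_nonneg (sub_nonneg.2 h) (sub_nonneg.2 (key u v hu h))
  · exact mul_nonneg_of_nonpos_of_nonpos (sub_nonpos.2 h) (sub_nonpos.2 (key v u hv h))

theorem weightField_injective (hs : ∀ i, 0 ≤ s i) {u v : Fin m → ℝ}
    (hu : ∀ i, weight α s u i < 1) (hv : ∀ i, weight α s v i < 1)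
    (h : weightField α s u = weightField α s v) : u = v := by
  have h1 := weightField_monotone hs hu hv
  rw [h] at h1
  simp only [sub_self, mul_zero, Finset.sum_const_zero] at h1
  funext j
  have h2 := (Finset.sum_eq_zero_iff_of_nonneg (fun j _ => sq_nonneg (u j - v j))).1
    (le_antisymm h1 (Finset.sum_nonneg fun j _ => sq_nonneg _)) j (Finset.mem_univ j)
  exact sub_eq_zero.1 (pow_eq_zero_iff two_ne_zero |>.1 h2)

/-- The field is half the gradient of the barrier function |u|² - ∑ log(1 - w_i), which blows up
when |u| → ∞ or some w_i → 1; a minimum of it is the required zero. -/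
theorem exists_weightField_eq_zero (hs : ∀ i, 0 ≤ s i) {u₀ : Fin m → ℝ}
    (hu₀ : ∀ i, weight α s u₀ i < 1) :
    ∃ u, (∀ i, weight α s u i < 1) ∧ weightField α s u = 0 := by
  classical
  let Φ : (Fin m → ℝ) → ℝ := fun u => (∑ j, u j ^ 2) - ∑ i, Real.log (1 - weight α s u i)
  have hw0 : ∀ u i, 0 ≤ weight α s u i := fun u i => mul_nonneg (hs i) (Real.exp_pos _).le
  have hlog : ∀ u, (∀ i, weight α s u i < 1) → ∀ i, 0 ≤ -Real.log (1 - weight α s u i) := by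
    intro u hu i
    have := Real.log_nonpos (sub_nonneg.2 (hu i).le) (by linarith [hw0 u i])
    linarith
  -- All terms of `Φ` are nonnegative while the weights are below 1, so each is bounded by `Φ u₀` on
  -- the sublevel set. `C` records these bounds; in particular it keeps the weights away from 1,
  -- where the totalised logarithm would lose its meaning.
  let C : Set (Fin m → ℝ) := {u | (∀ j, u j ^ 2 ≤ Φ u₀) ∧ ∀ i, weight α s u i ≤ 1 - Real.exp (-Φ u₀)}
  have hC1 : ∀ u ∈ C, ∀ i, weight α s u i < 1 := fun u hu i =>
    (hu.2 i).trans_lt (by linarith [Real.exp_pos (-Φ u₀)])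
  have hin : ∀ u, (∀ i, weight α s u i < 1) → Φ u ≤ Φ u₀ → u ∈ C := by
    intro u hu hle
    have h1 : ∀ j, u j ^ 2 ≤ ∑ j, u j ^ 2 := fun j =>
      Finset.single_le_sum (f := fun j => u j ^ 2) (fun _ _ => sq_nonneg _) (Finset.mem_univ j)
    have h2 : ∀ i, -Real.log (1 - weight α s u i) ≤ ∑ i, -Real.log (1 - weight α s u i) := fun i =>
      Finset.single_le_sum (f := fun i => -Real.log (1 - weight α s u i))
        (fun i _ => hlog u hu i) (Finset.mem_univ i)
    have h3 : Φ u = (∑ j, u j ^ 2) + ∑ i, -Real.log (1 - weight α s u i) := by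
      rw [Finset.sum_neg_distrib, ← sub_eq_add_neg]
    have h4 : 0 ≤ ∑ j, u j ^ 2 := Finset.sum_nonneg fun _ _ => sq_nonneg _
    have h5 : 0 ≤ ∑ i, -Real.log (1 - weight α s u i) := Finset.sum_nonneg fun i _ => hlog u hu i
    refine ⟨fun j => by linarith [h1 j], fun i => ?_⟩
    have h6 : -Φ u₀ ≤ Real.log (1 - weight α s u i) := by linarith [h2 i]
    have h7 := (Real.le_log_iff_exp_le (by linarith [hu i])).1 h6
    linarith
  have hCc : IsCompact C := by
    refine Metric.isCompact_of_isClosed_isBounded ?_ ?_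
    · have h1 : IsClosed {u : Fin m → ℝ | ∀ j, u j ^ 2 ≤ Φ u₀} := by
        simp only [Set.ofPred_forall]
        exact isClosed_iInter fun j => isClosed_le (by fun_prop) continuous_const
      have h2 : IsClosed {u : Fin m → ℝ | ∀ i, weight α s u i ≤ 1 - Real.exp (-Φ u₀)} := by
        simp only [Set.ofPred_forall]
        exact isClosed_iInter fun i => isClosed_le (continuous_weight α s i) continuous_const
      exact h1.inter h2
    · refine (Metric.isBounded_closedBall (x := (0 : Fin m → ℝ)) (r := √(Φ u₀))).subset ?_
      intro u hu
      rw [mem_closedBall_zero_iff, pi_norm_le_iff_of_nonneg (Real.sqrt_nonneg _)]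
      exact fun j => Real.abs_le_sqrt (hu.1 j)
  have hΦc : ContinuousOn Φ C := by
    refine ContinuousOn.sub (by fun_prop) (continuousOn_finsetSum _ fun i _ => ?_)
    refine ContinuousOn.log ((continuous_const.sub (continuous_weight α s i)).continuousOn) ?_
    exact fun u hu => (sub_pos.2 (hC1 u hu i)).ne'
  obtain ⟨u, huC, hmin⟩ := hCc.exists_isMinOn ⟨u₀, hin u₀ hu₀ le_rfl⟩ hΦc
  have hu := hC1 u huC
  refine ⟨u, hu, funext fun j => ?_⟩
  have hopen : ∀ᶠ v in 𝓝 u, ∀ i, weight α s v i < 1 :=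
    eventually_all.2 fun i => (continuous_weight α s i).continuousAt.eventually_lt
      continuousAt_const (hu i)
  -- Minimality is known only on `C`, but a nearby point outside `C` still has weights below 1, so
  -- its value exceeds `Φ u₀`.
  have hloc : IsLocalMin Φ u := by
    filter_upwards [hopen] with v hv
    by_cases hvC : v ∈ C
    · exact hmin hvC
    · have h1 : Φ u ≤ Φ u₀ := hmin (hin u₀ hu₀ le_rfl)
      exact h1.trans (not_le.1 fun h => hvC (hin v hv h)).le
  let γ : ℝ → Fin m → ℝ := fun r => u + r • Pi.single j 1
  have hγ0 : γ 0 = u := by simp [γ]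
  have hγc : Continuous γ := by fun_prop
  have hloc' : IsLocalMin (Φ ∘ γ) 0 :=
    IsLocalMin.comp_continuous (by rw [hγ0]; exact hloc) hγc.continuousAt
  have hwd : ∀ i, HasDerivAt (fun r => weight α s (γ r) i) (2 * α i j * weight α s u i) 0 := by
    intro i
    have h1 : ∀ r, weight α s (γ r) i =
        s i * Real.exp (2 * (linEval (α i) u + r * (α i j : ℝ))) := by
      intro r
      rw [weight, linEval_add_right, linEval_smul_right, linEval_single]
    simp only [h1]
    have h2 : HasDerivAt (fun r : ℝ => 2 * (linEval (α i) u + r * (α i j : ℝ))) (2 * α i j) 0 := by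
      have := (((hasDerivAt_id (0 : ℝ)).mul_const (α i j : ℝ)).const_add
        (linEval (α i) u)).const_mul 2
      simpa using this
    have h3 := (h2.exp).const_mul (s i)
    refine h3.congr_deriv ?_
    simp only [weight, zero_mul, add_zero]
    ring
  have hd : HasDerivAt (Φ ∘ γ) (2 * u j - ∑ i, -(2 * α i j * weight α s u i) /
      (1 - weight α s u i)) 0 := by
    refine HasDerivAt.sub ?_ ?_
    · have h1 : ∀ k, HasDerivAt (fun r => γ r k ^ 2) (2 * u k * (Pi.single j 1 : Fin m → ℝ) k) 0 := by
        intro k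
        have h2 : HasDerivAt (fun r => γ r k) ((Pi.single j 1 : Fin m → ℝ) k) 0 := by
          have := ((hasDerivAt_id (0 : ℝ)).mul_const ((Pi.single j 1 : Fin m → ℝ) k)).const_add (u k)
          simpa [γ] using this
        have h3 := h2.fun_pow 2
        simp only [hγ0] at h3
        refine h3.congr_deriv ?_
        norm_num
      have h2 := HasDerivAt.fun_sum (u := Finset.univ) fun k _ => h1 k
      convert h2 using 1
      rw [Finset.sum_eq_single j (fun k _ hk => by rw [Pi.single_eq_of_ne hk, mul_zero])
        (fun h => absurd (Finset.mem_univ j) h), Pi.single_eq_same, mul_one]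
    · refine HasDerivAt.fun_sum fun i _ => ?_
      have h1 := ((hwd i).const_sub 1).log (by rw [hγ0]; exact (sub_pos.2 (hu i)).ne')
      rw [hγ0] at h1
      exact h1
  have h0 := hloc'.hasDerivAt_eq_zero hd
  have h2 : ∑ i, -(2 * α i j * weight α s u i) / (1 - weight α s u i) =
      -2 * ∑ i, (α i j : ℝ) * (weight α s u i / (1 - weight α s u i)) := by
    rw [Finset.mul_sum]
    refine Finset.sum_congr rfl fun i _ => ?_
    ring
  rw [h2] at h0
  change u j + _ = 0
  linarith

theorem smoothNear_weightField {s : ι → ℝ} {u : Fin m → ℝ} (hu : ∀ i, weight α s u i < 1) :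
    SmoothNear (fun y : (Fin m → ℝ) × (ι → ℝ) => weightField α y.2 y.1) (u, s) := by
  have hw : ∀ i, ContDiff ℝ ∞ fun y : (Fin m → ℝ) × (ι → ℝ) => weight α y.2 y.1 i := by
    intro i
    unfold weight linEval
    fun_prop
  have hev : ∀ᶠ y : (Fin m → ℝ) × (ι → ℝ) in 𝓝 (u, s), ∀ i, weight α y.2 y.1 i < 1 :=
    eventually_all.2 fun i => (hw i).continuous.continuousAt.eventually_lt continuousAt_const (hu i)
  filter_upwards [hev] with y hy
  rw [contDiffAt_pi]
  intro j
  unfold weightField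
  refine ContDiffAt.add (by fun_prop) (ContDiffAt.sum fun i _ => ?_)
  exact contDiffAt_const.mul ((hw i).contDiffAt.div (contDiffAt_const.sub (hw i).contDiffAt)
    (sub_pos.2 (hy i)).ne')

/-- The zero of `weightField` depends smoothly on the parameters. -/
theorem exists_smooth_weightField_zero (hs : ∀ i, 0 ≤ s i) {u : Fin m → ℝ}
    (hu : ∀ i, weight α s u i < 1) (h0 : weightField α s u = 0) :
    ∃ U : (ι → ℝ) → Fin m → ℝ, SmoothNear U s ∧ U s = u ∧ ∀ᶠ s' in 𝓝 s,
      (∀ i, weight α s' (U s') i < 1) ∧ weightField α s' (U s') = 0 := by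
  let Φ : (Fin m → ℝ) × (ι → ℝ) → (Fin m → ℝ) × (ι → ℝ) := fun y => (weightField α y.2 y.1, y.2)
  have hΦ : SmoothNear Φ (u, s) :=
    (smoothNear_weightField hu).prodMk (ContDiff.smoothNear (by fun_prop) _)
  have hev : ∀ᶠ y : (Fin m → ℝ) × (ι → ℝ) in 𝓝 (u, s), ∀ i, weight α y.2 y.1 i < 1 := by
    refine eventually_all.2 fun i => ContinuousAt.eventually_lt ?_ continuousAt_const (hu i)
    refine Continuous.continuousAt ?_
    unfold weight linEval
    fun_prop
  -- The parameter is a component of `Φ`, so a kernel vector has the form (v, 0). The monotonicity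
  -- estimate divided by r², as r → 0, gives |v|² ≤ 0.
  have hinj : Function.Injective (fderiv ℝ Φ (u, s)) := by
    rw [injective_iff_map_eq_zero]
    rintro ⟨v, w⟩ hvw
    let γ : ℝ → (Fin m → ℝ) × (ι → ℝ) := fun r => (u, s) + r • (v, w)
    have hγ : HasDerivAt γ (v, w) 0 := by
      have := ((hasDerivAt_id (0 : ℝ)).smul_const (v, w)).const_add (u, s)
      rwa [one_smul] at this
    have hγ0 : γ 0 = (u, s) := by simp [γ]
    have hd : HasDerivAt (fun r => Φ (γ r)) 0 0 := by
      have h1 : HasFDerivAt Φ (fderiv ℝ Φ (u, s)) (γ 0) := by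
        rw [hγ0]
        exact hΦ.differentiableAt.hasFDerivAt
      have := h1.comp_hasDerivAt (0 : ℝ) hγ
      rwa [hvw] at this
    have hw : w = 0 := by
      have h1 : HasDerivAt (fun r => (Φ (γ r)).2) 0 0 := hd.snd
      have h2 : HasDerivAt (fun r => (γ r).2) w 0 := hγ.snd
      exact h2.unique h1
    subst hw
    have h1 : HasDerivAt (fun r : ℝ => ∑ j, v j * (weightField α s (u + r • v) j)) 0 0 := by
      have h2 : ∀ j, HasDerivAt (fun r : ℝ => weightField α s (u + r • v) j) 0 0 := by
        intro j
        have h3 : HasDerivAt (fun r => (Φ (γ r)).1) 0 0 := hd.fst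
        have h4 := hasDerivAt_pi.1 h3 j
        have h5 : ∀ r, (Φ (γ r)).1 j = weightField α s (u + r • v) j := by
          intro r
          simp [Φ, γ]
        simp only [h5] at h4
        exact h4
      have h3 := HasDerivAt.fun_sum (u := Finset.univ) fun j _ => (h2 j).const_mul (v j)
      simpa using h3
    have hev' : ∀ᶠ r in 𝓝[>] (0 : ℝ), ∀ i, weight α s (u + r • v) i < 1 := by
      have hc : Tendsto γ (𝓝[>] 0) (𝓝 (u, s)) := by
        rw [← hγ0]
        exact hγ.continuousAt.tendsto.mono_left nhdsWithin_le_nhds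
      filter_upwards [hc.eventually hev] with r hr
      simpa [γ] using hr
    have h2 : ∑ j, v j ^ 2 ≤ 0 := by
      refine ge_of_tendsto h1.tendsto_slope_zero_right ?_
      filter_upwards [hev', self_mem_nhdsWithin] with r hr (hr0 : 0 < r)
      have h3 := weightField_monotone hs hr hu
      simp only [Pi.add_apply, Pi.smul_apply, add_sub_cancel_left, smul_eq_mul, zero_smul, h0,
        zero_add, add_zero, Pi.zero_apply, mul_zero, sub_zero, Finset.sum_const_zero] at h3 ⊢
      simp only [mul_pow, mul_assoc] at h3
      rw [← Finset.mul_sum, ← Finset.mul_sum, sq, mul_assoc] at h3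
      have h4 := le_of_mul_le_mul_left h3 hr0
      rw [inv_mul_eq_div, le_div_iff₀ hr0, mul_comm]
      exact h4
    have h3 : v = 0 := by
      funext j
      have h4 := (Finset.sum_eq_zero_iff_of_nonneg (fun j _ => sq_nonneg (v j))).1
        (le_antisymm h2 (Finset.sum_nonneg fun j _ => sq_nonneg _)) j (Finset.mem_univ j)
      exact pow_eq_zero_iff two_ne_zero |>.1 h4
    rw [h3]
    rfl
  obtain ⟨e, hmem, heΦ, -, he⟩ := hΦ.exists_localInverse hinj
  have hΦa : Φ (u, s) = (0, s) := by simp [Φ, h0]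
  have h0s : (0, s) ∈ e.target := by
    rw [← hΦa, ← heΦ]
    exact e.map_source hmem
  have hesymm : e.symm (0, s) = (u, s) := by
    rw [← hΦa, ← heΦ]
    exact e.left_inv hmem
  have hU : SmoothNear (fun s' : ι → ℝ => e.symm ((0 : Fin m → ℝ), s')) s :=
    SmoothNear.comp (k := fun s' : ι → ℝ => ((0 : Fin m → ℝ), s')) (he _ h0s)
      (ContDiff.smoothNear (by fun_prop) _)
  refine ⟨fun s' => (e.symm (0, s')).1, SmoothNear.comp (h := Prod.fst)
    (ContDiff.smoothNear contDiff_fst _) hU, congrArg Prod.fst hesymm, ?_⟩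
  have hc : Tendsto (fun s' : ι → ℝ => e.symm ((0 : Fin m → ℝ), s')) (𝓝 s) (𝓝 (u, s)) := by
    rw [← hesymm]
    exact hU.continuousAt.tendsto
  have ht : ∀ᶠ s' : ι → ℝ in 𝓝 s, ((0 : Fin m → ℝ), s') ∈ e.target :=
    ContinuousAt.tendsto (f := fun s' : ι → ℝ => ((0 : Fin m → ℝ), s'))
      (Continuous.continuousAt (by fun_prop)) |>.eventually (e.open_target.mem_nhds h0s)
  filter_upwards [ht, hc.eventually hev] with s' h1 h2
  have h3 : Φ (e.symm (0, s')) = (0, s') := by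
    rw [← heΦ]
    exact e.right_inv h1
  have h4 : (e.symm (0, s')).2 = s' := congrArg Prod.snd h3
  have h5 : weightField α (e.symm (0, s')).2 (e.symm (0, s')).1 = 0 := congrArg Prod.fst h3
  rw [h4] at h2 h5
  exact ⟨h2, h5⟩

end Retract

/-! ### Shrinking the real coordinates -/

/-- A diffeomorphism from `ℝ` to `(-ε, ε)`. -/
def squeeze (ε t : ℝ) : ℝ := ε * t / √(1 + t ^ 2)

/-- The inverse of `squeeze ε`. -/
def unsqueeze (ε w : ℝ) : ℝ := w / √(ε ^ 2 - w ^ 2)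

theorem squeeze_eq_zero_iff {ε : ℝ} (hε : 0 < ε) {t : ℝ} : squeeze ε t = 0 ↔ t = 0 := by
  have : √(1 + t ^ 2) ≠ 0 := (Real.sqrt_pos.2 (by positivity)).ne'
  rw [squeeze, div_eq_zero_iff, or_iff_left this, mul_eq_zero, or_iff_right hε.ne']

theorem squeeze_sq (ε t : ℝ) : squeeze ε t ^ 2 = ε ^ 2 - ε ^ 2 / (1 + t ^ 2) := by
  rw [squeeze, div_pow, Real.sq_sqrt (by positivity)]
  field_simp
  ring

theorem abs_squeeze_lt {ε : ℝ} (hε : 0 < ε) (t : ℝ) : |squeeze ε t| < ε := by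
  refine abs_lt_of_sq_lt_sq ?_ hε.le
  rw [squeeze_sq]
  have : 0 < ε ^ 2 / (1 + t ^ 2) := by positivity
  linarith

theorem unsqueeze_squeeze {ε : ℝ} (hε : 0 < ε) (t : ℝ) : unsqueeze ε (squeeze ε t) = t := by
  have h : 0 < √(1 + t ^ 2) := Real.sqrt_pos.2 (by positivity)
  rw [unsqueeze, squeeze_sq, sub_sub_cancel, Real.sqrt_div (by positivity), Real.sqrt_sq hε.le,
    squeeze]
  field_simp

theorem squeeze_unsqueeze {ε : ℝ} (hε : 0 < ε) {w : ℝ} (hw : |w| < ε) :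
    squeeze ε (unsqueeze ε w) = w := by
  have h0 : 0 < ε ^ 2 - w ^ 2 := sub_pos.2 (sq_lt_sq.2 (by rwa [abs_of_pos hε]))
  have h : 0 < √(ε ^ 2 - w ^ 2) := Real.sqrt_pos.2 h0
  have h1 : 1 + unsqueeze ε w ^ 2 = ε ^ 2 / (ε ^ 2 - w ^ 2) := by
    rw [unsqueeze, div_pow, Real.sq_sqrt h0.le]
    field_simp
    ring
  rw [squeeze, h1, Real.sqrt_div (by positivity), Real.sqrt_sq hε.le, unsqueeze]
  field_simp

theorem contDiff_squeeze (ε : ℝ) : ContDiff ℝ ∞ (squeeze ε) := by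
  unfold squeeze
  refine ContDiff.div (by fun_prop) (ContDiff.sqrt (by fun_prop) fun t => ?_) fun t => ?_
  · positivity
  · exact (Real.sqrt_pos.2 (by positivity)).ne'

theorem smoothNear_unsqueeze {ε w : ℝ} (hε : 0 < ε) (hw : |w| < ε) :
    SmoothNear (unsqueeze ε) w := by
  have h1 : ∀ᶠ w' in 𝓝 w, |w'| < ε :=
    continuous_abs.continuousAt.eventually_lt continuousAt_const hw
  filter_upwards [h1] with w' hw'
  have h0 : 0 < ε ^ 2 - w' ^ 2 := sub_pos.2 (sq_lt_sq.2 (by rwa [abs_of_pos hε]))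
  exact ContDiffAt.div (by fun_prop) (ContDiffAt.sqrt (by fun_prop) h0.ne')
    (Real.sqrt_pos.2 h0).ne'

/-! ### Multiplication by positive reals -/

section Twist

variable {m : ℕ}

/-- Multiplication of the coordinates by `exp u`. -/
def twist (u : Fin m → ℝ) (z : Fin m → ExplUnit) : Fin m → ExplUnit := fun j =>
  ExplUnit.ofComplex (Real.exp (u j) : ℝ) * z j

theorem ofReal_exp_ne_zero (x : ℝ) : ((Real.exp x : ℝ) : ℂ) ≠ 0 := by
  exact_mod_cast (Real.exp_pos x).ne'

@[simp] theorem trop_twist (u : Fin m → ℝ) (z : Fin m → ExplUnit) (j : Fin m) :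
    (twist u z j).trop = (z j).trop := by
  simp [twist]

theorem twist_twist (u v : Fin m → ℝ) (z : Fin m → ExplUnit) :
    twist u (twist v z) = twist (u + v) z := by
  funext j
  rw [twist, twist, twist, ← mul_assoc,
    ← ExplodedSpace.ofComplex_mul (ofReal_exp_ne_zero _) (ofReal_exp_ne_zero _), ← Complex.ofReal_mul,
    ← Real.exp_add]
  rfl

theorem twist_zero (z : Fin m → ExplUnit) : twist 0 z = z := by
  funext j
  simp only [twist, Pi.zero_apply, Real.exp_zero, Complex.ofReal_one]
  rw [ExplUnit.ofComplex_of_ne_zero one_ne_zero]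
  ext <;> simp

theorem smoothPart_monomial_twist (c : ℝ × (Fin m → ℤ)) (u : Fin m → ℝ) (z : Fin m → ExplUnit) :
    (monomial c (twist u z)).smoothPart =
      (Real.exp (linEval c.2 u) : ℝ) * (monomial c z).smoothPart := by
  have h1 : (monomial c (twist u z)).trop = (monomial c z).trop := by
    simp [trop_monomial]
  have h2 : ((monomial c (twist u z)).1 : ℂ) =
      (Real.exp (linEval c.2 u) : ℝ) * (monomial c z).1 := by
    rw [coeff_monomial, coeff_monomial, ← prod_exp_zpow]
    simp only [twist, Prod.fst_mul, mul_zpow, Finset.prod_mul_distrib, Units.val_mul,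
      Units.coe_prod, Units.val_zpow_eq_zpow_val, ExplUnit.coeff_ofComplex (ofReal_exp_ne_zero _)]
  by_cases h : (monomial c z).trop = 0
  · rw [ExplUnit.smoothPart_of_trop_eq_zero h, ExplUnit.smoothPart_of_trop_eq_zero (h1.trans h), h2]
  · rw [ExplUnit.smoothPart_of_trop_ne_zero h,
      ExplUnit.smoothPart_of_trop_ne_zero (h1.trans_ne h), mul_zero]

end Twist

/-! ### Open copies of a model inside a neighbourhood, and straightening of functions. -/

namespace Model

variable {n m : ℕ} {P : Set (Fin m → ℝ)}

theorem eq_zero_of_affEval_eq_zero {y : Fin m → ℝ} (hy : y ∈ interior P) (c : NonnegMonomial P)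
    (h0 : affEval c.1 y = 0) : c.1 = 0 := by
  have h1 : ∀ v, 0 ≤ linEval c.1.2 v := by
    intro v
    have h2 : ∀ᶠ r : ℝ in 𝓝[>] 0, y + r • v ∈ P := by
      have h3 : Tendsto (fun r : ℝ => y + r • v) (𝓝[>] 0) (𝓝 y) := by
        have : Continuous fun r : ℝ => y + r • v := by fun_prop
        have h4 := this.tendsto 0
        simp only [zero_smul, add_zero] at h4
        exact h4.mono_left nhdsWithin_le_nhds
      exact h3 (mem_interior_iff_mem_nhds.1 hy)
    obtain ⟨r, hr, hr0 : 0 < r⟩ := (h2.and self_mem_nhdsWithin).exists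
    have h3 := c.2 _ hr
    rw [affEval_add_smul, h0, zero_add] at h3
    exact nonneg_of_mul_nonneg_right h3 hr0
  have h2 : c.1.2 = 0 := by
    funext j
    have h3 := h1 (Pi.single j 1)
    have h4 := h1 ((-1 : ℝ) • Pi.single j 1)
    rw [linEval_smul_right, linEval_single] at h4
    rw [linEval_single] at h3
    have : (c.1.2 j : ℝ) = 0 := by linarith
    exact_mod_cast this
  refine Prod.ext ?_ h2
  rw [affEval_eq, h2] at h0
  simpa [linEval] using h0

/-- A nonnegative affine function on `P` that vanishes at an interior point is identically zero.
This is the advantage of centring charts over the interior: no smooth monomial has a first-order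
variation along a curve through the centre. -/
theorem zeta_eq_zero_or_eq_one {p : Model n m P} (hp : p.trop ∈ interior P)
    (c : NonnegMonomial P) : (0 < affEval c.1 p.trop ∧ zeta c p = 0) ∨ ∀ q : Model n m P, zeta c q = 1 := by
  rcases (c.2 _ p.mem).lt_or_eq with h | h
  · exact .inl ⟨h, ExplUnit.smoothPart_of_trop_ne_zero (by rw [trop_monomial]; exact h.ne')⟩
  · refine .inr fun q => ?_
    rw [zeta, eq_zero_of_affEval_eq_zero hp c h.symm, monomial_zero, ExplUnit.smoothPart_one]

/-- A neighbourhood basis at a point with tropical part in the interior of `P`. -/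
theorem exists_small_subset {p : Model n m P} (hp : p.trop ∈ interior P) {Ω : Set (Model n m P)}
    (hΩ : Ω ∈ 𝓝 p) : ∃ (I : Finset (NonnegMonomial P)) (ε : ℝ), 0 < ε ∧
      (∀ c ∈ I, 0 < affEval c.1 p.trop) ∧
      ∀ q : Model n m P, (∀ i, |q.x i - p.x i| < ε) → (∀ c ∈ I, ‖zeta c q‖ < ε) → q ∈ Ω := by
  classical
  rw [isInducing_coords.nhds_eq_comap] at hΩ
  obtain ⟨W, hW, hWΩ⟩ := mem_comap.1 hΩ
  obtain ⟨A, hA, T, hT, hAT⟩ := mem_nhds_prod_iff.1 hW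
  rw [nhds_pi] at hT
  obtain ⟨I, hI, t, ht, hIt⟩ := mem_pi.1 hT
  have h1 : ∀ᶠ ε in 𝓝[>] (0 : ℝ), Metric.ball p.x ε ⊆ A := by
    obtain ⟨r, hr, hrA⟩ := Metric.mem_nhds_iff.1 hA
    filter_upwards [Ioo_mem_nhdsGT hr] with ε hε
    exact (Metric.ball_subset_ball hε.2.le).trans hrA
  have h2 : ∀ᶠ ε in 𝓝[>] (0 : ℝ), ∀ c ∈ I, Metric.ball (zeta c p) ε ⊆ t c := by
    refine (eventually_all_finite hI).2 fun c _ => ?_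
    obtain ⟨r, hr, hrA⟩ := Metric.mem_nhds_iff.1 (ht c)
    filter_upwards [Ioo_mem_nhdsGT hr] with ε hε
    exact (Metric.ball_subset_ball hε.2.le).trans hrA
  obtain ⟨ε, ⟨h3, h4⟩, hε : 0 < ε⟩ := ((h1.and h2).and self_mem_nhdsWithin).exists
  refine ⟨hI.toFinset.filter fun c => 0 < affEval c.1 p.trop, ε, hε,
    fun c hc => (Finset.mem_filter.1 hc).2, fun q hx hz => hWΩ (hAT ⟨h3 ?_, hIt fun c hc => h4 c hc ?_⟩)⟩
  · rw [Metric.mem_ball, dist_pi_lt_iff hε]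
    exact hx
  · rw [Metric.mem_ball, dist_eq_norm]
    rcases zeta_eq_zero_or_eq_one hp c with ⟨h5, h6⟩ | h5
    · dsimp only
      rw [h6, sub_zero]
      exact hz c (Finset.mem_filter.2 ⟨hI.mem_toFinset.2 hc, h5⟩)
    · dsimp only
      rw [h5, h5, sub_self, norm_zero]
      exact hε

open ExplodedSpace in
/-- Every neighbourhood of a point in the open stratum contains an open neighbourhood that is
isomorphic to the whole space. -/
theorem exists_isOpenIso_subset (hP : IsIntegralAffinePolytope P) {p : Model n m P}
    (hp : p.trop ∈ interior P) (hpx : p.x = 0) {Ω : Set (Model n m P)} (hΩ : Ω ∈ 𝓝 p) :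
    ∃ Θ : Model n m P → Model n m P, (space n m P).IsOpenIso (space n m P) Θ ∧
      Set.range Θ ⊆ Ω ∧ p ∈ Set.range Θ ∧ ∀ q i, (Θ q).x i = 0 ↔ q.x i = 0 := by
  classical
  obtain ⟨I, ε, hε, hI, hIΩ⟩ := exists_small_subset hp hΩ
  let J := Fin I.card
  let c : J → NonnegMonomial P := fun i => (I.equivFin.symm i).1
  have hcI : ∀ d ∈ I, ∃ i, c i = d := fun d hd => ⟨I.equivFin ⟨d, hd⟩, by simp [c]⟩
  have hc : ∀ i, 0 < affEval (c i).1 p.trop := fun i => hI _ (I.equivFin.symm i).2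
  let α : J → Fin m → ℤ := fun i => (c i).1.2
  -- The target is the open set where |x_i| < ε and all these squared ratios are below 1. Squares
  -- make them smooth functions of the monomials.
  let S : Model n m P → J → ℝ := fun q i => ‖zeta (c i) q‖ ^ 2 / ε ^ 2
  have hS0 : ∀ q i, 0 ≤ S q i := fun q i => by positivity
  have hSsmooth : ∀ q, SmoothFormAt q S := by
    intro q
    refine smoothFormAt_pi fun i => ?_
    refine (smoothFormAt_zeta q (c i)).comp (k := fun w : ℂ => ‖w‖ ^ 2 / ε ^ 2) ?_
    exact ContDiff.smoothNear ((contDiff_norm_sq ℝ).div_const _) _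
  -- Each `c i` is positive at the centre, and it is zero at `q` if its smooth part there does not
  -- vanish. So α i increases from `q` to the centre, and moving far in the opposite direction makes
  -- the corresponding weights as small as desired.
  have hadm : ∀ q, ∃ u, ∀ i, weight α (S q) u i < 1 := by
    intro q
    let v := p.trop - q.trop
    have h1 : ∀ i, ∀ᶠ r : ℝ in atTop, weight α (S q) ((-r) • v) i < 1 := by
      intro i
      by_cases hz : zeta (c i) q = 0
      · refine Eventually.of_forall fun r => ?_
        simp [weight, S, hz]
      · have h2 := zeta_ne_zero_iff.1 hz
        have h3 : 0 < linEval (α i) v := by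
          have h4 := hc i
          rw [affEval_eq] at h2 h4
          rw [linEval_sub_right]
          change 0 < linEval (c i).1.2 p.trop - linEval (c i).1.2 q.trop
          linarith
        have h4 : Tendsto (fun r : ℝ => S q i * Real.exp (2 * (-r * linEval (α i) v))) atTop
            (𝓝 (S q i * 0)) := by
          refine (Real.tendsto_exp_atBot.comp ?_).const_mul _
          have h5 : ∀ r : ℝ, 2 * (-r * linEval (α i) v) = -((2 * linEval (α i) v) * r) := by
            intro r; ring
          simp only [h5]
          exact tendsto_neg_atTop_atBot.comp (tendsto_id.const_mul_atTop (by positivity))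
        rw [mul_zero] at h4
        filter_upwards [h4.eventually (gt_mem_nhds zero_lt_one)] with r hr
        rw [weight, linEval_smul_right]
        exact hr
    obtain ⟨r, hr⟩ := (eventually_all.2 h1).exists
    exact ⟨_, hr⟩
  have hex : ∀ s : J → ℝ, ((∀ i, 0 ≤ s i) ∧ ∃ u, ∀ i, weight α s u i < 1) →
      ∃ u, (∀ i, weight α s u i < 1) ∧ weightField α s u = 0 := by
    rintro s ⟨h1, u₀, h2⟩
    exact exists_weightField_eq_zero h1 h2
  choose! U hU1 hU0 using hex
  have hUq1 : ∀ q i, weight α (S q) (U (S q)) i < 1 := fun q => hU1 _ ⟨hS0 q, hadm q⟩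
  have hUq0 : ∀ q, weightField α (S q) (U (S q)) = 0 := fun q => hU0 _ ⟨hS0 q, hadm q⟩
  -- `U` is merely chosen, but zeros of the field are unique, so near `S q` it agrees on admissible
  -- parameters with the smooth solution of the implicit function theorem.
  have hUsmooth : ∀ q, SmoothFormAt q fun r => U (S r) := by
    intro q
    obtain ⟨V, hV, -, hV'⟩ := exists_smooth_weightField_zero (hS0 q) (hUq1 q) (hUq0 q)
    refine ((hSsmooth q).comp hV).congr ?_
    filter_upwards [(hSsmooth q).continuousAt.eventually hV'] with r hr
    exact weightField_injective (hS0 r) (hUq1 r) hr.1 ((hUq0 r).trans hr.2.symm)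
  -- the map and its inverse
  let Θ : Model n m P → Model n m P := fun q =>
    ⟨fun i => squeeze ε (q.x i), twist (U (S q)) q.z, by simp only [trop_twist]; exact q.mem⟩
  -- The inverse twist is explicit. The equation `weightField = 0` says precisely that the twist `U
  -- (S q)` is minus this expression evaluated at the image point.
  let K : Model n m P → Fin m → ℝ := fun q j => ∑ i, (α i j : ℝ) * (S q i / (1 - S q i))
  let η : Model n m P → Model n m P := fun q =>
    ⟨fun i => unsqueeze ε (q.x i), twist (K q) q.z, by simp only [trop_twist]; exact q.mem⟩
  have hStwist : ∀ (q : Model n m P) (x : Fin n → ℝ) (u : Fin m → ℝ)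
      (h : (fun i => (twist u q.z i).trop) ∈ P), S ⟨x, twist u q.z, h⟩ = weight α (S q) u := by
    intro q x u h
    funext i
    change ‖(monomial (c i).1 (twist u q.z)).smoothPart‖ ^ 2 / ε ^ 2 = _
    rw [smoothPart_monomial_twist, norm_mul, mul_pow, Complex.norm_real, Real.norm_eq_abs,
      Real.abs_exp, ← Real.exp_nat_mul, weight]
    change _ = ‖(monomial (c i).1 q.z).smoothPart‖ ^ 2 / ε ^ 2 * Real.exp (2 * linEval (c i).1.2 u)
    push_cast
    ring
  have hηΘ : ∀ q, η (Θ q) = q := by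
    intro q
    ext1
    · funext i
      exact unsqueeze_squeeze hε _
    · change twist (K (Θ q)) (twist (U (S q)) q.z) = q.z
      have h1 : K (Θ q) + U (S q) = 0 := by
        rw [← hUq0 q]
        funext j
        simp only [Pi.add_apply, K, weightField]
        rw [add_comm, hStwist]
      rw [twist_twist, h1, twist_zero]
  have hΘη : ∀ q : Model n m P, (∀ i, |q.x i| < ε) → (∀ i, S q i < 1) → Θ (η q) = q := by
    intro q hx hs
    have h1 : S (η q) = weight α (S q) (K q) := hStwist _ _ _ _
    have h2 : weight α (S (η q)) (-K q) = S q := by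
      funext i
      have h3 : linEval (α i) (-K q) = -linEval (α i) (K q) := by
        rw [← neg_one_smul ℝ, linEval_smul_right, neg_one_mul]
      rw [h1, weight, weight, h3, mul_assoc, ← Real.exp_add, mul_neg, add_neg_cancel, Real.exp_zero,
        mul_one]
    have h3 : U (S (η q)) = -K q := by
      refine weightField_injective (hS0 _) (hUq1 _) (by rw [h2]; exact hs) ((hUq0 _).trans ?_)
      funext j
      rw [weightField, h2]
      simp [K]
    ext1
    · funext i
      exact squeeze_unsqueeze hε (hx i)
    · change twist (U (S (η q))) (twist (K q) q.z) = q.z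
      rw [h3, twist_twist, neg_add_cancel, twist_zero]
  have hsecexp : ∀ (q : Model n m P) (w : Model n m P → Fin m → ℝ), SmoothFormAt q w → ∀ j,
      (space n m P).SecAt q fun r => twist (w r) r.z j := by
    intro q w hw j
    refine SecAt.mul (secAt_of_smoothFormAt (s := fun r => ((Real.exp (w r j) : ℝ) : ℂ)) ?_
      (ofReal_exp_ne_zero _)) (secAt_z q j)
    refine hw.comp (k := fun y : Fin m → ℝ => ((Real.exp (y j) : ℝ) : ℂ)) ?_
    exact ContDiff.smoothNear (Complex.ofRealCLM.contDiff.comp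
      (Real.contDiff_exp.comp (contDiff_apply ℝ ℝ j))) _
  have hΘm : ∀ q, MorphAt (space n m P) (space n m P) Θ q := by
    intro q
    refine morphAt_of_components (goodAt hP q) (SmoothFormAt.smoothFnAt ?_)
      fun j => hsecexp q _ (hUsmooth q) j
    refine (smoothFormAt_x q).comp (k := fun (x : Fin n → ℝ) i => squeeze ε (x i)) ?_
    exact ContDiff.smoothNear (contDiff_pi.2 fun i => (contDiff_squeeze ε).comp
      (contDiff_apply ℝ ℝ i)) _
  have hηm : ∀ q : Model n m P, (∀ i, |q.x i| < ε) → (∀ i, S q i < 1) →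
      MorphAt (space n m P) (space n m P) η q := by
    intro q hx hs
    refine morphAt_of_components (goodAt hP q) (SmoothFormAt.smoothFnAt ?_)
      fun j => hsecexp q K ?_ j
    · refine (smoothFormAt_x q).comp (k := fun (x : Fin n → ℝ) i => unsqueeze ε (x i)) ?_
      exact smoothNear_pi fun i => SmoothNear.comp (k := fun x : Fin n → ℝ => x i)
        (smoothNear_unsqueeze hε (hx i)) (ContDiff.smoothNear (by fun_prop) _)
    · refine (hSsmooth q).comp
        (k := fun (s : J → ℝ) j => ∑ i, (α i j : ℝ) * (s i / (1 - s i))) ?_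
      have hev : ∀ᶠ s in 𝓝 (S q), ∀ i, s i < 1 := eventually_all.2 fun i =>
        (continuous_apply i).continuousAt.eventually_lt continuousAt_const (hs i)
      filter_upwards [hev] with s hs'
      refine contDiffAt_pi.2 fun j => ContDiffAt.sum fun i _ => ?_
      exact contDiffAt_const.mul (ContDiffAt.div (by fun_prop) (by fun_prop)
        (sub_pos.2 (hs' i)).ne')
  have hΘx : ∀ q i, |(Θ q).x i| < ε := fun q i => abs_squeeze_lt hε _
  have hΘS : ∀ q i, S (Θ q) i < 1 := fun q i => by rw [hStwist]; exact hUq1 q i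
  have hopen : ∀ q : Model n m P, (∀ i, |q.x i| < ε) → (∀ i, S q i < 1) →
      ∀ᶠ r in 𝓝 q, (∀ i, |r.x i| < ε) ∧ ∀ i, S r i < 1 := by
    intro q hx hs
    refine (eventually_all.2 fun i => ?_).and (eventually_all.2 fun i => ?_)
    · have : Continuous fun r : Model n m P => |r.x i| :=
        ((continuous_apply i).comp continuous_x).abs
      exact this.continuousAt.eventually_lt continuousAt_const (hx i)
    · have : ContinuousAt (fun r => S r i) q :=
        (continuous_apply i).continuousAt.comp (hSsmooth q).continuousAt
      exact this.eventually_lt continuousAt_const (hs i)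
  refine ⟨Θ, isOpenIso_of_localIsoAt (Function.LeftInverse.injective hηΘ) fun q => ?_, ?_, ?_, ?_⟩
  · refine ⟨hΘm q, η, hηm _ (hΘx q) (hΘS q), hηΘ q, ?_, Eventually.of_forall hηΘ⟩
    filter_upwards [hopen _ (hΘx q) (hΘS q)] with r hr using hΘη r hr.1 hr.2
  · rintro _ ⟨q, rfl⟩
    refine hIΩ _ (fun i => ?_) fun d hd => ?_
    · rw [hpx, Pi.zero_apply, sub_zero]
      exact hΘx q i
    · obtain ⟨i, rfl⟩ := hcI d hd
      have h1 := hΘS q i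
      rw [div_lt_one (by positivity)] at h1
      exact lt_of_pow_lt_pow_left₀ 2 hε.le h1
  · refine ⟨η p, hΘη p (fun i => by simpa [hpx] using hε) fun i => ?_⟩
    have h1 : zeta (c i) p = 0 :=
      ExplUnit.smoothPart_of_trop_ne_zero (by rw [trop_monomial]; exact (hc i).ne')
    simp [S, h1]
  · exact fun q i => squeeze_eq_zero_iff hε

open ExplodedSpace in
/-- Straightening a smooth function whose derivative in the real directions is invertible. -/
theorem exists_isOpenIso_straighten (hP : IsIntegralAffinePolytope P) {p : Model n m P}
    (hp : p.trop ∈ interior P) {ι : Type} [Fintype ι] (ζ : ι → NonnegMonomial P)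
    {h : (Fin n → ℝ) × (ι → ℂ) → Fin n → ℝ} (hh : SmoothNear h (p.x, fun i => zeta (ζ i) p))
    (h0 : h (p.x, fun i => zeta (ζ i) p) = 0)
    (hinj : ∀ ξ, fderiv ℝ h (p.x, fun i => zeta (ζ i) p) (ξ, 0) = 0 → ξ = 0)
    {Ω : Set (Model n m P)} (hΩ : Ω ∈ 𝓝 p) :
    ∃ Θ : Model n m P → Model n m P, (space n m P).IsOpenIso (space n m P) Θ ∧
      Set.range Θ ⊆ Ω ∧ p ∈ Set.range Θ ∧
      ∀ q i, h ((Θ q).x, fun i => zeta (ζ i) (Θ q)) i = 0 ↔ q.x i = 0 := by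
  let Z : Model n m P → ι → ℂ := fun q i => zeta (ζ i) q
  -- The new real coordinates are the components of `h`, and the monomials serve as parameters. The
  -- inverse changes `x` only, so it acts on the model without touching the exploded coordinates.
  let Φ : (Fin n → ℝ) × (ι → ℂ) → (Fin n → ℝ) × (ι → ℂ) := fun y => (h y, y.2)
  have hΦ : SmoothNear Φ (p.x, Z p) := hh.prodMk (ContDiff.smoothNear (by fun_prop) _)
  have hΦinj : Function.Injective (fderiv ℝ Φ (p.x, Z p)) := by
    rw [injective_iff_map_eq_zero]
    rintro ⟨ξ, w⟩ hw
    have h1 : HasFDerivAt Φ ((fderiv ℝ h (p.x, Z p)).prod (ContinuousLinearMap.snd ℝ _ _))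
        (p.x, Z p) := hh.differentiableAt.hasFDerivAt.prodMk hasFDerivAt_snd
    rw [h1.fderiv] at hw
    have h2 : w = 0 := congrArg Prod.snd hw
    subst h2
    rw [hinj ξ (congrArg Prod.fst hw)]
    rfl
  obtain ⟨e, hmem, heΦ, hsm, hsm'⟩ := hΦ.exists_localInverse hΦinj
  let Θ₂ : Model n m P → Model n m P := fun q => ⟨(e.symm (q.x, Z q)).1, q.z, q.mem⟩
  let η₂ : Model n m P → Model n m P := fun q => ⟨h (q.x, Z q), q.z, q.mem⟩
  have hcoord : ∀ q : Model n m P, SmoothFormAt q fun r => (r.x, Z r) := fun q =>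
    (smoothFormAt_x q).prodMk (smoothFormAt_pi fun i => smoothFormAt_zeta q (ζ i))
  have hcoordc : Continuous fun r : Model n m P => (r.x, Z r) :=
    continuous_iff_continuousAt.2 fun q => (hcoord q).continuousAt
  have hsnd : ∀ y ∈ e.target, (e.symm y).2 = y.2 := by
    intro y hy
    have h1 : Φ (e.symm y) = y := by rw [← heΦ, e.right_inv hy]
    have h2 := congrArg Prod.snd h1
    exact h2
  have hΘc : ∀ q : Model n m P, (q.x, Z q) ∈ e.target →
      ((Θ₂ q).x, Z (Θ₂ q)) = e.symm (q.x, Z q) := by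
    intro q hq
    refine Prod.ext rfl ?_
    rw [hsnd _ hq]
    rfl
  have hηΘ : ∀ q : Model n m P, (q.x, Z q) ∈ e.target → η₂ (Θ₂ q) = q := by
    intro q hq
    ext1
    · change h ((Θ₂ q).x, Z (Θ₂ q)) = q.x
      rw [hΘc q hq]
      have h1 : Φ (e.symm (q.x, Z q)) = (q.x, Z q) := by rw [← heΦ, e.right_inv hq]
      exact congrArg Prod.fst h1
    · rfl
  have hΘη : ∀ q : Model n m P, (q.x, Z q) ∈ e.source → Θ₂ (η₂ q) = q := by
    intro q hq
    ext1
    · change (e.symm (Φ (q.x, Z q))).1 = q.x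
      rw [← heΦ, e.left_inv hq]
    · rfl
  have hΘm : ∀ q : Model n m P, (q.x, Z q) ∈ e.target →
      MorphAt (space n m P) (space n m P) Θ₂ q := by
    intro q hq
    refine morphAt_of_components (goodAt hP q) (SmoothFormAt.smoothFnAt ?_) fun j => secAt_z q j
    exact (hcoord q).comp (k := fun y => (e.symm y).1)
      (SmoothNear.comp (h := Prod.fst) (ContDiff.smoothNear contDiff_fst _) (hsm' _ hq))
  have hηm : ∀ q : Model n m P, (q.x, Z q) ∈ e.source →
      MorphAt (space n m P) (space n m P) η₂ q := by
    intro q hq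
    refine morphAt_of_components (goodAt hP q) (SmoothFormAt.smoothFnAt ?_) fun j => secAt_z q j
    exact (hcoord q).comp (k := fun y => (Φ y).1)
      (SmoothNear.comp (h := Prod.fst) (ContDiff.smoothNear contDiff_fst _) (hsm _ hq))
  have hiso : ∀ q : Model n m P, (q.x, Z q) ∈ e.target →
      LocalIsoAt (space n m P) (space n m P) Θ₂ q := by
    intro q hq
    have hq' : ((Θ₂ q).x, Z (Θ₂ q)) ∈ e.source := by
      rw [hΘc q hq]
      exact e.map_target hq
    refine ⟨hΘm q hq, η₂, hηm _ hq', hηΘ q hq, ?_, ?_⟩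
    · filter_upwards [hcoordc.continuousAt.preimage_mem_nhds (e.open_source.mem_nhds hq')] with r hr
      exact hΘη r hr
    · filter_upwards [hcoordc.continuousAt.preimage_mem_nhds (e.open_target.mem_nhds hq)] with r hr
      exact hηΘ r hr
  -- In the straightened coordinates the centre has real part 0, as the shrinking lemma requires.
  let p₁ : Model n m P := ⟨0, p.z, p.mem⟩
  have hΦp : Φ (p.x, Z p) = (p₁.x, Z p₁) := Prod.ext h0 rfl
  have hp₁ : (p₁.x, Z p₁) ∈ e.target := by
    rw [← hΦp, ← heΦ]
    exact e.map_source hmem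
  have hΘp₁ : Θ₂ p₁ = p := hΘη p hmem ▸ congrArg Θ₂ (Model.ext h0.symm rfl)
  obtain ⟨Θ₁, h1, h2, h3, h4⟩ := exists_isOpenIso_subset hP (p := p₁) hp rfl
    (Ω := {q | (q.x, Z q) ∈ e.target ∧ Θ₂ q ∈ Ω}) (by
      refine inter_mem (hcoordc.continuousAt.preimage_mem_nhds (e.open_target.mem_nhds hp₁)) ?_
      refine (hΘm p₁ hp₁).1.preimage_mem_nhds ?_
      rw [hΘp₁]
      exact hΩ)
  have htar : ∀ q, ((Θ₁ q).x, Z (Θ₁ q)) ∈ e.target := fun q => (h2 ⟨q, rfl⟩).1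
  refine ⟨fun q => Θ₂ (Θ₁ q), isOpenIso_of_localIsoAt (fun q r hqr => ?_) fun q =>
    (hiso _ (htar q)).comp (h1.localIsoAt q), ?_, ?_, fun q i => ?_⟩
  · have h5 := congrArg η₂ hqr
    rw [hηΘ _ (htar q), hηΘ _ (htar r)] at h5
    exact h1.isOpenEmbedding.injective h5
  · rintro _ ⟨q, rfl⟩
    exact (h2 ⟨q, rfl⟩).2
  · obtain ⟨q, hq⟩ := h3
    exact ⟨q, by dsimp only; rw [hq, hΘp₁]⟩
  · rw [← h4 q i]
    have h5 : (η₂ (Θ₂ (Θ₁ q))).x = (Θ₁ q).x := by rw [hηΘ _ (htar q)]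
    rw [← h5]

end Model

/-! ### Adapted bases of a lattice -/

/-- A basis `E` of `ℤ^m`, divided into two parts, with its dual basis `C`. -/
structure AdaptedBasis (m l k : ℕ) where
  E : Fin l ⊕ Fin k → Fin m → ℤ
  C : Fin l ⊕ Fin k → Fin m → ℤ
  sum_C_E : ∀ j j', ∑ i, C i j * E i j' = if j = j' then 1 else 0
  sum_E_C : ∀ i i', ∑ j, E i' j * C i j = if i = i' then 1 else 0

/-- There is a basis of `ℤ^m` whose first part spans the saturation of a given sublattice. -/
theorem exists_adaptedBasis {m : ℕ} (N : Submodule ℤ (Fin m → ℤ)) :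
    ∃ (l k : ℕ) (b : AdaptedBasis m l k),
      (∀ i : Fin l, ∃ a : ℤ, a ≠ 0 ∧ a • b.E (.inl i) ∈ N) ∧
      ∀ β ∈ N, ∀ i : Fin k, ∑ j, β j * b.C (.inr i) j = 0 := by
  classical
  -- Smith normal form: `l` basis vectors have nonzero multiples forming a basis of `N`, and the
  -- others complete them to a basis of ℤ^m. The matrix `C` consists of the dual coordinates.
  obtain ⟨l, snf⟩ := N.smithNormalForm (Pi.basisFun ℤ (Fin m))
  obtain ⟨k, ⟨τ⟩⟩ : ∃ k, Nonempty (Fin k ≃ {j : Fin m // j ∈ (Set.range snf.f)ᶜ}) :=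
    ⟨_, ⟨(Fintype.equivFin _).symm⟩⟩
  obtain ⟨σ, hσl, hσr⟩ : ∃ σ : Fin l ⊕ Fin k ≃ Fin m, (∀ i, σ (.inl i) = snf.f i) ∧
      ∀ i, σ (.inr i) ∉ Set.range snf.f :=
    ⟨((Equiv.ofInjective snf.f snf.f.injective).sumCongr τ).trans (Equiv.Set.sumCompl _),
      fun i => rfl, fun i => (τ i).2⟩
  have hrepr : ∀ (v : Fin m → ℤ) (j : Fin m),
      snf.bM.repr v j = ∑ j', v j' * snf.bM.repr (Pi.single j' 1) j := by
    intro v j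
    have h1 : v = ∑ j', v j' • (Pi.single j' 1 : Fin m → ℤ) := pi_eq_sum_univ' v
    conv_lhs => rw [h1]
    rw [map_sum, Finsupp.finsetSum_apply]
    refine Finset.sum_congr rfl fun j' _ => ?_
    rw [map_smul, Finsupp.smul_apply, smul_eq_mul]
  refine ⟨l, k, ⟨fun i => snf.bM (σ i), fun i j => snf.bM.repr (Pi.single j 1) (σ i), ?_, ?_⟩,
    fun i => ⟨snf.a i, ?_, ?_⟩, fun β hβ i => ?_⟩
  · intro j j'
    rw [Equiv.sum_comp σ fun i => snf.bM.repr (Pi.single j 1) i * snf.bM i j']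
    have h1 := congrFun (snf.bM.sum_repr (Pi.single j 1)) j'
    rw [Finset.sum_apply] at h1
    simp only [Pi.smul_apply, smul_eq_mul] at h1
    rw [h1, Pi.single_apply]
    by_cases h : j = j'
    · rw [if_pos h, if_pos h.symm]
    · rw [if_neg h, if_neg (Ne.symm h)]
  · intro i i'
    rw [← hrepr, Module.Basis.repr_self, Finsupp.single_apply]
    by_cases h : i = i'
    · rw [if_pos h, if_pos (by rw [h])]
    · rw [if_neg h, if_neg fun h' => h (σ.injective h').symm]
  · intro ha
    have h1 := snf.snf i
    rw [ha, zero_smul] at h1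
    exact snf.bN.ne_zero i (Subtype.ext h1)
  · dsimp only
    rw [hσl, ← snf.snf i]
    exact (snf.bN i).2
  · dsimp only
    rw [← hrepr]
    exact snf.repr_eq_zero_of_notMem_range ⟨β, hβ⟩ (hσr i)

theorem ExplUnit.zpow_sum {ι : Type*} (s : Finset ι) (a : ExplUnit) (n : ι → ℤ) :
    a ^ ∑ i ∈ s, n i = ∏ i ∈ s, a ^ n i := by
  classical
  induction s using Finset.induction_on with
  | empty => simp
  | insert i s hi ih => rw [Finset.sum_insert hi, Finset.prod_insert hi, zpow_add, ih]

/-! ### Change of exploded coordinates along a lattice basis. -/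

namespace AdaptedBasis

variable {m l k : ℕ} (b : AdaptedBasis m l k)

/-- The point with given coordinates. -/
def point (V : Fin l ⊕ Fin k → ℝ) : Fin m → ℝ := fun j => ∑ i, V i * (b.C i j : ℝ)

theorem point_linEval (y : Fin m → ℝ) : b.point (fun i => linEval (b.E i) y) = y := by
  funext j
  have h1 : ∀ j', (∑ i, (b.C i j : ℝ) * (b.E i j' : ℝ)) = if j = j' then 1 else 0 := by
    intro j'
    exact_mod_cast b.sum_C_E j j'
  unfold linEval point
  simp only [Finset.sum_mul, mul_assoc]
  rw [Finset.sum_comm]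
  simp only [mul_comm (b.E _ _ : ℝ), ← Finset.mul_sum, h1, mul_ite, mul_one, mul_zero]
  exact (Finset.sum_ite_eq _ _ _).trans (if_pos (Finset.mem_univ j))

/-- The exploded coordinates obtained from those in the basis. -/
def unit (W : Fin l ⊕ Fin k → ExplUnit) : Fin m → ExplUnit := fun j => ∏ i, W i ^ b.C i j

theorem trop_unit (W : Fin l ⊕ Fin k → ExplUnit) :
    (fun j => (b.unit W j).trop) = b.point fun i => (W i).trop := by
  funext j
  simp [unit, point, mul_comm]

theorem monomial_unit (W : Fin l ⊕ Fin k → ExplUnit) (i : Fin l ⊕ Fin k) :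
    monomial (0, b.E i) (b.unit W) = W i := by
  have h0 : ∀ a : ExplUnit, (1, Multiplicative.ofAdd (0 : ℝ)) * a = a := by
    intro a
    ext <;> simp
  unfold monomial unit
  rw [h0]
  simp only [← Finset.prod_zpow]
  rw [Finset.prod_comm]
  simp only [← zpow_mul, ← ExplUnit.zpow_sum]
  have h1 : ∀ i', (∑ j, b.C i' j * b.E i j) = if i' = i then 1 else 0 := by
    intro i'
    have := b.sum_E_C i' i
    simpa only [mul_comm (b.E i _)] using this
  simp only [h1]
  rw [Finset.prod_eq_single i (fun i' _ h => by rw [if_neg h, zpow_zero])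
    (fun h => absurd (Finset.mem_univ i) h), if_pos rfl, zpow_one]

theorem unit_monomial (z : Fin m → ExplUnit) :
    b.unit (fun i => monomial (0, b.E i) z) = z := by
  have h0 : ∀ a : ExplUnit, (1, Multiplicative.ofAdd (0 : ℝ)) * a = a := by
    intro a
    ext <;> simp
  funext j
  unfold monomial unit
  simp only [h0, ← Finset.prod_zpow]
  rw [Finset.prod_comm]
  simp only [← zpow_mul, ← ExplUnit.zpow_sum]
  have h1 : ∀ j', (∑ i, b.E i j' * b.C i j) = if j = j' then 1 else 0 := by
    intro j'
    simpa only [mul_comm (b.C _ _)] using b.sum_C_E j j'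
  simp only [h1]
  rw [Finset.prod_eq_single j (fun j' _ h => by rw [if_neg (Ne.symm h), zpow_zero])
    (fun h => absurd (Finset.mem_univ j) h), if_pos rfl, zpow_one]

/-- The restriction of an affine function to the subspace on which the first coordinates are
fixed. -/
def pull (V : Fin l → ℝ) (c : ℝ × (Fin m → ℤ)) : ℝ × (Fin k → ℤ) :=
  (c.1 + ∑ i, V i * ∑ j, (c.2 j : ℝ) * (b.C (.inl i) j : ℝ), fun i => ∑ j, c.2 j * b.C (.inr i) j)

theorem affEval_pull (V : Fin l → ℝ) (c : ℝ × (Fin m → ℤ)) (v : Fin k → ℝ) :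
    affEval (b.pull V c) v = affEval c (b.point (Sum.elim V v)) := by
  have h1 : ∑ j, b.point (Sum.elim V v) j * (c.2 j : ℝ) =
      ∑ i, Sum.elim V v i * ∑ j, (c.2 j : ℝ) * (b.C i j : ℝ) := by
    unfold point
    simp only [Finset.sum_mul, Finset.mul_sum]
    rw [Finset.sum_comm]
    refine Finset.sum_congr rfl fun i _ => Finset.sum_congr rfl fun j _ => ?_
    ring
  unfold affEval
  rw [h1, Fintype.sum_sum_type]
  simp only [pull, Sum.elim_inl, Sum.elim_inr]
  push_cast
  ring

end AdaptedBasis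

namespace ExplodedSpace

variable {X : Type u} {Y : Type v} [TopologicalSpace X] [TopologicalSpace Y]
  {A : ExplodedSpace Y} {B : ExplodedSpace X} {f : X → Expl}

/-! ### Morphisms to the refinement -/

/-- A morphism lifts to the refinement where it maps to a region on which `f` has the exponent of
an exploded function. -/
theorem MorphAt.lift_refine {θ : Y → X} {q : Y} (hθ : MorphAt A B θ q) (hA : A.GoodAt q)
    {g : X → ExplUnit} (hg : B.SecAt (θ q) g) (hfg : ∀ᶠ r in 𝓝 q, (f (θ r)).exp = (g (θ r)).trop) :
    MorphAt (Y := Refined B f) A (B.refine f) θ q := by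
  have hmem : ∀ V : Set X, RefinedOpen B f V → θ q ∈ V → ∀ᶠ r in 𝓝 q, θ r ∈ V := by
    intro V hV
    induction hV with
    | of_open U => exact fun h => hθ.1.eventually (U.isOpen.mem_nhds h)
    | inter V W hV hW ihV ihW => exact fun h => (ihV h.1).and (ihW h.2)
    | face U k hk hle =>
      rintro ⟨hU, he⟩
      have hU' := hθ.1.eventually (U.isOpen.mem_nhds hU)
      have h1 := hA.continuousAt _ (hθ.2 _ ((secAt_of_mem hk hU).div hg)) (by
        filter_upwards [hU', hfg] with r hr hr'
        rw [ExplUnit.trop_div, ← hr']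
        exact sub_nonneg.2 (hle _ hr))
      -- Two exploded functions have equal exponents exactly where the smooth part of their quotient
      -- is nonzero. This quotient has nonnegative exponents near `q`, so the equality is an open
      -- condition.
      have h2 : (k (θ q) / g (θ q)).smoothPart ≠ 0 := by
        rw [ExplUnit.smoothPart_ne_zero_iff, ExplUnit.trop_div, ← he, ← hfg.self_of_nhds, sub_self]
      filter_upwards [h1.eventually_ne h2, hU', hfg] with r h3 h4 h5
      rw [ExplUnit.smoothPart_ne_zero_iff, ExplUnit.trop_div, ← h5, sub_eq_zero] at h3
      exact ⟨h4, h3.symm⟩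
    | smooth V hV U hVU k hk h0 O hO ih =>
      rintro ⟨hV', hO'⟩
      have h1 := hA.continuousAt _ (hθ.2 _ (secAt_of_mem hk (hVU hV'))) (by
        filter_upwards [ih hV'] with r hr using h0 _ hr)
      filter_upwards [ih hV', h1.eventually (hO.mem_nhds hO')] with r h2 h3 using ⟨h2, h3⟩
  have hcont : Tendsto (β := Refined B f) θ (𝓝 q) (𝓝 (θ q)) := by
    intro S hS
    obtain ⟨V, hV, hpV, hVS⟩ := mem_nhds_refined.1 hS
    exact mem_of_superset (hmem V hV hpV) fun s hs => hVS hs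
  refine ⟨hcont, fun φ hφ => ?_⟩
  obtain ⟨s, k, ⟨ι, _, h, H, h1, h2, h3⟩, h0, hk, hφ⟩ := secAt_refine_iff.1 hφ
  have hs : A.SmoothFnAt q fun r => s (θ r) :=
    ⟨ι, _, fun i r => h i (θ r), H, fun i => ⟨hθ.2 _ (h1 i).1, hcont.eventually (h1 i).2⟩, h2,
      hcont.eventually h3⟩
  exact ((hA.secAt _ hs h0).mul (hθ.2 _ hk)).congr (hcont.eventually hφ)

end ExplodedSpace

/-! ### Coordinates on the strata of a model -/

namespace AdaptedBasis

variable {m l k : ℕ} (b : AdaptedBasis m l k) {n : ℕ} {P : Set (Fin m → ℝ)} (V : Fin l → ℝ)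

/-- The polytope of the points of `Q` whose first coordinates are `V`. -/
def crossSection (Q : Set (Fin m → ℝ)) : Set (Fin k → ℝ) := {v | b.point (Sum.elim V v) ∈ Q}

theorem crossSection_polytope (s t : Finset (ℝ × (Fin m → ℤ))) :
    b.crossSection V (polytope s t) =
      {x | (∀ c ∈ s.image (b.pull V), 0 ≤ affEval c x) ∧
        (∀ c ∈ t.image (b.pull V), 0 < affEval c x)} := by
  ext v
  constructor
  · rintro ⟨h1, h2⟩
    constructor <;> intro c hc <;> obtain ⟨d, hd, rfl⟩ := Finset.mem_image.1 hc <;>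
      rw [b.affEval_pull]
    · exact h1 d hd
    · exact h2 d hd
  · rintro ⟨h1, h2⟩
    constructor <;> intro c hc <;> rw [← b.affEval_pull]
    · exact h1 _ (Finset.mem_image_of_mem _ hc)
    · exact h2 _ (Finset.mem_image_of_mem _ hc)

/-- The coordinate `w i` on the stratum, an affine function of the real coordinates. -/
def wCoord (w : Fin l → ℂ) (x : Fin (n + (l + l)) → ℝ) (i : Fin l) : ℂ :=
  w i + (x (Fin.natAdd n (Fin.castAdd l i)) + x (Fin.natAdd n (Fin.natAdd l i)) * Complex.I)

theorem contDiff_wCoord (w : Fin l → ℂ) (i : Fin l) :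
    ContDiff ℝ ∞ fun x : Fin (n + (l + l)) → ℝ => wCoord w x i := by
  unfold wCoord
  refine contDiff_const.add ((Complex.ofRealCLM.contDiff.comp (contDiff_apply ℝ ℝ _)).add
    ((Complex.ofRealCLM.contDiff.comp (contDiff_apply ℝ ℝ _)).mul contDiff_const))

/-- The exploded coordinates of a point of the stratum in the basis. -/
def strat (w : Fin l → ℂ) (x : Fin (n + (l + l)) → ℝ) (z : Fin k → ExplUnit) :
    Fin l ⊕ Fin k → ExplUnit :=
  Sum.elim (fun i => ExplUnit.ofComplex (wCoord w x i) * (1, Multiplicative.ofAdd (V i))) z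

theorem trop_strat (w : Fin l → ℂ) (x : Fin (n + (l + l)) → ℝ) (z : Fin k → ExplUnit) :
    (fun i => (strat V w x z i).trop) = Sum.elim V fun i => (z i).trop := by
  funext i
  rcases i with i | i
  · simp only [strat, Sum.elim_inl, ExplUnit.trop_mul, ExplUnit.trop_ofComplex, zero_add]
    rfl
  · rfl

variable {Q : Set (Fin m → ℝ)} (hQP : Q ⊆ P)

/-- The parametrization of a neighbourhood in the stratum. -/
def chart (w : Fin l → ℂ) (q : Model (n + (l + l)) k (b.crossSection V Q)) : Model n m P where
  x i := q.x (Fin.castAdd (l + l) i)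
  z := b.unit (strat V w q.x q.z)
  mem := by
    rw [b.trop_unit, trop_strat]
    exact hQP q.mem

theorem trop_chart (w : Fin l → ℂ) (q : Model (n + (l + l)) k (b.crossSection V Q)) :
    (b.chart V hQP w q).trop = b.point (Sum.elim V q.trop) := by
  change (fun i => (b.unit (strat V w q.x q.z) i).trop) = _
  rw [b.trop_unit, trop_strat]
  rfl

theorem trop_chart_mem (w : Fin l → ℂ) (q : Model (n + (l + l)) k (b.crossSection V Q)) :
    (b.chart V hQP w q).trop ∈ Q := by
  rw [trop_chart]
  exact q.mem

open Classical in
/-- The inverse of `chart`, defined where the tropical part has first coordinates `V`. -/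
def chartInv (w : Fin l → ℂ) (q₀ : Model (n + (l + l)) k (b.crossSection V Q)) (r : Model n m P) :
    Model (n + (l + l)) k (b.crossSection V Q) :=
  if h : (fun i => (monomial (0, b.E (.inr i)) r.z).trop) ∈ b.crossSection V Q then
    ⟨Fin.append r.x (Fin.append
      (fun i => (((monomial (0, b.E (.inl i)) r.z).1 : ℂ) - w i).re)
      (fun i => (((monomial (0, b.E (.inl i)) r.z).1 : ℂ) - w i).im)),
      fun i => monomial (0, b.E (.inr i)) r.z, h⟩
  else q₀

theorem trop_monomial_zero (β : Fin m → ℤ) (z : Fin m → ExplUnit) :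
    (monomial (0, β) z).trop = linEval β fun i => (z i).trop := by
  rw [trop_monomial, affEval_eq, zero_add]

theorem monomial_chart (w : Fin l → ℂ) (q : Model (n + (l + l)) k (b.crossSection V Q))
    (i : Fin l ⊕ Fin k) :
    monomial (0, b.E i) (b.chart V hQP w q).z = strat V w q.x q.z i :=
  b.monomial_unit _ i

theorem chartInv_chart (w : Fin l → ℂ) (q₀ q : Model (n + (l + l)) k (b.crossSection V Q))
    (hq : ∀ i, wCoord w q.x i ≠ 0) : b.chartInv V w q₀ (b.chart V hQP w q) = q := by
  have h1 : ∀ i, monomial (0, b.E (.inr i)) (b.chart V hQP w q).z = q.z i :=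
    fun i => b.monomial_chart V hQP w q _
  have h2 : ∀ i, ((monomial (0, b.E (.inl i)) (b.chart V hQP w q).z).1 : ℂ) = wCoord w q.x i := by
    intro i
    rw [b.monomial_chart V hQP w q]
    simp only [strat, Sum.elim_inl, Prod.fst_mul, mul_one]
    exact ExplUnit.coeff_ofComplex (hq i)
  unfold chartInv
  rw [dif_pos (by simp only [h1]; exact q.mem)]
  ext1
  · funext i
    simp only [h2, wCoord, add_sub_cancel_left]
    refine Fin.addCases (fun i => ?_) (fun i => ?_) i
    · rw [Fin.append_left]
      rfl
    · rw [Fin.append_right]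
      refine Fin.addCases (fun i => ?_) (fun i => ?_) i
      · rw [Fin.append_left]
        simp
      · rw [Fin.append_right]
        simp
  · funext i
    exact h1 i

/-- The conditions under which `chartInv` is inverse to `chart`. -/
structure InStratum (Q : Set (Fin m → ℝ)) (r : Model n m P) : Prop where
  mem : r.trop ∈ Q
  linEval_eq : ∀ i, linEval (b.E (.inl i)) r.trop = V i

variable {V} {b}

theorem InStratum.mem_crossSection {r : Model n m P} (hr : b.InStratum V Q r) :
    (fun i => (monomial (0, b.E (.inr i)) r.z).trop) ∈ b.crossSection V Q := by
  have h1 : Sum.elim V (fun i => (monomial (0, b.E (.inr i)) r.z).trop) =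
      fun i => linEval (b.E i) r.trop := by
    funext i
    rcases i with i | i
    · exact (hr.linEval_eq i).symm
    · exact trop_monomial_zero _ _
  change b.point _ ∈ Q
  rw [h1, b.point_linEval]
  exact hr.mem

theorem InStratum.chartInv_eq {r : Model n m P} (hr : b.InStratum V Q r) (w : Fin l → ℂ)
    (q₀ : Model (n + (l + l)) k (b.crossSection V Q)) : b.chartInv V w q₀ r =
    ⟨Fin.append r.x (Fin.append
      (fun i => (((monomial (0, b.E (.inl i)) r.z).1 : ℂ) - w i).re)
      (fun i => (((monomial (0, b.E (.inl i)) r.z).1 : ℂ) - w i).im)),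
      fun i => monomial (0, b.E (.inr i)) r.z, hr.mem_crossSection⟩ :=
  dif_pos hr.mem_crossSection

theorem InStratum.chart_chartInv {r : Model n m P} (hr : b.InStratum V Q r) (w : Fin l → ℂ)
    (q₀ : Model (n + (l + l)) k (b.crossSection V Q)) :
    b.chart V hQP w (b.chartInv V w q₀ r) = r := by
  rw [hr.chartInv_eq]
  ext1
  · funext i
    exact Fin.append_left _ _ i
  · change b.unit (strat V w _ _) = r.z
    conv_rhs => rw [← b.unit_monomial r.z]
    congr 1
    funext i
    rcases i with i | i
    · have h1 : wCoord (n := n) w (Fin.append r.x (Fin.append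
          (fun i => (((monomial (0, b.E (.inl i)) r.z).1 : ℂ) - w i).re)
          (fun i => (((monomial (0, b.E (.inl i)) r.z).1 : ℂ) - w i).im))) i =
          (monomial (0, b.E (.inl i)) r.z).1 := by
        rw [wCoord, Fin.append_right, Fin.append_right, Fin.append_left, Fin.append_right,
          Complex.re_add_im, add_sub_cancel]
      simp only [strat, Sum.elim_inl, h1]
      apply ExplUnit.ext_coeff_trop
      · rw [Prod.fst_mul, mul_one, ExplUnit.coeff_ofComplex (Units.ne_zero _)]
      · rw [ExplUnit.trop_mul, ExplUnit.trop_ofComplex, zero_add, trop_monomial_zero]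
        exact (hr.linEval_eq i).symm
    · rfl

open ExplodedSpace in
theorem morphAt_chart (hQ : IsIntegralAffinePolytope (b.crossSection V Q)) (w : Fin l → ℂ)
    (q : Model (n + (l + l)) k (b.crossSection V Q)) (hq : ∀ i, wCoord w q.x i ≠ 0) :
    MorphAt (Model.space _ _ _) (Model.space n m P) (b.chart V hQP w) q := by
  have hx : (Model.space (n + (l + l)) k (b.crossSection V Q)).SmoothFnAt q
      fun r (i : Fin n) => r.x (Fin.castAdd (l + l) i) :=
    (Model.smoothFnAt_x q).comp
      (k := fun (x : Fin (n + (l + l)) → ℝ) (i : Fin n) => x (Fin.castAdd (l + l) i))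
      (ContDiff.smoothNear (by fun_prop) _)
  refine Model.morphAt_of_components (Model.goodAt hQ q) hx fun j => ?_
  change (Model.space (n + (l + l)) k (b.crossSection V Q)).SecAt q
    fun r => ∏ i, strat V w r.x r.z i ^ b.C i j
  refine SecAt.prod (A := Model.space (n + (l + l)) k (b.crossSection V Q)) _ fun i _ =>
    SecAt.zpow (A := Model.space (n + (l + l)) k (b.crossSection V Q)) ?_ _
  rcases i with i | i
  · refine SecAt.mul (A := Model.space (n + (l + l)) k (b.crossSection V Q)) (Model.secAt_of_smoothFormAt (s := fun r => wCoord w r.x i) ?_ (hq i))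
      (secAt_const _ _)
    exact (Model.smoothFormAt_x q).comp ((contDiff_wCoord w i).smoothNear _)
  · exact Model.secAt_z q i

open ExplodedSpace in
theorem morphAt_chartInv {X : Type u} [TopologicalSpace X] {A : ExplodedSpace X} {p : X}
    (hA : A.GoodAt p) {η : X → Model n m P} (hη : MorphAt A (Model.space n m P) η p)
    (hs : ∀ᶠ x in 𝓝 p, b.InStratum V Q (η x)) (w : Fin l → ℂ)
    (q₀ : Model (n + (l + l)) k (b.crossSection V Q)) :
    MorphAt A (Model.space _ _ _) (fun x => b.chartInv V w q₀ (η x)) p := by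
  have hmon : ∀ c, A.SecAt p fun x => monomial c (η x).z := fun c => hη.2 _ (Model.secAt_monomial _ c)
  have hx : A.SmoothFnAt p fun x => (η x).x := hη.smoothFnAt (Model.smoothFnAt_x _)
  have hw : ∀ i, A.SmoothFnAt p fun x => ((monomial (0, b.E (.inl i)) (η x).z).1 : ℂ) - w i := by
    intro i
    -- On the stratum the exponent of this monomial is the constant `V i`; shifting by `-V i` makes
    -- it 0, so the coefficient is a smooth part and hence smooth.
    have h0 : ∀ᶠ x in 𝓝 p, (monomial (-V i, b.E (.inl i)) (η x).z).trop = 0 := by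
      filter_upwards [hs] with x hx
      rw [trop_monomial, affEval_eq]
      exact (congrArg (-V i + ·) (hx.linEval_eq i)).trans (neg_add_cancel _)
    refine (((hmon (-V i, b.E (.inl i))).smoothFnAt (h0.mono fun _ h => h.ge)).comp
      (k := fun y => y - w i) (ContDiff.smoothNear (by fun_prop) _)).congr ?_
    filter_upwards [h0] with x hx
    rw [ExplUnit.smoothPart_of_trop_eq_zero hx, coeff_monomial, coeff_monomial]
  refine Model.morphAt_of_components hA ?_ fun i => ?_
  · have h1 : A.SmoothFnAt p fun x => Fin.append (η x).x (Fin.append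
        (fun i => (((monomial (0, b.E (.inl i)) (η x).z).1 : ℂ) - w i).re)
        (fun i => (((monomial (0, b.E (.inl i)) (η x).z).1 : ℂ) - w i).im)) := by
      refine smoothFnAt_pi fun i => ?_
      refine Fin.addCases (fun i => ?_) (fun i => ?_) i
      · simp only [Fin.append_left]
        exact hx.comp (k := fun y => y i) (ContDiff.smoothNear (by fun_prop) _)
      · simp only [Fin.append_right]
        refine Fin.addCases (fun i => ?_) (fun i => ?_) i
        · simp only [Fin.append_left]
          exact (hw i).comp (k := Complex.re) (Complex.reCLM.contDiff.smoothNear _)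
        · simp only [Fin.append_right]
          exact (hw i).comp (k := Complex.im) (Complex.imCLM.contDiff.smoothNear _)
    refine h1.congr ?_
    filter_upwards [hs] with x hx
    rw [hx.chartInv_eq]
  · refine (hmon (0, b.E (.inr i))).congr ?_
    filter_upwards [hs] with x hx
    rw [hx.chartInv_eq]

end AdaptedBasis

/-! ### Charts of the refinement -/

namespace ExplodedSpace

variable {X : Type u} [TopologicalSpace X] {B : ExplodedSpace X} {f : X → Expl}

/-- Around every point of the refinement there is a parametrization, centred in the open stratum
of a model, in which the coefficient of `f` is a unit times a smooth function. -/
theorem exists_chart_refine (hB : B.IsExplodedManifold) (hf : B.IsTropicalOn ⊤ f)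
    (p : Refined B f) : ∃ (n m : ℕ) (P : Set (Fin m → ℝ)) (κ : Model n m P → Refined B f)
      (p₀ : Model n m P) (Ω : Set (Model n m P)) (g : X → ExplUnit) (H : Model n m P → ℂ),
      IsIntegralAffinePolytope P ∧ p₀.trop ∈ interior P ∧ κ p₀ = p ∧ Ω ∈ 𝓝 p₀ ∧ Ω.InjOn κ ∧
      (∀ q ∈ Ω, LocalIsoAt (Model.space n m P) (B.refine f) κ q) ∧ B.SecAt p g ∧
      Model.SmoothFormAt p₀ H ∧ ∀ q ∈ Ω, (f (κ q)).coeff = (g (κ q)).1 * H q := by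
  classical
  obtain ⟨n, m, P, φ, hP, hφ, q₀, hq₀⟩ := hB (refinedMap B f p)
  have hp : p = φ q₀ := hq₀.symm
  subst hp
  clear hq₀
  obtain ⟨-, s, t, hPst⟩ := id hP
  change P = polytope s t at hPst
  have hφc : Continuous φ := hφ.isOpenEmbedding.continuous
  obtain ⟨U, N, g, hpU, hdec⟩ := hf.exists_decomposes (φ q₀)
  obtain ⟨j₀, hj₀⟩ := hdec.exists_exp_eq _ hpU
  -- the affine functions that define the subdivision near the point
  have form : ∀ j, ∃ d : ℝ × (Fin m → ℤ),
      ∀ᶠ r in 𝓝 q₀, (g j (φ r) / g j₀ (φ r)).trop = affEval d r.trop := by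
    intro j
    obtain ⟨σ, d, -, -, h3⟩ := Model.secAt_iff.1 ((hφ.localIsoAt q₀).1.2 (fun x => g j x / g j₀ x)
      ((secAt_of_mem (hdec.mem j) hpU).div (secAt_of_mem (hdec.mem j₀) hpU)))
    refine ⟨d, ?_⟩
    filter_upwards [h3] with r hr
    rw [hr, ExplUnit.trop_mul, ExplUnit.trop_ofComplex, zero_add, trop_monomial]
    rfl
  choose d hd using form
  obtain ⟨O, hO, hOo, hq₀O⟩ := eventually_nhds_iff.1
    ((hφc.continuousAt.eventually (U.isOpen.mem_nhds hpU)).and (eventually_all.2 hd))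
  let s' := s ∪ Finset.univ.image d
  let Q := polytope s' t
  have hQ : ∀ x, x ∈ Q ↔ x ∈ P ∧ ∀ j, 0 ≤ affEval (d j) x := by
    intro x
    rw [hPst]
    constructor
    · exact fun h => ⟨⟨fun d hd => h.1 d (Finset.mem_union_left _ hd), h.2⟩,
        fun j => h.1 _ (Finset.mem_union_right _ (Finset.mem_image_of_mem _ (Finset.mem_univ _)))⟩
    · rintro ⟨h1, h2⟩
      refine ⟨fun d hd => ?_, h1.2⟩
      rcases Finset.mem_union.1 hd with hd | hd
      · exact h1.1 d hd
      · obtain ⟨j, -, rfl⟩ := Finset.mem_image.1 hd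
        exact h2 j
  have hQP : Q ⊆ P := fun x hx => ((hQ x).1 hx).1
  -- on `O`, the exponent of `f` is that of `g j₀` exactly over `Q`
  have hOQ : ∀ r ∈ O, (f (φ r)).exp = (g j₀ (φ r)).trop ↔ r.trop ∈ Q := by
    intro r hr
    obtain ⟨hrU, hrd⟩ := hO r hr
    rw [hQ]
    constructor
    · refine fun h => ⟨r.mem, fun j => ?_⟩
      rw [← hrd j, ExplUnit.trop_div, ← h]
      exact sub_nonneg.2 (hdec.exp_le _ hrU j)
    · rintro ⟨-, h⟩
      obtain ⟨j, hj⟩ := hdec.exists_exp_eq _ hrU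
      refine le_antisymm (hdec.exp_le _ hrU j₀) ?_
      have h1 := h j
      rw [← hrd j, ExplUnit.trop_div, ← hj] at h1
      linarith
  let y := q₀.trop
  have hyQ : y ∈ Q := (hOQ q₀ hq₀O).1 hj₀
  -- The active constraints at `y` determine the open face. Directions in the saturation of their
  -- lattice have constant exponent there and will become complex coordinates; the complementary
  -- ones parametrise the cell.
  let A := s'.filter fun c => affEval c y = 0
  let L := Submodule.span ℤ (Prod.snd '' (A : Set (ℝ × (Fin m → ℤ))))
  obtain ⟨l, k, b, hb1, hb2⟩ := exists_adaptedBasis L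
  let V : Fin l → ℝ := fun i => linEval (b.E (.inl i)) y
  let w : Fin l → ℂ := fun i => ((monomial (0, b.E (.inl i)) q₀.z).1 : ℂ)
  -- Elements of `L` are constant where the active constraints vanish. Only a nonzero multiple of
  -- each basis vector lies in `L`, but that suffices over ℝ.
  have hstr : ∀ r : Model n m P, r.trop ∈ Q → (∀ c ∈ A, affEval c r.trop = 0) →
      b.InStratum V Q r := by
    intro r hr hA
    refine ⟨hr, fun i => ?_⟩
    have h1 : ∀ β ∈ L, linEval β (r.trop - y) = 0 := by
      intro β hβ
      induction hβ using Submodule.span_induction with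
      | mem β hβ =>
        obtain ⟨c, hc, rfl⟩ := hβ
        have h2 := hA c hc
        have h3 := (Finset.mem_filter.1 hc).2
        rw [affEval_eq] at h2 h3
        rw [linEval_sub_right]
        linarith
      | zero => simp [linEval]
      | add β β' _ _ h h' => rw [linEval_add_left, h, h', add_zero]
      | smul a β _ h => rw [linEval_smul_left, h, mul_zero]
    obtain ⟨a, ha, haL⟩ := hb1 i
    have h2 := h1 _ haL
    rw [linEval_smul_left, linEval_sub_right] at h2
    exact sub_eq_zero.1 ((mul_eq_zero.1 h2).resolve_left (by exact_mod_cast ha))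
  have hstr₀ : b.InStratum V Q q₀ := ⟨hyQ, fun i => rfl⟩
  let v₀ : Fin k → ℝ := fun i => linEval (b.E (.inr i)) y
  have hpt : b.point (Sum.elim V v₀) = y := by
    have h1 : Sum.elim V v₀ = fun i => linEval (b.E i) y := by
      funext i
      rcases i with i | i <;> rfl
    rw [h1, b.point_linEval]
  -- The second half of the dual basis annihilates `L`, so active constraints pull back to constants
  -- on the cross section, necessarily 0. Only constraints strict at `v₀` remain, and `v₀` is
  -- therefore interior.
  have hAzero : ∀ c ∈ A, ∀ v : Fin k → ℝ, affEval c (b.point (Sum.elim V v)) = 0 := by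
    intro c hc v
    have h1 : ∀ i, (b.pull V c).2 i = 0 := fun i =>
      hb2 c.2 (Submodule.subset_span ⟨c, hc, rfl⟩) i
    have h2 : ∀ v, affEval (b.pull V c) v = (b.pull V c).1 := by
      intro v
      simp [affEval, h1]
    rw [← b.affEval_pull, h2, ← h2 v₀, b.affEval_pull, hpt]
    exact (Finset.mem_filter.1 hc).2
  have hint : v₀ ∈ interior (b.crossSection V Q) := by
    rw [mem_interior_iff_mem_nhds]
    have hcont : ∀ c : ℝ × (Fin m → ℤ),
        Continuous fun v : Fin k → ℝ => affEval c (b.point (Sum.elim V v)) := by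
      intro c
      simp only [← b.affEval_pull]
      unfold affEval
      fun_prop
    have h1 : ∀ᶠ v in 𝓝 v₀, ∀ c ∈ s', 0 ≤ affEval c (b.point (Sum.elim V v)) := by
      refine (eventually_all_finset _).2 fun c hc => ?_
      by_cases hcA : c ∈ A
      · exact Eventually.of_forall fun v => (hAzero c hcA v).ge
      · have h2 : 0 < affEval c (b.point (Sum.elim V v₀)) := by
          rw [hpt]
          exact lt_of_le_of_ne (hyQ.1 c hc) fun h => hcA (Finset.mem_filter.2 ⟨hc, h.symm⟩)
        filter_upwards [continuousAt_const.eventually_lt (hcont c).continuousAt h2] with v hv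
          using hv.le
    have h2 : ∀ᶠ v in 𝓝 v₀, ∀ c ∈ t, 0 < affEval c (b.point (Sum.elim V v)) := by
      refine (eventually_all_finset _).2 fun c hc => ?_
      refine continuousAt_const.eventually_lt (hcont c).continuousAt ?_
      rw [hpt]
      exact hyQ.2 c hc
    exact h1.and h2
  have hPoly : IsIntegralAffinePolytope (b.crossSection V Q) :=
    ⟨⟨v₀, hint⟩, _, _, b.crossSection_polytope V s' t⟩
  let κ₀ : Model (n + (l + l)) k (b.crossSection V Q) → Model n m P := b.chart V hQP w
  let p₀ : Model (n + (l + l)) k (b.crossSection V Q) :=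
    ⟨Fin.append q₀.x (Fin.append
      (fun i => (((monomial (0, b.E (.inl i)) q₀.z).1 : ℂ) - w i).re)
      (fun i => (((monomial (0, b.E (.inl i)) q₀.z).1 : ℂ) - w i).im)),
      fun i => monomial (0, b.E (.inr i)) q₀.z, hstr₀.mem_crossSection⟩
  have hp₀ : b.chartInv V w p₀ q₀ = p₀ := hstr₀.chartInv_eq w p₀
  have hκ₀p : κ₀ p₀ = q₀ := by
    rw [← hp₀]
    exact hstr₀.chart_chartInv hQP w p₀
  have hp₀w : ∀ i, AdaptedBasis.wCoord w p₀.x i ≠ 0 := by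
    intro i
    have h1 : AdaptedBasis.wCoord w p₀.x i = w i := by
      simp only [AdaptedBasis.wCoord, p₀]
      rw [Fin.append_right, Fin.append_right, Fin.append_left, Fin.append_right,
        Complex.re_add_im, add_sub_cancel]
    rw [h1]
    exact Units.ne_zero _
  have hp₀t : p₀.trop = v₀ := funext fun i => AdaptedBasis.trop_monomial_zero _ _
  -- The complex coordinates are coefficients of exploded units, so they must not vanish; the second
  -- condition keeps the decomposition of `f` valid.
  let Ω : Set (Model (n + (l + l)) k (b.crossSection V Q)) :=
    {q | (∀ i, AdaptedBasis.wCoord w q.x i ≠ 0) ∧ κ₀ q ∈ O}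
  have hΩnhds : ∀ q ∈ Ω, Ω ∈ 𝓝 q := by
    rintro q ⟨h1, h2⟩
    have h3 : ∀ᶠ r : Model (n + (l + l)) k (b.crossSection V Q) in 𝓝 q,
        ∀ i, AdaptedBasis.wCoord w r.x i ≠ 0 := by
      refine eventually_all.2 fun i => ?_
      have : Continuous fun q : Model (n + (l + l)) k (b.crossSection V Q) =>
          AdaptedBasis.wCoord w q.x i :=
        (AdaptedBasis.contDiff_wCoord w i).continuous.comp Model.continuous_x
      exact this.continuousAt.eventually_ne (h1 i)
    have h4 : ∀ᶠ r : Model (n + (l + l)) k (b.crossSection V Q) in 𝓝 q, κ₀ r ∈ O :=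
      (AdaptedBasis.morphAt_chart hQP hPoly w q h1).1.preimage_mem_nhds (hOo.mem_nhds h2)
    exact h3.and h4
  have hp₀Ω : p₀ ∈ Ω := ⟨hp₀w, by rw [hκ₀p]; exact hq₀O⟩
  have hfκ : ∀ q ∈ Ω, (f (φ (κ₀ q))).exp = (g j₀ (φ (κ₀ q))).trop := fun q hq =>
    (hOQ _ hq.2).2 (b.trop_chart_mem V hQP w q)
  have hκm : ∀ q ∈ Ω, MorphAt (Model.space _ _ _) B (fun q => φ (κ₀ q)) q := fun q hq =>
    (hφ.localIsoAt _).1.comp (AdaptedBasis.morphAt_chart hQP hPoly w q hq.1)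
  have hiso : ∀ q ∈ Ω, LocalIsoAt (Y := Refined B f) (Model.space _ _ _) (B.refine f)
      (fun q => φ (κ₀ q)) q := by
    intro q hq
    have hforw := (hκm q hq).lift_refine (f := f) (Model.goodAt hPoly q)
      (secAt_of_mem (hdec.mem j₀) (hO _ hq.2).1)
      (mem_of_superset (hΩnhds q hq) fun r hr => hfκ r hr)
    obtain ⟨-, η, hη, hη0, hφη, hηφ⟩ := hφ.localIsoAt (κ₀ q)
    let p' : Refined B f := φ (κ₀ q)
    have hη' : MorphAt (B.refine f) (Model.space n m P) (fun x => η (refinedMap B f x)) p' :=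
      MorphAt.comp (η := η) hη (morphAt_refinedMap p')
    have hη'0 : η (refinedMap B f p') = κ₀ q := hη0
    have hφη' : ∀ᶠ x : Refined B f in 𝓝 p', φ (η (refinedMap B f x)) = refinedMap B f x :=
      continuous_refinedMap.continuousAt.eventually hφη
    have hO' : ∀ᶠ x : Refined B f in 𝓝 p', η (refinedMap B f x) ∈ O :=
      hη'.1.eventually (hOo.mem_nhds (by
        change η (refinedMap B f p') ∈ O
        rw [hη'0]
        exact hq.2))
    have hQ' : ∀ᶠ x : Refined B f in 𝓝 p', (η (refinedMap B f x)).trop ∈ Q := by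
      filter_upwards [hφη', hO', hdec.mem_nhds_face (p := p') (hO _ hq.2).1 (hfκ q hq)]
        with x h1 h2 h3
      refine (hOQ _ h2).1 ?_
      rw [h1]
      exact h3.2
    -- In the refinement the monomials of the constraints have nonnegative exponents near `p'`, so
    -- their smooth parts are continuous. Those of the active ones are nonzero at `p'`, and their
    -- exponents thus remain 0 nearby.
    have hA' : ∀ᶠ x : Refined B f in 𝓝 p', ∀ c ∈ A, affEval c (η (refinedMap B f x)).trop = 0 := by
      refine (eventually_all_finset _).2 fun c hc => ?_
      have h1 := (goodAt_refine p').continuousAt _ (hη'.2 _ (Model.secAt_monomial _ c)) (by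
        filter_upwards [hQ'] with x hx
        rw [trop_monomial]
        exact hx.1 c (Finset.mem_filter.1 hc).1)
      have h2 : (monomial c (η (refinedMap B f p')).z).smoothPart ≠ 0 := by
        rw [ExplUnit.smoothPart_ne_zero_iff, hη'0, trop_monomial]
        change affEval c (κ₀ q).trop = 0
        rw [b.trop_chart]
        exact hAzero c hc _
      filter_upwards [h1.eventually_ne h2] with x hx
      rw [ExplUnit.smoothPart_ne_zero_iff, trop_monomial] at hx
      exact hx
    have hS : ∀ᶠ x : Refined B f in 𝓝 p', b.InStratum V Q (η (refinedMap B f x)) := by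
      filter_upwards [hQ', hA'] with x h1 h2 using hstr _ h1 h2
    have hback := AdaptedBasis.morphAt_chartInv (goodAt_refine p') hη' hS w p₀
    refine ⟨hforw, fun x => b.chartInv V w p₀ (η (refinedMap B f x)), hback, ?_, ?_, ?_⟩
    · change b.chartInv V w p₀ (η (refinedMap B f p')) = q
      rw [hη'0]
      exact b.chartInv_chart V hQP w p₀ q hq.1
    · filter_upwards [hS, hφη'] with x h1 h2
      change φ (b.chart V hQP w (b.chartInv V w p₀ (η (refinedMap B f x)))) = refinedMap B f x
      rw [h1.chart_chartInv hQP w p₀, h2]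
    · have h1 := (AdaptedBasis.morphAt_chart hQP hPoly w q hq.1).1.eventually hηφ
      filter_upwards [h1, hΩnhds q hq] with r h2 h3
      change b.chartInv V w p₀ (η (φ (κ₀ r))) = r
      rw [h2]
      exact b.chartInv_chart V hQP w p₀ r h3.1
  refine ⟨n + (l + l), k, b.crossSection V Q, fun q => φ (κ₀ q), p₀, Ω, g j₀,
    fun q => ∑ j, (g j (φ (κ₀ q)) / g j₀ (φ (κ₀ q))).smoothPart, hPoly, by rwa [hp₀t],
    by dsimp only; rw [hκ₀p], hΩnhds _ hp₀Ω, ?_, hiso, secAt_of_mem (hdec.mem j₀) hpU, ?_, ?_⟩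
  · intro q hq r hr hqr
    have h1 : κ₀ q = κ₀ r := hφ.isOpenEmbedding.injective hqr
    rw [← b.chartInv_chart V hQP w p₀ q hq.1, ← b.chartInv_chart V hQP w p₀ r hr.1]
    exact congrArg _ h1
  · have h1 : Model.SmoothFormAt p₀ fun q j => (g j (φ (κ₀ q)) / g j₀ (φ (κ₀ q))).smoothPart := by
      refine Model.smoothFormAt_pi fun j => Model.smoothFormAt_smoothPart hPoly
        ((hκm p₀ hp₀Ω).2 (fun x => g j x / g j₀ x) ?_) ?_
      · dsimp only
        rw [hκ₀p]
        exact (secAt_of_mem (hdec.mem j) hpU).div (secAt_of_mem (hdec.mem j₀) hpU)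
      · filter_upwards [hΩnhds _ hp₀Ω] with q hq
        rw [ExplUnit.trop_div, ← hfκ q hq]
        exact sub_nonneg.2 (hdec.exp_le _ (hO _ hq.2).1 j)
    exact h1.comp (k := fun y => ∑ j, y j) (ContDiff.smoothNear (by fun_prop) _)
  · exact fun q hq => hdec.coeff_eq _ (hO _ hq.2).1 j₀ (hfκ q hq)

end ExplodedSpace

/-! ### Coordinates adapted to a submersion -/

/-- The real and imaginary parts of `h` are completed to coordinates by a linear projection onto the
kernel of the partial derivative in the real directions. A vector killed by the derivative of `G`
lies in that kernel and has zero projection, hence is 0; the kernel has dimension N - 2 by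
surjectivity. -/
theorem SmoothNear.exists_slice_coordinates {N : ℕ} {E : Type*} [NormedAddCommGroup E]
    [NormedSpace ℝ E] {h : (Fin N → ℝ) × E → ℂ} {y₀ : (Fin N → ℝ) × E} (hh : SmoothNear h y₀)
    (h0 : h y₀ = 0) (hsurj : ∀ c, ∃ ξ, fderiv ℝ h y₀ (ξ, 0) = c) :
    ∃ n, N = 2 + n ∧ ∃ G : (Fin N → ℝ) × E → Fin (2 + n) → ℝ, SmoothNear G y₀ ∧ G y₀ = 0 ∧
      (∀ ξ, fderiv ℝ G y₀ (ξ, 0) = 0 → ξ = 0) ∧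
      ∀ y, h y = 0 ↔ ∀ i : Fin 2, G y (Fin.castAdd n i) = 0 := by
  let T : (Fin N → ℝ) →ₗ[ℝ] ℂ := (fderiv ℝ h y₀).toLinearMap ∘ₗ LinearMap.inl ℝ _ _
  have hT : LinearMap.range T = ⊤ := LinearMap.range_eq_top.2 hsurj
  let K := LinearMap.ker T
  obtain ⟨π, hπ⟩ := LinearMap.exists_leftInverse_of_injective K.subtype K.ker_subtype
  let n := Module.finrank ℝ K
  let e : K ≃ₗ[ℝ] (Fin n → ℝ) := (Module.finBasis ℝ K).equivFun
  let Λ : (Fin N → ℝ) →L[ℝ] (Fin n → ℝ) := (e.toLinearMap ∘ₗ π).toContinuousLinearMap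
  let G : (Fin N → ℝ) × E → Fin (2 + n) → ℝ := fun y =>
    Fin.append ![(h y).re, (h y).im] (Λ (y.1 - y₀.1))
  have hGl : ∀ y i, G y (Fin.castAdd n i) = ![(h y).re, (h y).im] i := fun y i =>
    Fin.append_left _ _ _
  have hGr : ∀ y i, G y (Fin.natAdd 2 i) = Λ (y.1 - y₀.1) i := fun y i =>
    Fin.append_right _ _ _
  have hG : SmoothNear G y₀ := by
    refine smoothNear_pi fun i => ?_
    refine Fin.addCases (fun i => ?_) (fun i => ?_) i
    · simp only [hGl]
      fin_cases i
      · exact SmoothNear.comp (h := fun z : ℂ => z.re)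
          (ContDiff.smoothNear Complex.reCLM.contDiff _) hh
      · exact SmoothNear.comp (h := fun z : ℂ => z.im)
          (ContDiff.smoothNear Complex.imCLM.contDiff _) hh
    · simp only [hGr]
      exact ContDiff.smoothNear (by fun_prop) _
  refine ⟨n, ?_, G, hG, ?_, ?_, ?_⟩
  · have := LinearMap.finrank_range_add_finrank_ker T
    rw [hT, finrank_top, Complex.finrank_real_complex, Module.finrank_fin_fun] at this
    exact this.symm
  · funext i
    refine Fin.addCases (fun i => ?_) (fun i => ?_) i
    · rw [hGl, h0]
      fin_cases i <;> rfl
    · rw [hGr, sub_self, map_zero]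
      rfl
  · intro ξ hξ
    let Ψ : (Fin (2 + n) → ℝ) →L[ℝ] ℂ :=
      (LinearMap.toContinuousLinearMap
        { toFun := fun v => (v (Fin.castAdd n 0) : ℂ) + v (Fin.castAdd n 1) * Complex.I
          map_add' := fun v w => by simp only [Pi.add_apply]; push_cast; ring
          map_smul' := fun a v => by
            simp only [Pi.smul_apply, smul_eq_mul, RingHom.id_apply, Complex.real_smul]
            push_cast
            ring })
    let R : (Fin (2 + n) → ℝ) →L[ℝ] (Fin n → ℝ) :=
      ContinuousLinearMap.pi fun i => ContinuousLinearMap.proj (Fin.natAdd 2 i)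
    have hd := hG.differentiableAt.hasFDerivAt
    have h1 : HasFDerivAt h (Ψ.comp (fderiv ℝ G y₀)) y₀ := by
      refine (Ψ.hasFDerivAt.comp y₀ hd).congr_of_eventuallyEq (Eventually.of_forall fun y => ?_)
      change h y = (G y (Fin.castAdd n 0) : ℂ) + G y (Fin.castAdd n 1) * Complex.I
      rw [hGl, hGl]
      exact (Complex.re_add_im _).symm
    have h2 : HasFDerivAt (fun y : (Fin N → ℝ) × E => Λ (y.1 - y₀.1)) (R.comp (fderiv ℝ G y₀)) y₀ := by
      refine (R.hasFDerivAt.comp y₀ hd).congr_of_eventuallyEq (Eventually.of_forall fun y => ?_)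
      funext i
      exact (hGr y i).symm
    have h3 : HasFDerivAt (fun y : (Fin N → ℝ) × E => Λ (y.1 - y₀.1))
        (Λ.comp (ContinuousLinearMap.fst ℝ _ _)) y₀ :=
      Λ.hasFDerivAt.comp y₀ (hasFDerivAt_fst.sub_const _)
    have h4 : Λ ξ = 0 := by
      have h5 := congrArg (fun D => D (ξ, 0)) (h3.unique h2)
      change Λ ξ = R (fderiv ℝ G y₀ (ξ, 0)) at h5
      rw [h5, hξ, map_zero]
    have h5 : ξ ∈ K := by
      rw [LinearMap.mem_ker]
      change fderiv ℝ h y₀ (ξ, 0) = 0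
      rw [h1.fderiv]
      change Ψ (fderiv ℝ G y₀ (ξ, 0)) = 0
      rw [hξ, map_zero]
    have h6 : π ξ = ⟨ξ, h5⟩ := LinearMap.congr_fun hπ ⟨ξ, h5⟩
    have h7 : e (π ξ) = 0 := h4
    rw [LinearEquiv.map_eq_zero_iff, h6] at h7
    exact congrArg Subtype.val h7
  · intro y
    rw [Fin.forall_fin_two, hGl, hGl]
    exact Complex.ext_iff

/-! ### Subsets of exploded spaces -/

namespace ExplodedSpace

variable {X : Type u} [TopologicalSpace X] {B : ExplodedSpace X}

/-- The exploded structure on a subset whose exploded functions are locally restrictions. -/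
def restrictSet (B : ExplodedSpace X) (S : Set X) : ExplodedSpace S :=
  ofForm (fun V g => ∃ (U : Opens X) (k : X → ExplUnit), k ∈ B.sec U ∧ ∀ q ∈ V, q.1 ∈ U ∧ g q = k q)
    (fun _ _ _ hWV ⟨U, k, hk, h⟩ => ⟨U, k, hk, fun q hq => h q (hWV hq)⟩)
    (fun _ _ _ hfg ⟨U, k, hk, h⟩ => ⟨U, k, hk, fun q hq =>
      ⟨(h q hq).1, (hfg q hq).symm.trans (h q hq).2⟩⟩)
    (fun _ a => ⟨⊤, fun _ => a, B.const _ a, fun _ _ => ⟨trivial, rfl⟩⟩)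
    (fun _ _ _ ⟨U, k, hk, h⟩ ⟨U', k', hk', h'⟩ => ⟨U ⊓ U', k * k',
      (B.sec _).mul_mem (B.restrict _ _ inf_le_left _ hk) (B.restrict _ _ inf_le_right _ hk'),
      fun q hq => ⟨⟨(h q hq).1, (h' q hq).1⟩, congrArg₂ (· * ·) (h q hq).2 (h' q hq).2⟩⟩)
    (fun _ _ ⟨U, k, hk, h⟩ => ⟨U, k⁻¹, (B.sec _).inv_mem hk, fun q hq =>
      ⟨(h q hq).1, congrArg (·⁻¹) (h q hq).2⟩⟩)

theorem secAt_restrictSet_iff {S : Set X} {a : S} {g : S → ExplUnit} :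
    (B.restrictSet S).SecAt a g ↔ ∃ k, B.SecAt a k ∧ ∀ᶠ q in 𝓝 a, g q = k q := by
  constructor
  · rintro ⟨V, ha, hV⟩
    obtain ⟨W, haW, -, U, k, hk, h⟩ := hV a ha
    exact ⟨k, secAt_of_mem hk (h a haW).1,
      mem_of_superset (W.isOpen.mem_nhds haW) fun q hq => (h q hq).2⟩
  · rintro ⟨k, ⟨U, ha, hk⟩, h⟩
    have hU : ∀ᶠ q : S in 𝓝 a, q.1 ∈ U :=
      continuousAt_subtype_val.eventually (U.isOpen.mem_nhds ha)
    obtain ⟨W, hW, hWo, haW⟩ := mem_nhds_iff.1 (h.and hU)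
    exact ⟨⟨W, hWo⟩, haW, fun q hq => ⟨⟨W, hWo⟩, hq, le_rfl, U, k, hk, fun r hr =>
      ⟨(hW hr).2, (hW hr).1⟩⟩⟩

theorem morphAt_subtype_val {S : Set X} (a : S) :
    MorphAt (B.restrictSet S) B Subtype.val a :=
  ⟨continuousAt_subtype_val, fun g hg => secAt_restrictSet_iff.2 ⟨g, hg, .of_forall fun _ => rfl⟩⟩

theorem MorphAt.restrictSet {Y : Type v} [TopologicalSpace Y] {A : ExplodedSpace Y} {θ : Y → X}
    {q : Y} (hθ : MorphAt A B θ q) {S : Set X} (hS : ∀ r, θ r ∈ S) :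
    MorphAt A (B.restrictSet S) (fun r => ⟨θ r, hS r⟩) q := by
  have hc : ContinuousAt (fun r => (⟨θ r, hS r⟩ : S)) q :=
    Topology.IsInducing.subtypeVal.continuousAt_iff.2 hθ.1
  refine ⟨hc, fun g hg => ?_⟩
  obtain ⟨k, hk, h⟩ := secAt_restrictSet_iff.1 hg
  exact (hθ.2 k hk).congr (hc.eventually h)

end ExplodedSpace

/-! ### Slices -/

namespace Model

open ExplodedSpace

variable {n m k : ℕ} {P : Set (Fin m → ℝ)}

/-- The projection `((y, x), z̃) ↦ (x, z̃)`. -/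
def unslice (q : Model (k + n) m P) : Model n m P := ⟨fun i => q.x (Fin.natAdd k i), q.z, q.mem⟩

theorem unslice_slice (q : Model n m P) : (q.slice k).unslice = q := by
  ext1
  · funext i
    exact Fin.append_right _ _ _
  · rfl

theorem slice_unslice {q : Model (k + n) m P} (hq : ∀ i : Fin k, q.x (Fin.castAdd n i) = 0) :
    q.unslice.slice k = q := by
  ext1
  · funext i
    refine Fin.addCases (fun i => ?_) (fun i => ?_) i
    · exact (Fin.append_left _ _ _).trans (hq i).symm
    · exact Fin.append_right _ _ _
  · rfl

theorem slice_x_castAdd (q : Model n m P) (i : Fin k) : (q.slice k).x (Fin.castAdd n i) = 0 :=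
  Fin.append_left _ _ _

theorem morphAt_slice (hP : IsIntegralAffinePolytope P) (q : Model n m P) :
    MorphAt (space n m P) (space (k + n) m P) (slice k) q := by
  have hx : (space n m P).SmoothFnAt q fun r => Fin.append (0 : Fin k → ℝ) r.x := by
    refine (smoothFnAt_x q).comp (k := fun x => Fin.append (0 : Fin k → ℝ) x)
      (ContDiff.smoothNear (contDiff_pi.2 fun i => ?_) _)
    refine Fin.addCases (fun i => ?_) (fun i => ?_) i
    · simp only [Fin.append_left]
      exact contDiff_const
    · simp only [Fin.append_right]
      fun_prop
  exact morphAt_of_components (goodAt hP q) hx fun i => secAt_z q i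

theorem morphAt_unslice (hP : IsIntegralAffinePolytope P) (q : Model (k + n) m P) :
    MorphAt (space (k + n) m P) (space n m P) unslice q := by
  have hx : (space (k + n) m P).SmoothFnAt q fun r (i : Fin n) => r.x (Fin.natAdd k i) :=
    (smoothFnAt_x q).comp
      (k := fun (x : Fin (k + n) → ℝ) (i : Fin n) => x (Fin.natAdd k i))
      (ContDiff.smoothNear (by fun_prop) _)
  exact morphAt_of_components (goodAt hP q) hx fun i => secAt_z q i

end Model

namespace ExplodedSpace

variable {X : Type u} [TopologicalSpace X] {B : ExplodedSpace X}

theorem IsOpenIso.restrictSet_slice {n m k : ℕ} {P : Set (Fin m → ℝ)}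
    (hP : IsIntegralAffinePolytope P) {φ : Model (k + n) m P → X}
    (hφ : (Model.space (k + n) m P).IsOpenIso B φ) {S : Set X}
    (hS : ∀ q, φ q ∈ S ↔ ∀ i : Fin k, q.x (Fin.castAdd n i) = 0) :
    (Model.space n m P).IsOpenIso (B.restrictSet S)
      fun q => ⟨φ (q.slice k), (hS _).2 q.slice_x_castAdd⟩ := by
  refine isOpenIso_of_localIsoAt (fun q r hqr => ?_) fun q => ?_
  · have h1 : φ (q.slice k) = φ (r.slice k) := congrArg Subtype.val hqr
    rw [← q.unslice_slice (k := k), hφ.isOpenEmbedding.injective h1, r.unslice_slice]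
  · obtain ⟨h1, η, h2, h3, h4, h5⟩ := hφ.localIsoAt (q.slice k)
    have hm : MorphAt (B.restrictSet S) (Model.space (k + n) m P) (fun a => η a.1)
        ⟨φ (q.slice k), (hS _).2 q.slice_x_castAdd⟩ :=
      MorphAt.comp (θ := Subtype.val) h2 (morphAt_subtype_val _)
    refine ⟨(h1.comp (Model.morphAt_slice hP q)).restrictSet _, fun a => (η a.1).unslice,
      MorphAt.comp (Model.morphAt_unslice hP _) hm, ?_, ?_, ?_⟩
    · dsimp only
      rw [h3, q.unslice_slice]
    · have h6 : ∀ᶠ a : S in 𝓝 ⟨φ (q.slice k), (hS _).2 q.slice_x_castAdd⟩, φ (η a.1) = a.1 :=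
        (continuous_subtype_val.tendsto (⟨φ (q.slice k), (hS _).2 q.slice_x_castAdd⟩ : S)).eventually h4
      filter_upwards [h6] with a ha
      refine Subtype.ext ?_
      dsimp only
      rw [Model.slice_unslice ((hS _).1 (by rw [ha]; exact a.2)), ha]
    · have h6 : ∀ᶠ r : Model n m P in 𝓝 q, η (φ (r.slice k)) = r.slice k :=
        (Model.morphAt_slice hP q).1.eventually h5
      filter_upwards [h6] with r hr
      rw [hr, r.unslice_slice]

/-- A subset that is a slice in suitable charts is an embedded submanifold. -/
theorem isEmbeddingOfCodim_restrictSet {k : ℕ} {S : Set X}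
    (h : ∀ p ∈ S, ∃ (n m : ℕ) (P : Set (Fin m → ℝ)) (φ : Model (k + n) m P → X),
      IsIntegralAffinePolytope P ∧ (Model.space (k + n) m P).IsOpenIso B φ ∧ p ∈ Set.range φ ∧
      ∀ q, φ q ∈ S ↔ ∀ i : Fin k, q.x (Fin.castAdd n i) = 0) :
    (B.restrictSet S).IsEmbeddingOfCodim B k Subtype.val := by
  have hslice : ∀ a : S, ∃ (n m : ℕ) (P : Set (Fin m → ℝ))
      (ψ : Model n m P → S) (φ : Model (k + n) m P → X), IsIntegralAffinePolytope P ∧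
      (Model.space n m P).IsOpenIso (B.restrictSet S) ψ ∧ (Model.space (k + n) m P).IsOpenIso B φ ∧
      a ∈ Set.range ψ ∧ (∀ q, (ψ q).1 = φ (q.slice k)) ∧
      ∀ q, φ q ∈ Set.range (Subtype.val : S → X) ↔ ∀ i : Fin k, q.x (Fin.castAdd n i) = 0 := by
    rintro ⟨p, hp⟩
    obtain ⟨n, m, P, φ, hP, hφ, ⟨q, rfl⟩, hS⟩ := h p hp
    refine ⟨n, m, P, _, φ, hP, hφ.restrictSet_slice hP hS, hφ, ⟨q.unslice, ?_⟩, fun q => rfl,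
      fun q => by rw [Subtype.range_coe]; exact hS q⟩
    exact Subtype.ext (congrArg φ (Model.slice_unslice ((hS q).1 hp)))
  refine ⟨fun a => ?_, isMorphism_of_morphAt morphAt_subtype_val, .subtypeVal, hslice⟩
  obtain ⟨n, m, P, ψ, φ, hP, hψ, -, ha, -⟩ := hslice a
  exact ⟨n, m, P, ψ, hP, hψ, ha⟩

/-! ### The zero set of a transverse tropical function -/

theorem isOpenIso_comp_of_injOn {n m : ℕ} {P : Set (Fin m → ℝ)} {κ : Model n m P → X}
    {Ω : Set (Model n m P)} (hinj : Ω.InjOn κ)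
    (hκ : ∀ q ∈ Ω, LocalIsoAt (Model.space n m P) B κ q) {Θ : Model n m P → Model n m P}
    (hΘ : (Model.space n m P).IsOpenIso (Model.space n m P) Θ) (hΩ : Set.range Θ ⊆ Ω) :
    (Model.space n m P).IsOpenIso B fun q => κ (Θ q) :=
  isOpenIso_of_localIsoAt
    (fun q r hqr => hΘ.isOpenEmbedding.injective (hinj (hΩ ⟨q, rfl⟩) (hΩ ⟨r, rfl⟩) hqr))
    fun q => (hκ _ (hΩ ⟨q, rfl⟩)).comp (hΘ.localIsoAt q)

theorem TropicalAt.comp_morphAt {Y : Type v} [TopologicalSpace Y] {A : ExplodedSpace Y} {θ : Y → X}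
    {q : Y} {f : X → Expl} (hf : B.TropicalAt (θ q) f) (hθ : MorphAt A B θ q) :
    A.TropicalAt q fun r => f (θ r) := by
  obtain ⟨g₀, l, h0, hl, h⟩ := tropicalAt_iff.1 hf
  refine tropicalAt_iff.2 ⟨fun r => g₀ (θ r), l.map fun g r => g (θ r), hθ.2 _ h0, ?_, ?_⟩
  · intro g hg
    obtain ⟨g', hg', rfl⟩ := List.mem_map.1 hg
    exact hθ.2 _ (hl _ hg')
  · filter_upwards [hθ.1.eventually h] with r hr
    rw [hr, List.foldl_map]

variable {f : X → Expl}

theorem isExplodedManifold_refine (hB : B.IsExplodedManifold) (hf : B.IsTropicalOn ⊤ f) :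
    (B.refine f).IsExplodedManifold := by
  intro p
  obtain ⟨n, m, P, κ, p₀, Ω, g, H, hP, hp₀, rfl, hΩ, hinj, hκ, -⟩ := exists_chart_refine hB hf p
  -- Straightening the function x - p₀.x, without any monomials, recentres the parametrization and
  -- shrinks it to an injective one on a whole model.
  obtain ⟨Θ, hΘ, hΘΩ, ⟨q, hq⟩, -⟩ := Model.exists_isOpenIso_straighten hP hp₀
    (ι := Fin 0) Fin.elim0 (h := fun y => y.1 - p₀.x) (ContDiff.smoothNear (by fun_prop) _)
    (sub_self _) (fun ξ hξ => by
      rw [(hasFDerivAt_fst.sub_const _).fderiv] at hξ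
      exact hξ) hΩ
  exact ⟨n, m, P, _, hP, isOpenIso_comp_of_injOn hinj hκ hΘ hΘΩ, q, congrArg κ hq⟩

theorem isRefinement_refine (hB : B.IsExplodedManifold) (hf : B.IsTropicalOn ⊤ f) :
    (B.refine f).IsRefinement B (refinedMap B f) where
  isExplodedManifold := isExplodedManifold_refine hB hf
  isMorphism := isMorphism_of_morphAt morphAt_refinedMap
  isProper := isProperMap_smoothPartMap_refinedMap hB hf
  bijective := Function.bijective_id
  derivSurjective := derivSurjectiveAt_refinedMap hB hf

/-- A tangent vector sending `f` to coefficient g · c lifts to the refinement and is the velocity of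
a model curve. As `h` vanishes at the centre, the derivative of the coefficient g · h along the
curve is g times that of `h`, and the unit g cancels. -/
theorem TransverseToZero.exists_fderiv_eq (htr : B.TransverseToZero f) (hB : B.IsExplodedManifold)
    (hf : B.IsTropicalOn ⊤ f) {n m : ℕ} {P : Set (Fin m → ℝ)} {κ : Model n m P → Refined B f}
    {p₀ : Model n m P} (hp₀ : p₀.trop ∈ interior P)
    (hκ : LocalIsoAt (Model.space n m P) (B.refine f) κ p₀) {g : X → ExplUnit}
    (hg : B.SecAt (κ p₀) g) {ι : Type} [Fintype ι] (ζ : ι → NonnegMonomial P)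
    {h : (Fin n → ℝ) × (ι → ℂ) → ℂ} (hh : SmoothNear h (p₀.x, fun i => Model.zeta (ζ i) p₀))
    (h0 : h (p₀.x, fun i => Model.zeta (ζ i) p₀) = 0)
    (hfg : ∀ᶠ q in 𝓝 p₀,
      (f (κ q)).coeff = (g (κ q)).1 * h (q.x, fun i => Model.zeta (ζ i) q)) (c : ℂ) :
    ∃ ξ, fderiv ℝ h (p₀.x, fun i => Model.zeta (ζ i) p₀) (ξ, 0) = c := by
  have hcoeff : (f (κ p₀)).coeff = 0 := by rw [hfg.self_of_nhds, h0, mul_zero]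
  obtain ⟨w, hw⟩ := htr (refinedMap B f (κ p₀)) hcoeff ((g (κ p₀)).1 * c)
  obtain ⟨v, -, hv⟩ := derivSurjectiveAt_refinedMap hB hf (κ p₀) w
  have hfp : B.TropicalAt (refinedMap B f (κ p₀)) f := ⟨⊤, trivial, hf⟩
  obtain ⟨ξ, lam, h1, -⟩ := TangentVector.exists_eq_curve goodAt_refine hκ v
  have h2 := h1 _ (hfp.comp_morphAt (morphAt_refinedMap _))
  have h3 := (hv f hfp).trans hw
  have h4 := congrArg Expl.coeff (h2.symm.trans h3)
  refine ⟨ξ, ?_⟩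
  have hder := Model.hasDerivAt_smoothForm_curve p₀ ξ lam ζ hh (EventuallyEq.refl _ _)
  -- Over the interior of `P` the smooth monomials have zero velocity: each one vanishes at `p₀` or
  -- is the trivial monomial. So the real directions alone account for surjectivity.
  have hzero : (fun i => Model.logDot (ζ i).1 lam * Model.zeta (ζ i) p₀) = 0 := by
    funext i
    rcases Model.zeta_eq_zero_or_eq_one hp₀ (ζ i) with ⟨-, h5⟩ | h5
    · rw [h5, mul_zero, Pi.zero_apply]
    · have h6 : affEval (ζ i).1 p₀.trop = 0 := by
        have h7 : (monomial (ζ i).1 p₀.z).smoothPart ≠ 0 := (h5 p₀).trans_ne one_ne_zero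
        rwa [ExplUnit.smoothPart_ne_zero_iff, trop_monomial] at h7
      rw [Model.eq_zero_of_affEval_eq_zero hp₀ (ζ i) h6]
      simp [Model.logDot]
  rw [hzero] at hder
  have hgd := ((Model.curveAt p₀ ξ lam).map hκ.1).differentiableAt _
    (secAt_refine_of_secAt (f := f) hg)
  have hmul := hgd.hasDerivAt.mul hder
  have h7 : deriv (fun s => (f (κ (p₀.curve ξ lam s))).coeff) 0 =
      (g (κ p₀)).1 * fderiv ℝ h (p₀.x, fun i => Model.zeta (ζ i) p₀) (ξ, 0) := by
    refine HasDerivAt.deriv ((hmul.congr_deriv ?_).congr_of_eventuallyEq ?_)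
    · rw [Model.curve_zero, h0, mul_zero, zero_add]
    · exact (Model.continuousAt_curve p₀ ξ lam).eventually (by rw [Model.curve_zero]; exact hfg)
  have h8 : (g (κ p₀)).1 * fderiv ℝ h (p₀.x, fun i => Model.zeta (ζ i) p₀) (ξ, 0) =
      (g (κ p₀)).1 * c := h7.symm.trans h4
  exact mul_left_cancel₀ (Units.ne_zero _) h8

/-- The coefficient of `f` is a unit times `h`, so its zero set is that of `h`, whose real and
imaginary parts become the first two coordinates after straightening. -/
theorem TransverseToZero.exists_slice_chart (htr : B.TransverseToZero f)
    (hB : B.IsExplodedManifold) (hf : B.IsTropicalOn ⊤ f) {p : Refined B f}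
    (hp : (f p).coeff = 0) :
    ∃ (n m : ℕ) (P : Set (Fin m → ℝ)) (φ : Model (2 + n) m P → Refined B f),
      IsIntegralAffinePolytope P ∧ (Model.space (2 + n) m P).IsOpenIso (B.refine f) φ ∧
      p ∈ Set.range φ ∧
      ∀ q, (f (φ q)).coeff = 0 ↔ ∀ i : Fin 2, q.x (Fin.castAdd n i) = 0 := by
  obtain ⟨N, m, P, κ, p₀, Ω, g, H, hP, hp₀, rfl, hΩ, hinj, hκ, hg, ⟨ι, _, ζ, h, hh, hH⟩, hfg⟩ :=
    exists_chart_refine hB hf p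
  have hΩ' : ∀ᶠ q in 𝓝 p₀, q ∈ Ω ∧
      (f (κ q)).coeff = (g (κ q)).1 * h (q.x, fun i => Model.zeta (ζ i) q) := by
    filter_upwards [hΩ, hH] with q h1 h2
    exact ⟨h1, by rw [hfg q h1, h2]⟩
  have h0 : h (p₀.x, fun i => Model.zeta (ζ i) p₀) = 0 := by
    have h1 := hΩ'.self_of_nhds.2
    rw [hp] at h1
    exact (mul_eq_zero.1 h1.symm).resolve_left (Units.ne_zero _)
  obtain ⟨n, rfl, G, hG, hG0, hGinj, hGh⟩ := hh.exists_slice_coordinates h0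
    (htr.exists_fderiv_eq hB hf hp₀ (hκ _ (mem_of_mem_nhds hΩ)) hg ζ hh h0
      (hΩ'.mono fun _ h => h.2))
  obtain ⟨Θ, hΘ, hΘΩ, ⟨q, hq⟩, hΘG⟩ :=
    Model.exists_isOpenIso_straighten hP hp₀ ζ hG hG0 hGinj hΩ'
  refine ⟨n, m, P, fun q => κ (Θ q), hP, isOpenIso_comp_of_injOn hinj hκ hΘ
    (hΘΩ.trans fun q hq => hq.1), ⟨q, congrArg κ hq⟩, fun q => ?_⟩
  rw [(hΘΩ ⟨q, rfl⟩).2, mul_eq_zero, or_iff_right (Units.ne_zero _), hGh]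
  exact forall_congr' fun i => hΘG q _

end ExplodedSpace

end

theorem mainTheorem2 {X : Type u} [TopologicalSpace X] (B : ExplodedSpace X)
    (hB : B.IsExplodedManifold) (f : X → Expl) (hf : B.IsTropicalOn ⊤ f)
    (htr : B.TransverseToZero f) :
    B.IsExplodedSubmanifold 2 {p : X | (f p).coeff = 0} := by
  let S : Set (ExplodedSpace.Refined B f) := {p | (f p).coeff = 0}
  refine ⟨ExplodedSpace.Refined B f, inferInstance, B.refine f, ExplodedSpace.refinedMap B f,
    S, inferInstance, (B.refine f).restrictSet S, Subtype.val,
    ExplodedSpace.isRefinement_refine hB hf,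
    ExplodedSpace.isEmbeddingOfCodim_restrictSet fun p hp => htr.exists_slice_chart hB hf hp,
    ?_, fun h => ?_⟩
  · exact (Set.range_comp _ _).trans (by rw [Subtype.range_coe]; exact Set.image_id _)
  -- A smooth part is Hausdorff exactly when the space is R1; this property passes to the
  -- refinement, and from there to the subspace.
  · have : R1Space X := SeparationQuotient.t2Space_iff.1 h
    have := ExplodedSpace.r1Space_refined (B := B) hf
    exact ⟨SeparationQuotient.t2Space_iff.2 this, SeparationQuotient.t2Space_iff.2 inferInstance⟩
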